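/- **Conventions.** All metrics are smooth ($C^\infty$). For a surface $H$ in a Riemannian 3-manifold $(\Sigma,h)$, $\mu$ is the induced metric, $R[\mu]$ its Ricci scalar, and $k_{ij}$ the extrinsic curvature, $X^iY^jk_{ij}=X^iY^jD_in_j$ for $X,Y$ tangent to $H$, where $n$ is the unit normal covector and $D$ the Levi-Civita connection of $h$. The improper Riemann integral over $D\subset\mathbb R^2$ of a function $f$ that is continuous on $D$ is the limit (if it exists) of $\int_K f$ as the compact Jordan measurable sets $K\subset D$ exhaust $D$; it diverges to $+\infty$ if these integrals tend to $+\infty$. A *horizon cross-section $H\subset\Sigma$ with an $A_3$ caustic* is one for which there are smooth coordinates $(x,y,z)$ on a neighbourhood of the caustic point in the Riemannian 3-manifold $(\Sigma,h)$ in which the $A_3$ point is the origin and $H$ is the image of $\{q\le 2p^2\}$ under $(p,q)\mapsto(4p^3-2qp,\;q,\;3p^4-qp^2)$. The crease is $q=2p^2$, $p\neq0$ (where $(p,q)$ and $(-p,q)$ give the same point). Put $\Delta=12p^2-2q$. **(1) Generic cross-section.** Let $H$ be such a cross-section in $(\Sigma,h)$. There are $a_0>0$ and $C$ such that for every $0<a<a_0$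 the following holds. The points of $H$ with $|p|,|q|\le a$ form a neighbourhood of the $A_3$ point in $H$, and $(p,q)$ are injective parameters on its smooth part $D_a=\{|p|\le a,\ |q|\le a,\ q<2p^2\}$. With $\mu=\det\mu_{AB}$ computed in the parameters $(p,q)$, on $D_a$ $$|R[\mu]|\le C/\Delta,\qquad 0<\sqrt\mu\le C\Delta,\qquad |\sqrt\mu\,R[\mu]|\le C .$$ The function $\sqrt\mu\,R[\mu]$ extends continuously to $\{|p|\le a,\ |q|\le a,\ q\le2p^2\}$, i.e. to the $A_3$ point and to each of the two sides of the crease. The integral $\int_{D_a}\sqrt\mu\,R[\mu]\,dp\,dq$ (the contribution to the Gauss–Bonnet entropy from a neighbourhood of the $A_3$ point) exists as an improper Riemann integral. The integrals of $\sqrt\mu\,k^i_ik^j_j$ and of $\sqrt\mu\,k^{ij}k_{ij}$ over $D_a$ also exist (are finite) as improper Riemann integrals. **(2) $A_3$ perestroika.** Let $g$ be a Lorentzian metric of signature $(-,+,+,+)$ on an open neighbourhood of the origin in $\mathbb R^4$, with coordinates $(w,x,y,z)$ in which a future horizon has its canonical form near an $A_3$ point: $\mathcal H$ is the image of $\{q\le2p^2\}$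 under $(w,p,q)\mapsto(w,\;4p^3-2qp,\;q,\;3p^4-qp^2)$, so that the $A_3$ line is $x=y=z=0$. Let $\tau$ be a smooth time function ($d\tau$ is timelike; the future is the direction of increasing $\tau$). $\mathcal H$ is null at its smooth points $q<2p^2$, i.e. its normal $dz-p\,dx-p^2\,dy$ is null there, and it is future null ruled: from each of its points there starts a future-directed null curve that stays in $\mathcal H$. Let $\tau$ have an $A_3$ perestroika at the origin at the instant $\tau=0$: $\tau(0)=0$, and the level set $\Sigma_0$ of $\tau$ is tangent to the $A_3$ line at the origin with nondegenerate tangency, $\partial_w\tau(0)=0\ne\partial_w^2\tau(0)$. Write $\Sigma_t=\{\tau=t\}$ with its induced metric. Then there are $a_0,\delta>0$ and $C$ such that near the origin, for $|t|<\delta$, $\Sigma_t$ is a graph $y=Y_t(w,x,z)$ with $Y$ jointly smooth in $t$ and $(w,x,z)$, and the cross-section $H_t=\Sigma_t\cap\mathcal H$ is parametrised by $(p,r)$ through $w=r$, $q=Q_t(p,r)$, subject to $q\le 2p^2$, with $Q$ jointly smooth in $(t,p,r)$ on $|t|<\delta$, $|p|,|r|<a_0$; for each $0<a<a_0$ the points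 with $|p|,|r|\le a$ cover all of $\mathcal H\cap\Sigma_t$ near the origin for $t$ near $0$, and the parametrisation is injective on $D_{t,a}=\{|p|\le a,\ |r|\le a,\ Q_t(p,r)<2p^2\}$. With $\Delta=12p^2-2Q_t(p,r)$ and $\sqrt\mu$ computed in the parameters $(p,r)$: (a) for all $|t|<\delta$ (in particular at the perestroika $t=0$) and $0<a<a_0$, on $D_{t,a}$ $$|R[\mu]|\le C/\Delta,\qquad 0<\sqrt\mu\le C\Delta,\qquad|\sqrt\mu R[\mu]|\le C,$$ $\sqrt\mu R[\mu]$ extends continuously to $\{|p|\le a,\ |r|\le a,\ Q_t\le2p^2\}$, and $\int_{D_{t,a}}\sqrt\mu R[\mu]\,dp\,dr$ exists as an improper Riemann integral; (b) at $t=0$, for every $0<a<a_0$, the improper integrals of $\sqrt\mu\,k^i_ik^j_j$ and of $\sqrt\mu\,k^{ij}k_{ij}$ over $D_{0,a}$ diverge to $+\infty$; (c) if the perestroika is the crease-disappearing one, i.e. $\partial_w^2\tau(0)<0$ (a finite section of crease with $A_3$ endpoints is present for $\tau<0$ and has vanished for $\tau>0$), then there is $c>0$ such that for every $0<a<a_0$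 the integrals $S_1(t)$ of $\sqrt\mu\,k^i_ik^j_j$ and $S_2(t)$ of $\sqrt\mu\,k^{ij}k_{ij}$ over $D_{t,a}$ exist as improper Riemann integrals for $0<t<\delta$, and $$\frac{S_1(t)}{\log t}\to-c,\qquad\frac{S_2(t)}{\log t}\to-c\qquad(t\to0^+).$$ -/

import Mathlib

open Set Filter MeasureTheory Topology
open scoped ContDiff

namespace A3Caustic

noncomputable section

/-! ### Metrics and curvature in coordinates -/

/-- The partial derivative of `f` in the `i`-th coordinate direction. -/
def pd {n : ℕ} (i : Fin n) (f : (Fin n → ℝ) → ℝ) (x : Fin n → ℝ) : ℝ :=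
  fderiv ℝ f x (Pi.single i 1)

/-- The components of a metric tensor, as functions on a coordinate space. -/
abbrev MetricField (n : ℕ) := (Fin n → ℝ) → Matrix (Fin n) (Fin n) ℝ

/-- All components of the metric are smooth on `U`. -/
def SmoothOn {n : ℕ} (g : MetricField n) (U : Set (Fin n → ℝ)) : Prop :=
  ∀ i j, ContDiffOn ℝ ∞ (fun x => g x i j) U

/-- Christoffel symbols `Γ^k_{ij}` of the Levi-Civita connection. -/
def christoffel {n : ℕ} (g : MetricField n) (k i j : Fin n) (x : Fin n → ℝ) : ℝ :=
  (1 / 2) * ∑ l, (g x)⁻¹ k l *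
    (pd i (fun y => g y l j) x + pd j (fun y => g y l i) x - pd l (fun y => g y i j) x)

/-- Riemann tensor `R^k_{lij} = ∂_i Γ^k_{jl} - ∂_j Γ^k_{il} + Γ^k_{im} Γ^m_{jl} - Γ^k_{jm} Γ^m_{il}`. -/
def riemann {n : ℕ} (g : MetricField n) (k l i j : Fin n) (x : Fin n → ℝ) : ℝ :=
  pd i (christoffel g k j l) x - pd j (christoffel g k i l) x
    + ∑ m, (christoffel g k i m x * christoffel g m j l x
      - christoffel g k j m x * christoffel g m i l x)

/-- Ricci tensor `R_{lj} = R^k_{lkj}`. -/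
def ricci {n : ℕ} (g : MetricField n) (l j : Fin n) (x : Fin n → ℝ) : ℝ :=
  ∑ k, riemann g k l k j x

/-- Ricci scalar. -/
def ricciScalar {n : ℕ} (g : MetricField n) (x : Fin n → ℝ) : ℝ :=
  ∑ l, ∑ j, (g x)⁻¹ l j * ricci g l j x

/-- The metric induced from `g` by a map `f` of coordinate spaces. -/
def pullback {m n : ℕ} (g : MetricField n) (f : (Fin m → ℝ) → (Fin n → ℝ)) : MetricField m :=
  fun u => Matrix.of fun a b =>
    ∑ i, ∑ j, g (f u) i j * pd a (fun v => f v i) u * pd b (fun v => f v j) u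

/-- The pairing `g^{ij} α_i β_j` of two covectors at `x`. -/
def coPair {n : ℕ} (g : MetricField n) (x α β : Fin n → ℝ) : ℝ :=
  ∑ i, ∑ j, (g x)⁻¹ i j * α i * β j

/-! ### Geometry of a parametrised surface `F` in a Riemannian 3-space with metric `h` -/

/-- The tangent vector `∂F/∂u^a`. -/
def tangent (F : (Fin 2 → ℝ) → (Fin 3 → ℝ)) (a : Fin 2) (u : Fin 2 → ℝ) : Fin 3 → ℝ :=
  fun i => pd a (fun v => F v i) u

/-- A covector annihilating both tangent vectors (their coordinate cross product). -/
def conormal (F : (Fin 2 → ℝ) → (Fin 3 → ℝ)) (u : Fin 2 → ℝ) : Fin 3 → ℝ :=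
  crossProduct (tangent F 0 u) (tangent F 1 u)

/-- The unit normal covector `n_i`, with `h^{ij} n_i n_j = 1`. -/
def unitNormal (h : MetricField 3) (F : (Fin 2 → ℝ) → (Fin 3 → ℝ)) (u : Fin 2 → ℝ) : Fin 3 → ℝ :=
  (Real.sqrt (coPair h (F u) (conormal F u) (conormal F u)))⁻¹ • conormal F u

/-- The extrinsic curvature `k(∂_a, ∂_b) = (∂_a)^i (∂_b)^j D_i n_j`, with `D` the Levi-Civita
connection of `h`. -/
def extrinsic (h : MetricField 3) (F : (Fin 2 → ℝ) → (Fin 3 → ℝ)) (a b : Fin 2)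
    (u : Fin 2 → ℝ) : ℝ :=
  ∑ j, tangent F b u j * (pd a (fun v => unitNormal h F v j) u
    - ∑ i, ∑ k, christoffel h k i j (F u) * tangent F a u i * unitNormal h F u k)

/-- The area density `√μ` of the induced metric, in the parameters `u`. -/
def areaDensity (h : MetricField 3) (F : (Fin 2 → ℝ) → (Fin 3 → ℝ)) (u : Fin 2 → ℝ) : ℝ :=
  Real.sqrt (pullback h F u).det

/-- The Ricci scalar `R[μ]` of the induced metric. -/
def surfaceRicci (h : MetricField 3) (F : (Fin 2 → ℝ) → (Fin 3 → ℝ)) (u : Fin 2 → ℝ) : ℝ :=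
  ricciScalar (pullback h F) u

/-- `k^i_i`. -/
def traceK (h : MetricField 3) (F : (Fin 2 → ℝ) → (Fin 3 → ℝ)) (u : Fin 2 → ℝ) : ℝ :=
  ∑ a, ∑ b, (pullback h F u)⁻¹ a b * extrinsic h F a b u

/-- `k^{ij} k_{ij}`. -/
def normSqK (h : MetricField 3) (F : (Fin 2 → ℝ) → (Fin 3 → ℝ)) (u : Fin 2 → ℝ) : ℝ :=
  ∑ a, ∑ b, ∑ c, ∑ d, (pullback h F u)⁻¹ a c * (pullback h F u)⁻¹ b d
    * extrinsic h F a b u * extrinsic h F c d u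

/-- The integrand `√μ R[μ]`. -/
def gbDensity (h : MetricField 3) (F : (Fin 2 → ℝ) → (Fin 3 → ℝ)) (u : Fin 2 → ℝ) : ℝ :=
  areaDensity h F u * surfaceRicci h F u

/-- The integrand `√μ k^i_i k^j_j`. -/
def traceSqDensity (h : MetricField 3) (F : (Fin 2 → ℝ) → (Fin 3 → ℝ)) (u : Fin 2 → ℝ) : ℝ :=
  areaDensity h F u * traceK h F u ^ 2

/-- The integrand `√μ k^{ij} k_{ij}`. -/
def normSqDensity (h : MetricField 3) (F : (Fin 2 → ℝ) → (Fin 3 → ℝ)) (u : Fin 2 → ℝ) : ℝ :=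
  areaDensity h F u * normSqK h F u

/-! ### Improper Riemann integrals in the plane -/

/-- `I` is the improper Riemann integral of `f` over `D`: `f` is continuous on `D`, and the
integrals over the compact Jordan measurable sets `K ⊆ D` converge to `I` as `K` exhausts `D`
(on such a `K` the continuous function `f` is Riemann integrable, with the integral below). -/
def HasImproperIntegral (f : (Fin 2 → ℝ) → ℝ) (D : Set (Fin 2 → ℝ)) (I : ℝ) : Prop :=
  ContinuousOn f D ∧ ∀ ε > 0, ∃ K₀ ⊆ D, IsCompact K₀ ∧
    ∀ K, IsCompact K → volume (frontier K) = 0 → K₀ ⊆ K → K ⊆ D → |(∫ u in K, f u) - I| < ε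

/-- The improper Riemann integral of the continuous function `f` over `D` diverges to `+∞`. -/
def ImproperIntegralDiverges (f : (Fin 2 → ℝ) → ℝ) (D : Set (Fin 2 → ℝ)) : Prop :=
  ContinuousOn f D ∧ ∀ M : ℝ, ∃ K₀ ⊆ D, IsCompact K₀ ∧
    ∀ K, IsCompact K → volume (frontier K) = 0 → K₀ ⊆ K → K ⊆ D → M ≤ ∫ u in K, f u

/-! ### The `A₃` caustic -/

/-- The canonical form of a wavefront near an `A₃` point, in coordinates `(x, y, z)`;
`u = (p, q)`. -/
def swallowtail (u : Fin 2 → ℝ) : Fin 3 → ℝ :=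
  ![4 * u 0 ^ 3 - 2 * u 1 * u 0, u 1, 3 * u 0 ^ 4 - u 1 * u 0 ^ 2]

/-- The canonical form of a horizon cross-section near an `A₃` point at the origin: the part
`q ≤ 2 p ^ 2` of the wavefront that does not lie beyond its self-intersection (the crease). -/
def crossSection : Set (Fin 3 → ℝ) :=
  {P | ∃ u : Fin 2 → ℝ, u 1 ≤ 2 * u 0 ^ 2 ∧ P = swallowtail u}

/-- The canonical form of the big wavefront near an `A₃` point, in spacetime coordinates
`(w, x, y, z)`. The `A₃` line is `x = y = z = 0`. -/
def bigWavefront (w p q : ℝ) : Fin 4 → ℝ :=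
  ![w, 4 * p ^ 3 - 2 * q * p, q, 3 * p ^ 4 - q * p ^ 2]

/-- The canonical form of the horizon near an `A₃` point. -/
def horizon : Set (Fin 4 → ℝ) :=
  {P | ∃ w p q : ℝ, q ≤ 2 * p ^ 2 ∧ P = bigWavefront w p q}

/-- On a surface of parameters `u`, with `p = u 0` and `q = Q u`, the smooth part `q < 2 p ^ 2`
(crease and `A₃` points removed) of the window `|u 0|, |u 1| ≤ a`. -/
def smoothRegion (Q : (Fin 2 → ℝ) → ℝ) (a : ℝ) : Set (Fin 2 → ℝ) :=
  {u | |u 0| ≤ a ∧ |u 1| ≤ a ∧ Q u < 2 * u 0 ^ 2}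

/-- As `smoothRegion`, with the two sides of the crease, and the `A₃` points, added. -/
def closedRegion (Q : (Fin 2 → ℝ) → ℝ) (a : ℝ) : Set (Fin 2 → ℝ) :=
  {u | |u 0| ≤ a ∧ |u 1| ≤ a ∧ Q u ≤ 2 * u 0 ^ 2}

/-- `Δ = 12 p ^ 2 - 2 q`. -/
def Delta (Q : (Fin 2 → ℝ) → ℝ) (u : Fin 2 → ℝ) : ℝ := 12 * u 0 ^ 2 - 2 * Q u

/-- The estimates for the Ricci scalar, and the existence of the Gauss-Bonnet integral, for the
surface `F` in the window of size `a`, with constant `C`. -/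
structure GaussBonnetRegular (h : MetricField 3) (F : (Fin 2 → ℝ) → (Fin 3 → ℝ))
    (Q : (Fin 2 → ℝ) → ℝ) (a C : ℝ) : Prop where
  /-- `R[μ] = O(1/Δ)` -/
  ricci_le : ∀ u ∈ smoothRegion Q a, |surfaceRicci h F u| ≤ C / Delta Q u
  /-- the induced metric is nondegenerate -/
  area_pos : ∀ u ∈ smoothRegion Q a, 0 < areaDensity h F u
  /-- `√μ = O(Δ)` -/
  area_le : ∀ u ∈ smoothRegion Q a, areaDensity h F u ≤ C * Delta Q u
  /-- `√μ R[μ]` is bounded -/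
  gb_le : ∀ u ∈ smoothRegion Q a, |gbDensity h F u| ≤ C
  /-- `√μ R[μ]` extends continuously to the `A₃` points and to each side of the crease -/
  gb_extends : ∃ G : (Fin 2 → ℝ) → ℝ,
    ContinuousOn G (closedRegion Q a) ∧ EqOn (gbDensity h F) G (smoothRegion Q a)
  /-- the integral of `√μ R[μ]` exists as an improper Riemann integral -/
  gb_integral : ∃ I : ℝ, HasImproperIntegral (gbDensity h F) (smoothRegion Q a) I

/-! ### The `A₃` perestroika -/

/-- A symmetric matrix of signature `(-, +, +, +)`. -/
def IsLorentzian (g : Matrix (Fin 4) (Fin 4) ℝ) : Prop :=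
  ∃ P : Matrix (Fin 4) (Fin 4) ℝ, IsUnit P.det ∧ P.transpose * g * P = Matrix.diagonal ![-1, 1, 1, 1]

/-- The differential `dτ`, as a covector. -/
def grad {n : ℕ} (τ : (Fin n → ℝ) → ℝ) (x : Fin n → ℝ) : Fin n → ℝ := fun i => pd i τ x

/-- On the patch `U` of a spacetime with metric `g`, with coordinates in which a future horizon
has its canonical form near an `A₃` point at the origin, the time function `τ` has an
`A₃` perestroika at the origin, at the instant `τ = 0`. -/
structure IsA3Perestroika (U : Set (Fin 4 → ℝ)) (g : MetricField 4) (τ : (Fin 4 → ℝ) → ℝ) :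
    Prop where
  isOpen : IsOpen U
  zero_mem : (0 : Fin 4 → ℝ) ∈ U
  smooth_metric : SmoothOn g U
  lorentzian : ∀ x ∈ U, IsLorentzian (g x)
  smooth_time : ContDiffOn ℝ ∞ τ U
  /-- the level sets of `τ` are spacelike -/
  timelike : ∀ x ∈ U, coPair g x (grad τ x) (grad τ x) < 0
  /-- the horizon is null where it is smooth: its normal `dz - p dx - p² dy` is null there -/
  null : ∀ w p q : ℝ, q < 2 * p ^ 2 → bigWavefront w p q ∈ U →
    coPair g (bigWavefront w p q) ![0, -p, -p ^ 2, 1] ![0, -p, -p ^ 2, 1] = 0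
  /-- the horizon is future null ruled: from each of its points there starts a future-directed
  null curve that stays in the horizon (the future is the direction of increasing `τ`) -/
  ruled : ∀ P ∈ horizon ∩ U, ∃ (γ : ℝ → Fin 4 → ℝ) (ε : ℝ), 0 < ε ∧ γ 0 = P ∧
    ∀ s ∈ Ico 0 ε, γ s ∈ horizon ∩ U ∧ ∃ v : Fin 4 → ℝ, HasDerivWithinAt γ v (Ici s) s ∧
      ∑ i, ∑ j, g (γ s) i j * v i * v j = 0 ∧ 0 < ∑ i, grad τ (γ s) i * v i
  time_zero : τ 0 = 0
  /-- the level set of `τ` is tangent to the `A₃` line at the origin, -/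
  tangency : pd 0 τ 0 = 0
  /-- and the tangency is nondegenerate -/
  nondegenerate : pd 0 (pd 0 τ) 0 ≠ 0

/-- The `A₃` perestroika describes the disappearance of a finite section of crease with `A₃`
endpoints: the restriction of `τ` to the `A₃` line has a nondegenerate maximum, so that the
`A₃` points are present for `τ < 0` and absent for `τ > 0`. -/
def CreaseDisappears (τ : (Fin 4 → ℝ) → ℝ) : Prop := pd 0 (pd 0 τ) 0 < 0

/-- The embedding of the surface `y = Y(w, x, z)`, with `s = (w, x, z)` as coordinates on it. -/
def slice (Y : (Fin 3 → ℝ) → ℝ) (s : Fin 3 → ℝ) : Fin 4 → ℝ := ![s 0, s 1, Y s, s 2]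

/-- The parametrisation of the cross-section by `u = (p, r)`, where `w = r` and `q = Q(p, r)`, in
the coordinates `(w, x, z)`. -/
def sliceSurface (Q : (Fin 2 → ℝ) → ℝ) (u : Fin 2 → ℝ) : Fin 3 → ℝ :=
  ![u 1, 4 * u 0 ^ 3 - 2 * Q u * u 0, 3 * u 0 ^ 4 - Q u * u 0 ^ 2]

/-- Near the origin, for `|t| < δ`, the surface `τ = t` is `y = Y t (w, x, z)`, and the horizon
cross-section in it is parametrised by `(p, r)` as the part `Q t ≤ 2 p ^ 2` of the surface
`w = r`, `q = Q t (p, r)`. -/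
structure IsSliceParam (U : Set (Fin 4 → ℝ)) (τ : (Fin 4 → ℝ) → ℝ) (a₀ ρ δ : ℝ)
    (Y : ℝ → (Fin 3 → ℝ) → ℝ) (Q : ℝ → (Fin 2 → ℝ) → ℝ) : Prop where
  smooth_Y : ContDiffOn ℝ ∞ (fun v : ℝ × (Fin 3 → ℝ) => Y v.1 v.2)
    (Ioo (-δ) δ ×ˢ Metric.ball 0 ρ)
  slice_mem : ∀ t ∈ Ioo (-δ) δ, ∀ s ∈ Metric.ball (0 : Fin 3 → ℝ) ρ,
    slice (Y t) s ∈ U ∧ τ (slice (Y t) s) = t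
  slice_covers : ∀ᶠ P in 𝓝 (0 : Fin 4 → ℝ), P = slice (Y (τ P)) ![P 0, P 1, P 3]
  smooth_Q : ContDiffOn ℝ ∞ (fun v : ℝ × (Fin 2 → ℝ) => Q v.1 v.2)
    (Ioo (-δ) δ ×ˢ Metric.ball 0 a₀)
  surface_mem : ∀ t ∈ Ioo (-δ) δ, ∀ u ∈ Metric.ball (0 : Fin 2 → ℝ) a₀,
    sliceSurface (Q t) u ∈ Metric.ball 0 ρ ∧
    slice (Y t) (sliceSurface (Q t) u) = bigWavefront (u 1) (u 0) (Q t u)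
  surface_inj : ∀ t ∈ Ioo (-δ) δ, ∀ a ∈ Ioo 0 a₀,
    InjOn (sliceSurface (Q t)) (smoothRegion (Q t) a)
  surface_covers : ∀ a ∈ Ioo 0 a₀, ∀ᶠ P in 𝓝[horizon] (0 : Fin 4 → ℝ),
    τ P ∈ Ioo (-δ) δ ∧
      ∃ u ∈ closedRegion (Q (τ P)) a, P = bigWavefront (u 1) (u 0) (Q (τ P) u)

end

end A3Caustic

open A3Caustic

/-! Both halves rest on one structure, `FoldedFamily`: surfaces F with ∂_0 F = Δ e, where e and ∂_1
F stay independent even where Δ = 0. The swallowtail has it with e = (1, 0, p). So has a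
cross-section q = Q_t(p, r) of the big wavefront: at fixed q the p-derivative of the wavefront is Δ
times a smooth vector, so differentiating τ = t in p gives ∂_p Q = Δ φ with φ smooth.

In the frame (e, ∂_1 F) the Gram matrix and the unit normal are smooth across Δ = 0, and √μ = Δ W
with W > 0. Since ∂_0 ∂_1 F = ∂_1(Δ e), Brioschi's curvature expression is divisible by Δ³, so √μ R
= 2X/W³ with X smooth (`FoldedFamily.gbDensity_eq`). All claims about R follow, with constants
obtained from continuity at the origin. The extrinsic curvature, by contrast, is a continuous matrix
divided by Δ in this frame. Hence √μ (tr k)² = Θ₁/Δ and √μ |k|² = Θ₂/Δ with continuous Θ₁, Θ₂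
(`FoldedFamily.traceSqDensity_eq`, `FoldedFamily.normSqDensity_eq`); where Δ = 0 only one entry of
the matrix survives, and Θ₁ = Θ₂.

What remains is the integral of 1/Δ. For an isolated A₃ point, Δ ≥ p² + |q| on the smooth part, and
this is integrable. For a perestroika, Q_t(p, r) = (t − ½ τ_ww r²)/τ_y + o(|t| + p² + r²)
(`IsA3Perestroika.eventually_height`). At t = 0 this makes Δ at most a multiple of p² on a cone |r|
≤ k p, and ∫ dp/p diverges. If τ_ww < 0, then Q_t ≈ −b t − κ r² with b, κ > 0. For t > 0 the smooth
region is then the whole window, Δ ≈ 2bt + 12p² + 2κr², and the integral of 1/Δ is asymptotic to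
−π/√(24κ) log t (`tendsto_integral_modelDelta`).

The sign τ_y < 0 used here is causal (`IsA3Perestroika.pd_time_neg`). Each crease point carries two
conormals, with parameters p and −p, both null; in the limit at the A₃ point this gives g³³ = g¹³ =
0 and g¹¹ = 2g²³ > 0. A future null curve on the horizon starting at the crease cannot pass below
the other sheet, which fixes its direction along the raised conormal and hence the sign of τ_y. -/

namespace A3Caustic

/-! ### Partial derivatives -/

section PartialDerivatives

variable {n : ℕ} {f g : (Fin n → ℝ) → ℝ} {x : Fin n → ℝ}

theorem pd_add (i : Fin n) (hf : DifferentiableAt ℝ f x) (hg : DifferentiableAt ℝ g x) :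
    pd i (fun y => f y + g y) x = pd i f x + pd i g x := by
  simp [pd, fderiv_fun_add hf hg]

theorem pd_sub (i : Fin n) (hf : DifferentiableAt ℝ f x) (hg : DifferentiableAt ℝ g x) :
    pd i (fun y => f y - g y) x = pd i f x - pd i g x := by
  simp [pd, fderiv_fun_sub hf hg]

theorem pd_mul (i : Fin n) (hf : DifferentiableAt ℝ f x) (hg : DifferentiableAt ℝ g x) :
    pd i (fun y => f y * g y) x = pd i f x * g x + f x * pd i g x := by
  simp [pd, fderiv_fun_mul hf hg]; ring

theorem pd_const (i : Fin n) (c : ℝ) : pd i (fun _ => c) x = 0 := by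
  simp [pd]

theorem pd_coord (i j : Fin n) : pd i (fun y => y j) x = if j = i then 1 else 0 := by
  have : HasFDerivAt (fun y : Fin n → ℝ => y j) (ContinuousLinearMap.proj (R := ℝ) j) x :=
    (ContinuousLinearMap.proj (R := ℝ) (φ := fun _ : Fin n => ℝ) j).hasFDerivAt
  simp [pd, this.fderiv, Pi.single_apply]

theorem pd_pow (i : Fin n) (m : ℕ) (hf : DifferentiableAt ℝ f x) :
    pd i (fun y => f y ^ m) x = m * f x ^ (m - 1) * pd i f x := by
  simp [pd, fderiv_fun_pow m hf]

theorem pd_div (i : Fin n) (hf : DifferentiableAt ℝ f x) (hg : DifferentiableAt ℝ g x)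
    (h0 : g x ≠ 0) :
    pd i (fun y => f y / g y) x = (pd i f x * g x - f x * pd i g x) / g x ^ 2 := by
  have h1 : HasFDerivAt (fun y => (g y)⁻¹) ((-(g x ^ 2)⁻¹) • fderiv ℝ g x) x :=
    (hasDerivAt_inv h0).comp_hasFDerivAt x hg.hasFDerivAt
  have h2 : pd i (fun y => (g y)⁻¹) x = -(g x ^ 2)⁻¹ * pd i g x := by simp [pd, h1.fderiv]
  simp only [div_eq_mul_inv]
  rw [pd_mul i hf h1.differentiableAt, h2]
  field_simp
  ring

theorem pd_sum {ι : Type*} (s : Finset ι) (F : ι → (Fin n → ℝ) → ℝ) (i : Fin n)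
    (hF : ∀ k ∈ s, DifferentiableAt ℝ (F k) x) :
    pd i (fun y => ∑ k ∈ s, F k y) x = ∑ k ∈ s, pd i (F k) x := by
  simp [pd, fderiv_fun_sum hF]

theorem pd_congr (i : Fin n) (h : f =ᶠ[𝓝 x] g) : pd i f x = pd i g x := by
  simp [pd, h.fderiv_eq]

theorem pd_eventuallyEq (i : Fin n) (h : f =ᶠ[𝓝 x] g) : pd i f =ᶠ[𝓝 x] pd i g :=
  h.eventuallyEq_nhds.mono fun _ hy => pd_congr i hy

theorem pd_comp {m : ℕ} (i : Fin m) {F : (Fin m → ℝ) → (Fin n → ℝ)} {u : Fin m → ℝ}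
    (hf : DifferentiableAt ℝ f (F u)) (hF : DifferentiableAt ℝ F u) :
    pd i (fun v => f (F v)) u = ∑ k, pd k f (F u) * pd i (fun v => F v k) u := by
  have h1 : fderiv ℝ (fun v => f (F v)) u = (fderiv ℝ f (F u)).comp (fderiv ℝ F u) :=
    fderiv_comp u hf hF
  have h2 : ∀ k, pd i (fun v => F v k) u = fderiv ℝ F u (Pi.single i 1) k := by
    intro k
    have := (hasFDerivAt_pi'.1 hF.hasFDerivAt k).fderiv
    simp only [pd, this]
    rfl
  simp only [h2]
  rw [pd, h1, ContinuousLinearMap.comp_apply]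
  conv_lhs => rw [← Finset.univ_sum_single (fderiv ℝ F u (Pi.single i 1)), map_sum]
  refine Finset.sum_congr rfl fun k _ => ?_
  have : Pi.single (M := fun _ : Fin n => ℝ) k (fderiv ℝ F u (Pi.single i 1) k)
      = (fderiv ℝ F u (Pi.single i 1) k) • Pi.single (M := fun _ : Fin n => ℝ) k (1 : ℝ) := by
    rw [← Pi.single_smul, smul_eq_mul, mul_one]
  rw [this, map_smul, smul_eq_mul, mul_comm]; rfl

theorem pd_comm (i j : Fin n) (hf : ContDiffAt ℝ ∞ f x) :
    pd i (pd j f) x = pd j (pd i f) x := by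
  have hd : DifferentiableAt ℝ (fderiv ℝ f) x :=
    (hf.fderiv_right (m := ∞) (by simp)).differentiableAt (by simp)
  have hs : IsSymmSndFDerivAt ℝ f x := hf.isSymmSndFDerivAt (by simpa using ENat.LEInfty.out)
  have key : ∀ i j, pd i (pd j f) x = fderiv ℝ (fderiv ℝ f) x (Pi.single i 1) (Pi.single j 1) := by
    intro i j
    have : fderiv ℝ (fun y => fderiv ℝ f y (Pi.single j 1)) x
        = (fderiv ℝ (fderiv ℝ f) x).flip (Pi.single j 1) := by
      rw [fderiv_clm_apply hd (differentiableAt_const _)]; simp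
    show fderiv ℝ (fun y => fderiv ℝ f y (Pi.single j 1)) x _ = _
    rw [this]; rfl
  rw [key, key, hs.eq]

theorem contDiffAt_pd (i : Fin n) (hf : ContDiffAt ℝ ∞ f x) : ContDiffAt ℝ ∞ (pd i f) x :=
  (hf.fderiv_right (m := ∞) (by simp)).clm_apply contDiffAt_const

end PartialDerivatives

/-! ### Smooth families of functions -/

section Families

variable {n : ℕ} {Ω : Set (ℝ × (Fin n → ℝ))} {f : ℝ → (Fin n → ℝ) → ℝ}

/-- The family `f t` of functions on a coordinate space is jointly smooth on `Ω`. -/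
abbrev SmoothFamily {n : ℕ} (f : ℝ → (Fin n → ℝ) → ℝ) (Ω : Set (ℝ × (Fin n → ℝ))) : Prop :=
  ContDiffOn ℝ ∞ (fun v : ℝ × (Fin n → ℝ) => f v.1 v.2) Ω

theorem SmoothFamily.contDiffAt (hf : SmoothFamily f Ω) (hΩ : IsOpen Ω) {t : ℝ} {u : Fin n → ℝ}
    (h : (t, u) ∈ Ω) : ContDiffAt ℝ ∞ (f t) u := by
  have h1 : ContDiffAt ℝ ∞ (fun v : ℝ × (Fin n → ℝ) => f v.1 v.2) (t, u) :=
    ContDiffOn.contDiffAt hf (hΩ.mem_nhds h)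
  have h2 : ContDiffAt ℝ ∞ (fun y : Fin n → ℝ => (t, y)) u := by fun_prop
  exact ContDiffAt.comp (g := fun v : ℝ × (Fin n → ℝ) => f v.1 v.2)
    (f := fun y : Fin n → ℝ => (t, y)) u h1 h2

theorem SmoothFamily.differentiableAt (hf : SmoothFamily f Ω) (hΩ : IsOpen Ω) {t : ℝ}
    {u : Fin n → ℝ} (h : (t, u) ∈ Ω) : DifferentiableAt ℝ (f t) u :=
  (hf.contDiffAt hΩ h).differentiableAt (by simp)

theorem SmoothFamily.pd (hf : SmoothFamily f Ω) (hΩ : IsOpen Ω) (i : Fin n) :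
    SmoothFamily (fun t => pd i (f t)) Ω := by
  have h1 : ContDiffOn ℝ ∞ (fun v => fderiv ℝ (fun v : ℝ × (Fin n → ℝ) => f v.1 v.2) v
      (0, Pi.single i 1)) Ω :=
    (ContDiffOn.fderiv_of_isOpen hf hΩ (m := ∞) (by simp)).clm_apply contDiffOn_const
  refine h1.congr ?_
  rintro ⟨t, u⟩ h
  have h1 : DifferentiableAt ℝ (fun v : ℝ × (Fin n → ℝ) => f v.1 v.2) (t, u) :=
    (ContDiffOn.contDiffAt hf (hΩ.mem_nhds h)).differentiableAt (by simp)
  have h2 : HasFDerivAt (fun y : Fin n → ℝ => (t, y))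
      (ContinuousLinearMap.inr ℝ ℝ (Fin n → ℝ)) u := hasFDerivAt_prodMk_right t u
  have h3 := (h1.hasFDerivAt.comp u h2).fderiv
  have h4 : fderiv ℝ (f t) u = (fderiv ℝ (fun v : ℝ × (Fin n → ℝ) => f v.1 v.2) (t, u)).comp
      (ContinuousLinearMap.inr ℝ ℝ (Fin n → ℝ)) := h3
  simp [A3Caustic.pd, h4]

end Families

/-! ### Smoothness of matrix inverses -/

section Inverse

variable {E : Type*} [NormedAddCommGroup E] [NormedSpace ℝ E] {n : ℕ}

theorem contDiffOn_det {M : E → Matrix (Fin n) (Fin n) ℝ} {s : Set E}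
    (hM : ∀ i j, ContDiffOn ℝ ∞ (fun v => M v i j) s) :
    ContDiffOn ℝ ∞ (fun v => (M v).det) s := by
  simp only [Matrix.det_apply']
  exact ContDiffOn.sum fun σ _ => contDiffOn_const.mul
    (contDiffOn_prod fun i _ => hM _ _)

theorem contDiffOn_matrix_inv {M : E → Matrix (Fin n) (Fin n) ℝ} {s : Set E}
    (hM : ∀ i j, ContDiffOn ℝ ∞ (fun v => M v i j) s) (h0 : ∀ v ∈ s, (M v).det ≠ 0)
    (i j : Fin n) : ContDiffOn ℝ ∞ (fun v => (M v)⁻¹ i j) s := by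
  simp only [Matrix.inv_def, Ring.inverse_eq_inv', Matrix.smul_apply, smul_eq_mul,
    Matrix.adjugate_apply]
  refine ((contDiffOn_det hM).inv h0).mul (contDiffOn_det fun k l => ?_)
  by_cases hk : k = j
  · subst hk
    simpa using contDiffOn_const
  · simpa [Matrix.updateRow_apply, hk] using hM k l

end Inverse

/-! ### The Ricci scalar of a surface -/

section Locality

variable {n : ℕ} {g g' : MetricField n} {x : Fin n → ℝ}

/-- The pullback metric agrees with its folded normal form only near each parameter point, so
curvature must be seen to depend on the germ of the metric alone. -/
theorem christoffel_eventuallyEq (h : g =ᶠ[𝓝 x] g') (k i j : Fin n) :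
    christoffel g k i j =ᶠ[𝓝 x] christoffel g' k i j := by
  have hc : ∀ a b, (fun y => g y a b) =ᶠ[𝓝 x] fun y => g' y a b := fun a b =>
    h.mono fun y hy => by simp only [hy]
  have hp : ∀ c a b, pd c (fun y => g y a b) =ᶠ[𝓝 x] pd c (fun y => g' y a b) := fun c a b =>
    pd_eventuallyEq c (hc a b)
  have hp' : ∀ᶠ y in 𝓝 x, ∀ c a b, pd c (fun y => g y a b) y = pd c (fun y => g' y a b) y := by
    simp only [eventually_all]; exact hp
  filter_upwards [h, hp'] with y h1 h2
  simp only [christoffel, h1, h2]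

theorem riemann_congr (h : g =ᶠ[𝓝 x] g') (k l i j : Fin n) :
    riemann g k l i j x = riemann g' k l i j x := by
  simp only [riemann, pd_congr _ (christoffel_eventuallyEq h _ _ _),
    (christoffel_eventuallyEq h _ _ _).eq_of_nhds]

theorem ricciScalar_congr (h : g =ᶠ[𝓝 x] g') : ricciScalar g x = ricciScalar g' x := by
  simp only [ricciScalar, ricci, riemann_congr h, h.eq_of_nhds]

end Locality

/-- The metric `E du² + 2 F du dv + G dv²`. -/
def metricEFG (E F G : (Fin 2 → ℝ) → ℝ) : MetricField 2 := fun y => !![E y, F y; F y, G y]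

section Surface

variable {E F G : (Fin 2 → ℝ) → ℝ}

/-- A closed form over the common denominator 2(EG − F²) reduces the derivatives in the Riemann
tensor to the quotient rule. Where the determinant vanishes both sides are 0, by the default values
of the inverse and of division. -/
theorem christoffel_metricEFG (k i j : Fin 2) :
    christoffel (metricEFG E F G) k i j = fun y =>
      (![![![G y * pd 0 E y - F y * (2 * pd 0 F y - pd 1 E y), G y * pd 1 E y - F y * pd 0 G y],
          ![G y * pd 1 E y - F y * pd 0 G y, G y * (2 * pd 1 F y - pd 0 G y) - F y * pd 1 G y]],
        ![![E y * (2 * pd 0 F y - pd 1 E y) - F y * pd 0 E y, E y * pd 0 G y - F y * pd 1 E y],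
          ![E y * pd 0 G y - F y * pd 1 E y, E y * pd 1 G y - F y * (2 * pd 1 F y - pd 0 G y)]]]
        k i j) / (2 * (E y * G y - F y * F y)) := by
  funext y
  fin_cases k <;> fin_cases i <;> fin_cases j <;>
  simp [christoffel, metricEFG, Matrix.inv_def, Matrix.det_fin_two, Matrix.adjugate_fin_two, div_eq_mul_inv] <;>
  ring

/-- Brioschi's expression for the Gauss curvature times the square of the determinant. -/
noncomputable def brioschi (E F G E₀ E₁ F₀ F₁ G₀ G₁ E₁₁ F₀₁ G₀₀ : ℝ) : ℝ :=
  (-E₁₁ / 2 + F₀₁ - G₀₀ / 2) * (E * G - F * F)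
    - E₀ / 2 * ((F₁ - G₀ / 2) * G - F * G₁ / 2)
    + (F₀ - E₁ / 2) * ((F₁ - G₀ / 2) * F - E * G₁ / 2)
    + E₁ / 2 * (E₁ * G / 2 - F * G₀ / 2) - G₀ / 2 * (E₁ * F / 2 - E * G₀ / 2)

theorem ricciScalar_metricEFG {x : Fin 2 → ℝ} (hE : ContDiffAt ℝ ∞ E x)
    (hF : ContDiffAt ℝ ∞ F x) (hG : ContDiffAt ℝ ∞ G x) (hd : E x * G x - F x * F x ≠ 0) :
    ricciScalar (metricEFG E F G) x =
      2 * brioschi (E x) (F x) (G x) (pd 0 E x) (pd 1 E x) (pd 0 F x) (pd 1 F x)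
        (pd 0 G x) (pd 1 G x) (pd 1 (pd 1 E) x) (pd 0 (pd 1 F) x) (pd 0 (pd 0 G) x)
        / (E x * G x - F x * F x) ^ 2 := by
  have dE := hE.differentiableAt (by simp)
  have dF := hF.differentiableAt (by simp)
  have dG := hG.differentiableAt (by simp)
  have dE' : ∀ i, DifferentiableAt ℝ (pd i E) x := fun i =>
    (contDiffAt_pd i hE).differentiableAt (by simp)
  have dF' : ∀ i, DifferentiableAt ℝ (pd i F) x := fun i =>
    (contDiffAt_pd i hF).differentiableAt (by simp)
  have dG' : ∀ i, DifferentiableAt ℝ (pd i G) x := fun i =>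
    (contDiffAt_pd i hG).differentiableAt (by simp)
  have cE : pd 1 (pd 0 E) x = pd 0 (pd 1 E) x := pd_comm _ _ hE
  have cF : pd 1 (pd 0 F) x = pd 0 (pd 1 F) x := pd_comm _ _ hF
  have cG : pd 1 (pd 0 G) x = pd 0 (pd 1 G) x := pd_comm _ _ hG
  have hd2 : 2 * (E x * G x - F x * F x) ≠ 0 := mul_ne_zero two_ne_zero hd
  have i00 : (metricEFG E F G x)⁻¹ 0 0 = G x / (E x * G x - F x * F x) := by
    simp [metricEFG, Matrix.inv_def, Matrix.det_fin_two, Matrix.adjugate_fin_two]; ring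
  have i01 : (metricEFG E F G x)⁻¹ 0 1 = -F x / (E x * G x - F x * F x) := by
    simp [metricEFG, Matrix.inv_def, Matrix.det_fin_two, Matrix.adjugate_fin_two]; ring
  have i10 : (metricEFG E F G x)⁻¹ 1 0 = -F x / (E x * G x - F x * F x) := by
    simp [metricEFG, Matrix.inv_def, Matrix.det_fin_two, Matrix.adjugate_fin_two]; ring
  have i11 : (metricEFG E F G x)⁻¹ 1 1 = E x / (E x * G x - F x * F x) := by
    simp [metricEFG, Matrix.inv_def, Matrix.det_fin_two, Matrix.adjugate_fin_two]; ring
  simp only [ricciScalar, ricci, riemann, Fin.sum_univ_two, i00, i01, i10, i11,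
    christoffel_metricEFG, Matrix.cons_val_zero, Matrix.cons_val_one, sub_self]
  simp (disch := first | assumption | fun_prop) only [pd_div, pd_mul, pd_sub, pd_const, cE, cF, cG]
  generalize pd 0 (pd 0 E) x = E00
  generalize pd 0 (pd 1 E) x = E01
  generalize pd 1 (pd 1 E) x = E11
  generalize pd 0 (pd 0 F) x = F00
  generalize pd 0 (pd 1 F) x = F01
  generalize pd 1 (pd 1 F) x = F11
  generalize pd 0 (pd 0 G) x = G00
  generalize pd 0 (pd 1 G) x = G01
  generalize pd 1 (pd 1 G) x = G11
  generalize pd 0 E x = E0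
  generalize pd 1 E x = E1
  generalize pd 0 F x = F0
  generalize pd 1 F x = F1
  generalize pd 0 G x = G0
  generalize pd 1 G x = G1
  generalize E x = e at *
  generalize F x = f at *
  generalize G x = g at *
  clear * - hd
  unfold brioschi
  -- The determinant stays a single symbol while denominators are cleared, and is expanded only for
  -- the final polynomial identity.
  generalize hD : e * g - f * f = D at *
  field_simp
  subst hD
  ring

end Surface

/-! ### Surfaces with a folded parametrisation -/

theorem SmoothFamily.comp {m n : ℕ} {Ω : Set (ℝ × (Fin m → ℝ))} {V : Set (ℝ × (Fin n → ℝ))}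
    {f : ℝ → (Fin n → ℝ) → ℝ} {F : ℝ → (Fin m → ℝ) → Fin n → ℝ} (hf : SmoothFamily f V)
    (hF : ∀ i, SmoothFamily (fun t u => F t u i) Ω) (hm : ∀ v ∈ Ω, (v.1, F v.1 v.2) ∈ V) :
    SmoothFamily (fun t u => f t (F t u)) Ω := by
  have h1 : ContDiffOn ℝ ∞ (fun v : ℝ × (Fin m → ℝ) => (v.1, F v.1 v.2)) Ω :=
    contDiffOn_fst.prodMk (contDiffOn_pi.2 hF)
  exact ContDiffOn.comp (g := fun v : ℝ × (Fin n → ℝ) => f v.1 v.2)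
    (f := fun v : ℝ × (Fin m → ℝ) => (v.1, F v.1 v.2)) hf h1 hm

theorem SmoothFamily.christoffel {n : ℕ} {h : ℝ → MetricField n} {V : Set (ℝ × (Fin n → ℝ))}
    (hV : IsOpen V) (hh : ∀ i j, SmoothFamily (fun t x => h t x i j) V)
    (h0 : ∀ v ∈ V, (h v.1 v.2).det ≠ 0) (k i j : Fin n) :
    SmoothFamily (fun t => christoffel (h t) k i j) V := by
  have h1 : ∀ i j, ContDiffOn ℝ ∞ (fun v : ℝ × (Fin n → ℝ) => (h v.1 v.2)⁻¹ i j) V :=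
    contDiffOn_matrix_inv (M := fun v : ℝ × (Fin n → ℝ) => h v.1 v.2) hh h0
  have h2 : ∀ c i j, ContDiffOn ℝ ∞
      (fun v : ℝ × (Fin n → ℝ) => A3Caustic.pd c (fun y => h v.1 y i j) v.2) V :=
    fun c i j => SmoothFamily.pd (hh i j) hV c
  exact contDiffOn_const.mul (ContDiffOn.sum fun l _ =>
    (h1 k l).mul (((h2 i l j).add (h2 j l i)).sub (h2 l i j)))

/-- A family of surfaces `F t` in 3-spaces with metrics `h t`, folded in the sense that
`∂F/∂u⁰ = Δ e` with `e` independent of `∂F/∂u¹`. -/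
structure FoldedFamily (Ω : Set (ℝ × (Fin 2 → ℝ))) (V : Set (ℝ × (Fin 3 → ℝ)))
    (h : ℝ → MetricField 3) (F : ℝ → (Fin 2 → ℝ) → Fin 3 → ℝ) (Δ : ℝ → (Fin 2 → ℝ) → ℝ)
    (e : ℝ → (Fin 2 → ℝ) → Fin 3 → ℝ) : Prop where
  isOpen_dom : IsOpen Ω
  isOpen_cod : IsOpen V
  smooth_h : ∀ i j, SmoothFamily (fun t x => h t x i j) V
  posDef : ∀ v ∈ V, (h v.1 v.2).PosDef
  smooth_F : ∀ i, SmoothFamily (fun t u => F t u i) Ω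
  mapsTo : ∀ v ∈ Ω, (v.1, F v.1 v.2) ∈ V
  smooth_Δ : SmoothFamily Δ Ω
  smooth_e : ∀ i, SmoothFamily (fun t u => e t u i) Ω
  fold : ∀ t u, (t, u) ∈ Ω → ∀ i, pd 0 (fun v => F t v i) u = Δ t u * e t u i
  indep : ∀ t u, (t, u) ∈ Ω → crossProduct (e t u) (tangent (F t) 1 u) ≠ 0

/-- The pairing `h_{ij} X^i Y^j` along `F`. -/
def gram (h : MetricField 3) (F X Y : (Fin 2 → ℝ) → Fin 3 → ℝ) (u : Fin 2 → ℝ) : ℝ :=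
  ∑ i, ∑ j, h (F u) i j * X u i * Y u j

/-- The normal covector `e × ∂F/∂u¹`. -/
noncomputable def foldNormal (F e : (Fin 2 → ℝ) → Fin 3 → ℝ) (u : Fin 2 → ℝ) : Fin 3 → ℝ :=
  crossProduct (e u) (tangent F 1 u)

/-- The unit normal covector, which extends smoothly to `Δ = 0`. -/
noncomputable def foldUnitNormal (h : MetricField 3) (F e : (Fin 2 → ℝ) → Fin 3 → ℝ) (u : Fin 2 → ℝ) :
    Fin 3 → ℝ :=
  (Real.sqrt (coPair h (F u) (foldNormal F e u) (foldNormal F e u)))⁻¹ • foldNormal F e u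

theorem gram_pos_of_ne {M : Matrix (Fin 3) (Fin 3) ℝ} (hM : M.PosDef) {X : Fin 3 → ℝ}
    (hX : X ≠ 0) : 0 < ∑ i, ∑ j, M i j * X i * X j := by
  have := hM.dotProduct_mulVec_pos hX
  simp only [dotProduct, Matrix.mulVec, star_trivial, Finset.mul_sum] at this
  refine this.trans_eq (Finset.sum_congr rfl fun i _ => Finset.sum_congr rfl fun j _ => ?_)
  ring

/-- Strict Cauchy–Schwarz: with A, B, D the entries of the Gram matrix, the form takes the value
D(AD − B²) on the nonzero vector D X − B Y. -/
theorem gram_det_pos {M : Matrix (Fin 3) (Fin 3) ℝ} (hM : M.PosDef) {X Y : Fin 3 → ℝ}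
    (hXY : crossProduct X Y ≠ 0) :
    0 < (∑ i, ∑ j, M i j * X i * X j) * (∑ i, ∑ j, M i j * Y i * Y j)
      - (∑ i, ∑ j, M i j * X i * Y j) ^ 2 := by
  have hs : ∀ i j, M i j = M j i := fun i j => by
    have := congrFun (congrFun hM.isHermitian j) i
    simpa using this
  have hY : Y ≠ 0 := by rintro rfl; simp at hXY
  set A := ∑ i, ∑ j, M i j * X i * X j with hA
  set B := ∑ i, ∑ j, M i j * X i * Y j with hB
  set D := ∑ i, ∑ j, M i j * Y i * Y j with hD
  have hDp : 0 < D := gram_pos_of_ne hM hY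
  have hZ : D • X - B • Y ≠ 0 := by
    intro h
    apply hXY
    have h1 : D • X = B • Y := sub_eq_zero.1 h
    have h2 : D • crossProduct X Y = 0 := by
      rw [← LinearMap.smul_apply, ← map_smul, h1, map_smul, LinearMap.smul_apply, cross_self,
        smul_zero]
    exact (smul_eq_zero.1 h2).resolve_left hDp.ne'
  have h2 := gram_pos_of_ne hM hZ
  have h3 : ∀ a b : ℝ, ∑ i, ∑ j, M i j * (a • X - b • Y) i * (a • X - b • Y) j
      = a ^ 2 * A - 2 * a * b * B + b ^ 2 * D := by
    intro a b
    simp only [hA, hB, hD, Fin.sum_univ_three, Pi.sub_apply, Pi.smul_apply, smul_eq_mul]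
    rw [hs 1 0, hs 2 0, hs 2 1]
    ring
  have h4 : D ^ 2 * A - 2 * D * B * B + B ^ 2 * D = D * (A * D - B ^ 2) := by ring
  rw [h3, h4] at h2
  exact pos_of_mul_pos_right h2 hDp.le

/-! ### Smoothness of the Gram matrix and the unit normal of a fold -/

namespace FoldedFamily

variable {Ω : Set (ℝ × (Fin 2 → ℝ))} {V : Set (ℝ × (Fin 3 → ℝ))}
  {h : ℝ → MetricField 3} {F : ℝ → (Fin 2 → ℝ) → Fin 3 → ℝ} {Δ : ℝ → (Fin 2 → ℝ) → ℝ}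
  {e : ℝ → (Fin 2 → ℝ) → Fin 3 → ℝ}

section Smoothness

theorem symm (H : FoldedFamily Ω V h F Δ e) {t : ℝ} {x : Fin 3 → ℝ} (hx : (t, x) ∈ V)
    (i j : Fin 3) : h t x i j = h t x j i := by
  have := congrFun (congrFun (H.posDef _ hx).isHermitian j) i
  simpa using this

theorem smooth_hF (H : FoldedFamily Ω V h F Δ e) (i j : Fin 3) :
    SmoothFamily (fun t u => h t (F t u) i j) Ω :=
  SmoothFamily.comp (H.smooth_h i j) H.smooth_F H.mapsTo

theorem smooth_pd_hF (H : FoldedFamily Ω V h F Δ e) (k i j : Fin 3) :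
    SmoothFamily (fun t u => pd k (fun x => h t x i j) (F t u)) Ω :=
  SmoothFamily.comp (SmoothFamily.pd (H.smooth_h i j) H.isOpen_cod k) H.smooth_F H.mapsTo

theorem smooth_christoffel (H : FoldedFamily Ω V h F Δ e) (k i j : Fin 3) :
    SmoothFamily (fun t u => christoffel (h t) k i j (F t u)) Ω :=
  SmoothFamily.comp (SmoothFamily.christoffel H.isOpen_cod H.smooth_h
    (fun v hv => (H.posDef v hv).det_pos.ne') k i j) H.smooth_F H.mapsTo

theorem smooth_tangent (H : FoldedFamily Ω V h F Δ e) (a : Fin 2) (i : Fin 3) :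
    SmoothFamily (fun t u => tangent (F t) a u i) Ω :=
  SmoothFamily.pd (H.smooth_F i) H.isOpen_dom a

theorem smooth_gram (H : FoldedFamily Ω V h F Δ e) {X Y : ℝ → (Fin 2 → ℝ) → Fin 3 → ℝ}
    (hX : ∀ i, SmoothFamily (fun t u => X t u i) Ω)
    (hY : ∀ i, SmoothFamily (fun t u => Y t u i) Ω) :
    SmoothFamily (fun t => gram (h t) (F t) (X t) (Y t)) Ω := by
  exact ContDiffOn.sum fun i _ => ContDiffOn.sum fun j _ =>
    ((H.smooth_hF i j).mul (hX i)).mul (hY j)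

theorem smooth_foldNormal (H : FoldedFamily Ω V h F Δ e) (i : Fin 3) :
    SmoothFamily (fun t u => foldNormal (F t) (e t) u i) Ω := by
  have h1 := H.smooth_tangent 1
  have h2 := H.smooth_e
  have key : ∀ a b, SmoothFamily (fun t u => e t u a * tangent (F t) 1 u b
      - e t u b * tangent (F t) 1 u a) Ω := fun a b =>
    ((h2 a).mul (h1 b)).sub ((h2 b).mul (h1 a))
  unfold foldNormal
  simp only [cross_apply]
  fin_cases i
  · exact key 1 2
  · exact key 2 0
  · exact key 0 1

theorem normal_pos (H : FoldedFamily Ω V h F Δ e) {t : ℝ} {u : Fin 2 → ℝ} (hu : (t, u) ∈ Ω) :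
    0 < coPair (h t) (F t u) (foldNormal (F t) (e t) u) (foldNormal (F t) (e t) u) :=
  gram_pos_of_ne (H.posDef _ (H.mapsTo _ hu)).inv (H.indep t u hu)

theorem smooth_foldUnitNormal (H : FoldedFamily Ω V h F Δ e) (i : Fin 3) :
    SmoothFamily (fun t u => foldUnitNormal (h t) (F t) (e t) u i) Ω := by
  have h1 := H.smooth_foldNormal
  have h2 : ∀ i j, ContDiffOn ℝ ∞ (fun v : ℝ × (Fin 2 → ℝ) => (h v.1 (F v.1 v.2))⁻¹ i j) Ω :=
    contDiffOn_matrix_inv (M := fun v : ℝ × (Fin 2 → ℝ) => h v.1 (F v.1 v.2)) H.smooth_hF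
      fun v hv => (H.posDef _ (H.mapsTo v hv)).det_pos.ne'
  have h3 : ContDiffOn ℝ ∞ (fun v : ℝ × (Fin 2 → ℝ) => coPair (h v.1) (F v.1 v.2)
      (foldNormal (F v.1) (e v.1) v.2) (foldNormal (F v.1) (e v.1) v.2)) Ω := by
    exact ContDiffOn.sum fun i _ => ContDiffOn.sum fun j _ => ((h2 i j).mul (h1 i)).mul (h1 j)
  have h4 := h3.sqrt fun v hv => (H.normal_pos hv).ne'
  have h5 := h4.inv fun v hv => (Real.sqrt_pos.2 (H.normal_pos hv)).ne'
  exact h5.mul (h1 i)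

end Smoothness

end FoldedFamily

/-- The regular part of `∂_0 h(∂_1 F, ∂_1 F) = 2 ∂_1 Δ h(e, ∂_1 F) + Δ M`. -/
noncomputable def foldM (h : MetricField 3) (F e : (Fin 2 → ℝ) → Fin 3 → ℝ) (u : Fin 2 → ℝ) : ℝ :=
  (∑ i, ∑ j, ∑ k, pd k (fun x => h x i j) (F u) * e u k * tangent F 1 u i * tangent F 1 u j)
    + 2 * ∑ i, ∑ j, h (F u) i j * pd 1 (fun v => e v i) u * tangent F 1 u j

/-- Brioschi's expression for the folded metric, divided by `d ^ 3`. -/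
noncomputable def foldBrioschi (d d₁ d₁₁ A A₀ A₁ A₁₁ B B₀ B₁ B₀₁ D D₁ M M₀ : ℝ) : ℝ :=
  (-d₁₁ * A - 2 * d₁ * A₁ - d * A₁₁ / 2 + B₀₁ - M₀ / 2) * (A * D - B ^ 2)
    - A₀ / 2 * ((B₁ - M / 2) * D - B * D₁ / 2)
    + (B₀ - d₁ * A - d * A₁ / 2) * ((B₁ - M / 2) * B - A * D₁ / 2)
    + d₁ * A * (A₁ * D - B * M) / 2 + A₁ / 2 * (d₁ * (A * D - B ^ 2) + d * (A₁ * D - B * M) / 2)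
    - (d₁ * B + d * M / 2) * (A₁ * B - A * M) / 2

/-- The arguments are the derivatives of E = d²A, F = dB, G = D, subject to ∂_0 D = 2d₁B + dM.
Thanks to this relation the lower powers of d cancel, and d₀ and d₀₁ drop out altogether. -/
theorem brioschi_fold (d d₀ d₁ d₀₁ d₁₁ A A₀ A₁ A₁₁ B B₀ B₁ B₀₁ D D₁ M M₀ : ℝ) :
    brioschi (d ^ 2 * A) (d * B) D (2 * d * d₀ * A + d ^ 2 * A₀) (2 * d * d₁ * A + d ^ 2 * A₁)
      (d₀ * B + d * B₀) (d₁ * B + d * B₁) (2 * d₁ * B + d * M) D₁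
      (2 * d₁ ^ 2 * A + 2 * d * d₁₁ * A + 4 * d * d₁ * A₁ + d ^ 2 * A₁₁)
      (d₀₁ * B + d₁ * B₀ + d₀ * B₁ + d * B₀₁)
      (2 * d₀₁ * B + 2 * d₁ * B₀ + d₀ * M + d * M₀)
      = d ^ 3 * foldBrioschi d d₁ d₁₁ A A₀ A₁ A₁₁ B B₀ B₁ B₀₁ D D₁ M M₀ := by
  unfold brioschi foldBrioschi
  ring

/-! ### The induced metric and the Gauss–Bonnet integrand of a fold -/

namespace FoldedFamily

variable {Ω : Set (ℝ × (Fin 2 → ℝ))} {V : Set (ℝ × (Fin 3 → ℝ))}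
  {h : ℝ → MetricField 3} {F : ℝ → (Fin 2 → ℝ) → Fin 3 → ℝ} {Δ : ℝ → (Fin 2 → ℝ) → ℝ}
  {e : ℝ → (Fin 2 → ℝ) → Fin 3 → ℝ} {t : ℝ} {u : Fin 2 → ℝ}

theorem eventually_mem (H : FoldedFamily Ω V h F Δ e) (hu : (t, u) ∈ Ω) :
    ∀ᶠ v in 𝓝 u, (t, v) ∈ Ω :=
  (Continuous.prodMk_right t).continuousAt.eventually_mem (H.isOpen_dom.mem_nhds hu)

theorem smooth_foldM (H : FoldedFamily Ω V h F Δ e) :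
    SmoothFamily (fun t => foldM (h t) (F t) (e t)) Ω := by
  have h1 := H.smooth_tangent 1
  have h2 := fun i => SmoothFamily.pd (H.smooth_e i) H.isOpen_dom 1
  refine ContDiffOn.add ?_ (contDiffOn_const.mul ?_)
  · exact ContDiffOn.sum fun i _ => ContDiffOn.sum fun j _ => ContDiffOn.sum fun k _ =>
      (((H.smooth_pd_hF k i j).mul (H.smooth_e k)).mul (h1 i)).mul (h1 j)
  · exact ContDiffOn.sum fun i _ => ContDiffOn.sum fun j _ =>
      ((H.smooth_hF i j).mul (h2 i)).mul (h1 j)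

/-- Mixed partials commute, so ∂_0 ∂_1 F = ∂_1(Δ e). This integrability condition is the source of
the cancellations in the curvature. -/
theorem pd_tangent (H : FoldedFamily Ω V h F Δ e) (hu : (t, u) ∈ Ω) (i : Fin 3) :
    pd 0 (fun v => tangent (F t) 1 v i) u
      = pd 1 (Δ t) u * e t u i + Δ t u * pd 1 (fun v => e t v i) u := by
  have h1 : pd 0 (fun v => tangent (F t) 1 v i) u = pd 1 (pd 0 fun v => F t v i) u :=
    pd_comm 0 1 (SmoothFamily.contDiffAt (H.smooth_F i) H.isOpen_dom hu)
  have h2 : pd 0 (fun v => F t v i) =ᶠ[𝓝 u] fun v => Δ t v * e t v i :=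
    (H.eventually_mem hu).mono fun v hv => H.fold t v hv i
  rw [h1, pd_congr 1 h2, pd_mul 1 (H.smooth_Δ.differentiableAt H.isOpen_dom hu)
    (SmoothFamily.differentiableAt (H.smooth_e i) H.isOpen_dom hu)]

theorem pd_gram (H : FoldedFamily Ω V h F Δ e) (hu : (t, u) ∈ Ω) :
    pd 0 (gram (h t) (F t) (tangent (F t) 1) (tangent (F t) 1)) u
      = 2 * pd 1 (Δ t) u * gram (h t) (F t) (e t) (tangent (F t) 1) u
        + Δ t u * foldM (h t) (F t) (e t) u := by
  have dT := fun i => SmoothFamily.differentiableAt (H.smooth_tangent 1 i) H.isOpen_dom hu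
  have dH := fun i j => SmoothFamily.differentiableAt (H.smooth_hF i j) H.isOpen_dom hu
  have dF : DifferentiableAt ℝ (F t) u := differentiableAt_pi.2 fun i =>
    SmoothFamily.differentiableAt (H.smooth_F i) H.isOpen_dom hu
  have hV := H.mapsTo _ hu
  have pH : ∀ i j, pd 0 (fun v => h t (F t v) i j) u
      = ∑ k, pd k (fun x => h t x i j) (F t u) * (Δ t u * e t u k) := by
    intro i j
    rw [pd_comp (f := fun x => h t x i j) 0
      (SmoothFamily.differentiableAt (H.smooth_h i j) H.isOpen_cod hV) dF]
    simp only [H.fold t u hu]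
  have key : pd 0 (gram (h t) (F t) (tangent (F t) 1) (tangent (F t) 1)) u
      = ∑ i, ∑ j, (pd 0 (fun v => h t (F t v) i j) u * tangent (F t) 1 u i * tangent (F t) 1 u j
        + h t (F t u) i j * pd 0 (fun v => tangent (F t) 1 v i) u * tangent (F t) 1 u j
        + h t (F t u) i j * tangent (F t) 1 u i * pd 0 (fun v => tangent (F t) 1 v j) u) := by
    have t1 : ∀ i j, DifferentiableAt ℝ (fun v => h t (F t v) i j * tangent (F t) 1 v i) u :=
      fun i j => (dH i j).mul (dT i)
    have t2 : ∀ i j, DifferentiableAt ℝ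
        (fun v => h t (F t v) i j * tangent (F t) 1 v i * tangent (F t) 1 v j) u :=
      fun i j => (t1 i j).mul (dT j)
    unfold gram
    rw [pd_sum _ _ _ fun i _ => DifferentiableAt.fun_sum fun j _ => t2 i j]
    refine Finset.sum_congr rfl fun i _ => ?_
    rw [pd_sum _ _ _ fun j _ => t2 i j]
    refine Finset.sum_congr rfl fun j _ => ?_
    rw [pd_mul 0 (t1 i j) (dT j), pd_mul 0 (dH i j) (dT i)]
    ring
  have hs := H.symm hV
  rw [key]
  simp only [pH, H.pd_tangent hu, gram, foldM]
  simp only [Fin.sum_univ_three]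
  rw [hs 1 0, hs 2 0, hs 2 1]
  ring

theorem pullback_eq (H : FoldedFamily Ω V h F Δ e) (hu : (t, u) ∈ Ω) :
    pullback (h t) (F t) u = metricEFG
      (fun v => Δ t v ^ 2 * gram (h t) (F t) (e t) (e t) v)
      (fun v => Δ t v * gram (h t) (F t) (e t) (tangent (F t) 1) v)
      (gram (h t) (F t) (tangent (F t) 1) (tangent (F t) 1)) u := by
  have hs := H.symm (H.mapsTo _ hu)
  ext a b
  fin_cases a <;> fin_cases b <;>
    simp only [pullback, metricEFG, Matrix.of_apply, Fin.zero_eta, Fin.mk_one, Matrix.cons_val',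
      Matrix.cons_val_zero, Matrix.cons_val_one, Matrix.cons_val_fin_one, Fin.isValue,
      H.fold t u hu, gram, Finset.mul_sum]
  · exact Finset.sum_congr rfl fun i _ => Finset.sum_congr rfl fun j _ => by ring
  · exact Finset.sum_congr rfl fun i _ => Finset.sum_congr rfl fun j _ => by
      simp only [tangent]; ring
  · rw [Finset.sum_comm]
    exact Finset.sum_congr rfl fun i _ => Finset.sum_congr rfl fun j _ => by
      rw [hs i j]; simp only [tangent]; ring
  · rfl

/-- The area density of the fold, divided by `Δ`. -/
noncomputable def areaFactor (h : MetricField 3) (F e : (Fin 2 → ℝ) → Fin 3 → ℝ)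
    (u : Fin 2 → ℝ) : ℝ :=
  Real.sqrt (gram h F e e u * gram h F (tangent F 1) (tangent F 1) u
    - gram h F e (tangent F 1) u ^ 2)

theorem gramDet_pos (H : FoldedFamily Ω V h F Δ e) (hu : (t, u) ∈ Ω) :
    0 < gram (h t) (F t) (e t) (e t) u * gram (h t) (F t) (tangent (F t) 1) (tangent (F t) 1) u
      - gram (h t) (F t) (e t) (tangent (F t) 1) u ^ 2 :=
  gram_det_pos (H.posDef _ (H.mapsTo _ hu)) (H.indep t u hu)

theorem areaFactor_pos (H : FoldedFamily Ω V h F Δ e) (hu : (t, u) ∈ Ω) :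
    0 < areaFactor (h t) (F t) (e t) u :=
  Real.sqrt_pos.2 (H.gramDet_pos hu)

theorem areaDensity_eq (H : FoldedFamily Ω V h F Δ e) (hu : (t, u) ∈ Ω) (hΔ : 0 ≤ Δ t u) :
    areaDensity (h t) (F t) u = Δ t u * areaFactor (h t) (F t) (e t) u := by
  rw [areaDensity, H.pullback_eq hu, metricEFG, Matrix.det_fin_two_of, areaFactor]
  have h1 : ∀ w, Δ t u * √w = √(Δ t u ^ 2 * w) := fun w => by
    rw [Real.sqrt_mul (sq_nonneg _), Real.sqrt_sq hΔ]
  rw [h1]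
  congr 1
  ring

/-- The extension of `√μ R[μ]` to the fold. -/
noncomputable def gbExtension (h : MetricField 3) (F : (Fin 2 → ℝ) → Fin 3 → ℝ)
    (Δ : (Fin 2 → ℝ) → ℝ) (e : (Fin 2 → ℝ) → Fin 3 → ℝ) (u : Fin 2 → ℝ) : ℝ :=
  2 * foldBrioschi (Δ u) (pd 1 Δ u) (pd 1 (pd 1 Δ) u)
    (gram h F e e u) (pd 0 (gram h F e e) u) (pd 1 (gram h F e e) u)
    (pd 1 (pd 1 (gram h F e e)) u)
    (gram h F e (tangent F 1) u) (pd 0 (gram h F e (tangent F 1)) u)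
    (pd 1 (gram h F e (tangent F 1)) u) (pd 0 (pd 1 (gram h F e (tangent F 1))) u)
    (gram h F (tangent F 1) (tangent F 1) u) (pd 1 (gram h F (tangent F 1) (tangent F 1)) u)
    (foldM h F e u) (pd 0 (foldM h F e) u) / areaFactor h F e u ^ 3

/-- The powers of Δ balance: Δ W from the area density and Δ³ from Brioschi's expression, against Δ⁴
W⁴ from the squared determinant. -/
theorem gbDensity_eq (H : FoldedFamily Ω V h F Δ e) (hu : (t, u) ∈ Ω) (hΔ : 0 < Δ t u) :
    gbDensity (h t) (F t) u = gbExtension (h t) (F t) (Δ t) (e t) u := by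
  have o := H.isOpen_dom
  have sA := H.smooth_gram H.smooth_e H.smooth_e
  have sB := H.smooth_gram H.smooth_e (H.smooth_tangent 1)
  have sD := H.smooth_gram (H.smooth_tangent 1) (H.smooth_tangent 1)
  have hp : pullback (h t) (F t) =ᶠ[𝓝 u] _ := (H.eventually_mem hu).mono fun v hv =>
    H.pullback_eq hv
  have hw := H.gramDet_pos hu
  have hW := H.areaFactor_pos hu
  have hW2 : areaFactor (h t) (F t) (e t) u ^ 2 = _ := Real.sq_sqrt hw.le
  have cA := SmoothFamily.contDiffAt sA o hu
  have cB := SmoothFamily.contDiffAt sB o hu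
  have cD := SmoothFamily.contDiffAt sD o hu
  have cΔ := H.smooth_Δ.contDiffAt o hu
  have sM := H.smooth_foldM
  have dM := SmoothFamily.differentiableAt sM o hu
  have gD : pd 0 (gram (h t) (F t) (tangent (F t) 1) (tangent (F t) 1)) =ᶠ[𝓝 u] _ :=
    (H.eventually_mem hu).mono fun v hv => H.pd_gram hv
  have evA : ∀ᶠ v in 𝓝 u, DifferentiableAt ℝ (gram (h t) (F t) (e t) (e t)) v :=
    (H.eventually_mem hu).mono fun v hv => SmoothFamily.differentiableAt sA o hv
  have evB : ∀ᶠ v in 𝓝 u, DifferentiableAt ℝ (gram (h t) (F t) (e t) (tangent (F t) 1)) v :=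
    (H.eventually_mem hu).mono fun v hv => SmoothFamily.differentiableAt sB o hv
  have evΔ : ∀ᶠ v in 𝓝 u, DifferentiableAt ℝ (Δ t) v :=
    (H.eventually_mem hu).mono fun v hv => H.smooth_Δ.differentiableAt o hv
  rw [gbDensity, surfaceRicci, ricciScalar_congr hp, H.areaDensity_eq hu hΔ.le, gbExtension]
  generalize areaFactor (h t) (F t) (e t) u = W at *
  generalize foldM (h t) (F t) (e t) = M at *
  generalize gram (h t) (F t) (e t) (e t) = A at *
  generalize gram (h t) (F t) (e t) (tangent (F t) 1) = B at *
  generalize gram (h t) (F t) (tangent (F t) 1) (tangent (F t) 1) = D at *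
  generalize Δ t = d at *
  clear H hp sA sB sD sM
  have dA := cA.differentiableAt (by simp)
  have dB := cB.differentiableAt (by simp)
  have dD := cD.differentiableAt (by simp)
  have dd := cΔ.differentiableAt (by simp)
  have dA' : ∀ i, DifferentiableAt ℝ (pd i A) u := fun i =>
    (contDiffAt_pd i cA).differentiableAt (by simp)
  have dB' : ∀ i, DifferentiableAt ℝ (pd i B) u := fun i =>
    (contDiffAt_pd i cB).differentiableAt (by simp)
  have dd' : ∀ i, DifferentiableAt ℝ (pd i d) u := fun i =>
    (contDiffAt_pd i cΔ).differentiableAt (by simp)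
  have pE : ∀ i, pd i (fun v => d v ^ 2 * A v) =ᶠ[𝓝 u]
      fun v => 2 * d v * pd i d v * A v + d v ^ 2 * pd i A v := by
    intro i
    filter_upwards [evA, evΔ] with v h1 h2
    rw [pd_mul i (h2.fun_pow 2) h1, pd_pow i 2 h2]
    norm_num
  have pF : ∀ i, pd i (fun v => d v * B v) =ᶠ[𝓝 u]
      fun v => pd i d v * B v + d v * pd i B v := by
    intro i
    filter_upwards [evB, evΔ] with v h1 h2
    rw [pd_mul i h2 h1]
  have hdet : d u ^ 2 * A u * D u - d u * B u * (d u * B u) = d u ^ 2 * W ^ 2 := by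
    rw [hW2]; ring
  have cd01 : pd 1 (pd 0 d) u = pd 0 (pd 1 d) u := pd_comm _ _ cΔ
  rw [ricciScalar_metricEFG ((cΔ.pow 2).mul cA) (cΔ.mul cB) cD
    (by rw [hdet]; positivity), hdet,
    pd_congr 1 (pE 1), pd_congr 0 (pF 1), pd_congr 0 gD, (pE 0).eq_of_nhds, (pE 1).eq_of_nhds,
    (pF 0).eq_of_nhds, (pF 1).eq_of_nhds, gD.eq_of_nhds]
  simp (disch := fun_prop) only [pd_mul, pd_add, pd_pow, pd_const]
  have hb := brioschi_fold (d u) (pd 0 d u) (pd 1 d u) (pd 0 (pd 1 d) u) (pd 1 (pd 1 d) u)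
    (A u) (pd 0 A u) (pd 1 A u) (pd 1 (pd 1 A) u) (B u) (pd 0 B u) (pd 1 B u)
    (pd 0 (pd 1 B) u) (D u) (pd 1 D u) (M u) (pd 0 M u)
  have hWne := hW.ne'
  have hdne := hΔ.ne'
  trans d u * W * (2 * (d u ^ 3 * foldBrioschi (d u) (pd 1 d u) (pd 1 (pd 1 d) u)
    (A u) (pd 0 A u) (pd 1 A u) (pd 1 (pd 1 A) u) (B u) (pd 0 B u) (pd 1 B u)
    (pd 0 (pd 1 B) u) (D u) (pd 1 D u) (M u) (pd 0 M u)) / (d u ^ 2 * W ^ 2) ^ 2)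
  · rw [← hb]
    congr 4 <;> push_cast <;> ring
  · field_simp

theorem continuousOn_areaFactor (H : FoldedFamily Ω V h F Δ e) :
    ContinuousOn (fun v : ℝ × (Fin 2 → ℝ) => areaFactor (h v.1) (F v.1) (e v.1) v.2) Ω := by
  have sA := (H.smooth_gram H.smooth_e H.smooth_e).continuousOn
  have sB := (H.smooth_gram H.smooth_e (H.smooth_tangent 1)).continuousOn
  have sD := (H.smooth_gram (H.smooth_tangent 1) (H.smooth_tangent 1)).continuousOn
  exact ((sA.mul sD).sub (sB.pow 2)).sqrt

theorem continuousOn_gbExtension (H : FoldedFamily Ω V h F Δ e) :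
    ContinuousOn (fun v : ℝ × (Fin 2 → ℝ) => gbExtension (h v.1) (F v.1) (Δ v.1) (e v.1) v.2) Ω := by
  have o := H.isOpen_dom
  have sA := H.smooth_gram H.smooth_e H.smooth_e
  have sB := H.smooth_gram H.smooth_e (H.smooth_tangent 1)
  have sD := H.smooth_gram (H.smooth_tangent 1) (H.smooth_tangent 1)
  have sM := H.smooth_foldM
  have c1 := H.smooth_Δ.continuousOn
  have c2 := (SmoothFamily.pd H.smooth_Δ o 1).continuousOn
  have c3 := (SmoothFamily.pd (SmoothFamily.pd H.smooth_Δ o 1) o 1).continuousOn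
  have c4 := sA.continuousOn
  have c5 := (SmoothFamily.pd sA o 0).continuousOn
  have c6 := (SmoothFamily.pd sA o 1).continuousOn
  have c7 := (SmoothFamily.pd (SmoothFamily.pd sA o 1) o 1).continuousOn
  have c8 := sB.continuousOn
  have c9 := (SmoothFamily.pd sB o 0).continuousOn
  have c10 := (SmoothFamily.pd sB o 1).continuousOn
  have c11 := (SmoothFamily.pd (SmoothFamily.pd sB o 1) o 0).continuousOn
  have c12 := sD.continuousOn
  have c13 := (SmoothFamily.pd sD o 1).continuousOn
  have c14 := sM.continuousOn
  have c15 := (SmoothFamily.pd sM o 0).continuousOn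
  have c16 := H.continuousOn_areaFactor
  have c17 : ∀ v ∈ Ω, areaFactor (h v.1) (F v.1) (e v.1) v.2 ^ 3 ≠ 0 := fun v hv =>
    (pow_pos (H.areaFactor_pos hv) 3).ne'
  refine ContinuousOn.div ?_ (c16.pow 3) c17
  unfold foldBrioschi
  exact ContinuousOn.mul continuousOn_const (by fun_prop)

end FoldedFamily

/-- `∑ Γ^k_{ij} X^i Y^j n_k` along the surface. -/
noncomputable def christoffelPair (h : MetricField 3) (F : (Fin 2 → ℝ) → Fin 3 → ℝ)
    (X Y n : Fin 3 → ℝ) (u : Fin 2 → ℝ) : ℝ :=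
  ∑ j, ∑ i, ∑ k, christoffel h k i j (F u) * X i * Y j * n k

/-- The extrinsic curvature of the fold in the frame `e, ∂_1 F`, times `Δ`. -/
noncomputable def foldK (h : MetricField 3) (F : (Fin 2 → ℝ) → Fin 3 → ℝ)
    (Δ : (Fin 2 → ℝ) → ℝ) (e : (Fin 2 → ℝ) → Fin 3 → ℝ) (u : Fin 2 → ℝ) :
    Matrix (Fin 2) (Fin 2) ℝ :=
  !![(∑ j, e u j * pd 0 (fun v => foldUnitNormal h F e v j) u)
      - Δ u * christoffelPair h F (e u) (e u) (foldUnitNormal h F e u) u,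
    Δ u * (-(∑ j, pd 1 (fun v => e v j) u * foldUnitNormal h F e u j)
      - christoffelPair h F (e u) (tangent F 1 u) (foldUnitNormal h F e u) u);
    Δ u * ((∑ j, e u j * pd 1 (fun v => foldUnitNormal h F e v j) u)
      - christoffelPair h F (tangent F 1 u) (e u) (foldUnitNormal h F e u) u),
    Δ u * ((∑ j, tangent F 1 u j * pd 1 (fun v => foldUnitNormal h F e v j) u)
      - christoffelPair h F (tangent F 1 u) (tangent F 1 u) (foldUnitNormal h F e u) u)]

/-- The inverse of the Gram matrix of the frame `e, ∂_1 F`. -/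
noncomputable def foldInv (h : MetricField 3) (F e : (Fin 2 → ℝ) → Fin 3 → ℝ) (u : Fin 2 → ℝ) :
    Matrix (Fin 2) (Fin 2) ℝ :=
  (FoldedFamily.areaFactor h F e u ^ 2)⁻¹ •
    !![gram h F (tangent F 1) (tangent F 1) u, -gram h F e (tangent F 1) u;
      -gram h F e (tangent F 1) u, gram h F e e u]

/-- `Δ √μ k^i_i k^j_j`, extended to the fold. -/
noncomputable def traceSqFactor (h : MetricField 3) (F : (Fin 2 → ℝ) → Fin 3 → ℝ)
    (Δ : (Fin 2 → ℝ) → ℝ) (e : (Fin 2 → ℝ) → Fin 3 → ℝ) (u : Fin 2 → ℝ) : ℝ :=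
  FoldedFamily.areaFactor h F e u * (∑ a, ∑ b, foldInv h F e u a b * foldK h F Δ e u a b) ^ 2

/-- `Δ √μ k^{ij} k_{ij}`, extended to the fold. -/
noncomputable def normSqFactor (h : MetricField 3) (F : (Fin 2 → ℝ) → Fin 3 → ℝ)
    (Δ : (Fin 2 → ℝ) → ℝ) (e : (Fin 2 → ℝ) → Fin 3 → ℝ) (u : Fin 2 → ℝ) : ℝ :=
  FoldedFamily.areaFactor h F e u * ∑ a, ∑ b, ∑ c, ∑ d, foldInv h F e u a c * foldInv h F e u b d
    * foldK h F Δ e u a b * foldK h F Δ e u c d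

/-! ### The extrinsic curvature of a fold -/

namespace FoldedFamily

variable {Ω : Set (ℝ × (Fin 2 → ℝ))} {V : Set (ℝ × (Fin 3 → ℝ))}
  {h : ℝ → MetricField 3} {F : ℝ → (Fin 2 → ℝ) → Fin 3 → ℝ} {Δ : ℝ → (Fin 2 → ℝ) → ℝ}
  {e : ℝ → (Fin 2 → ℝ) → Fin 3 → ℝ} {t : ℝ} {u : Fin 2 → ℝ}

theorem tangent_zero (H : FoldedFamily Ω V h F Δ e) (hu : (t, u) ∈ Ω) :
    tangent (F t) 0 u = Δ t u • e t u :=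
  funext fun i => H.fold t u hu i

theorem unitNormal_eq (H : FoldedFamily Ω V h F Δ e) (hu : (t, u) ∈ Ω) (hΔ : 0 < Δ t u) :
    unitNormal (h t) (F t) u = foldUnitNormal (h t) (F t) (e t) u := by
  have h1 : conormal (F t) u = Δ t u • foldNormal (F t) (e t) u := by
    rw [conormal, H.tangent_zero hu, map_smul, LinearMap.smul_apply, foldNormal]
  have h2 : ∀ N : Fin 3 → ℝ, coPair (h t) (F t u) (Δ t u • N) (Δ t u • N)
      = Δ t u ^ 2 * coPair (h t) (F t u) N N := by
    intro N
    simp only [coPair, Finset.mul_sum, Pi.smul_apply, smul_eq_mul]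
    exact Finset.sum_congr rfl fun i _ => Finset.sum_congr rfl fun j _ => by ring
  rw [unitNormal, h1, h2, Real.sqrt_mul (sq_nonneg _), Real.sqrt_sq hΔ.le, foldUnitNormal,
    smul_smul, mul_inv, mul_right_comm, inv_mul_cancel₀ hΔ.ne', one_mul]

theorem pd_unitNormal (H : FoldedFamily Ω V h F Δ e) (hu : (t, u) ∈ Ω) (hΔ : 0 < Δ t u)
    (a : Fin 2) (j : Fin 3) : pd a (fun v => unitNormal (h t) (F t) v j) u
      = pd a (fun v => foldUnitNormal (h t) (F t) (e t) v j) u := by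
  refine pd_congr a ?_
  filter_upwards [H.eventually_mem hu,
    (H.smooth_Δ.contDiffAt H.isOpen_dom hu).continuousAt.eventually_const_lt hΔ] with v h1 h2
  rw [H.unitNormal_eq h1 h2]

theorem dot_foldUnitNormal (h : MetricField 3) (F e : (Fin 2 → ℝ) → Fin 3 → ℝ) (u : Fin 2 → ℝ) :
    ∑ j, e u j * foldUnitNormal h F e u j = 0 ∧
      ∑ j, tangent F 1 u j * foldUnitNormal h F e u j = 0 := by
  constructor
  · change e u ⬝ᵥ _ • crossProduct (e u) (tangent F 1 u) = 0
    rw [dotProduct_smul, dot_self_cross, smul_zero]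
  · change tangent F 1 u ⬝ᵥ _ • crossProduct (e u) (tangent F 1 u) = 0
    rw [dotProduct_smul, dot_cross_self, smul_zero]

/-- Differentiating `∑ X_j n_j = 0`. -/
theorem sum_mul_pd {X n : (Fin 2 → ℝ) → Fin 3 → ℝ} (a : Fin 2)
    (hX : ∀ j, DifferentiableAt ℝ (fun v => X v j) u)
    (hn : ∀ j, DifferentiableAt ℝ (fun v => n v j) u) (h0 : ∀ v, ∑ j, X v j * n v j = 0) :
    ∑ j, X u j * pd a (fun v => n v j) u = -∑ j, pd a (fun v => X v j) u * n u j := by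
  have h1 : pd a (fun v => ∑ j, X v j * n v j) u = 0 := by simp only [h0, pd_const]
  rw [pd_sum _ (fun j v => X v j * n v j) _ fun j _ => (hX j).mul (hn j)] at h1
  simp only [fun j => pd_mul a (hX j) (hn j), Finset.sum_add_distrib] at h1
  linarith

theorem extrinsic_eq_sum (h : MetricField 3) (F : (Fin 2 → ℝ) → Fin 3 → ℝ) (a b : Fin 2)
    (u : Fin 2 → ℝ) : extrinsic h F a b u
      = (∑ j, tangent F b u j * pd a (fun v => unitNormal h F v j) u)
        - christoffelPair h F (tangent F a u) (tangent F b u) (unitNormal h F u) u := by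
  simp only [extrinsic, christoffelPair, mul_sub, Finset.sum_sub_distrib, Finset.mul_sum]
  congr 1
  exact Finset.sum_congr rfl fun j _ => Finset.sum_congr rfl fun i _ =>
    Finset.sum_congr rfl fun k _ => by ring

theorem christoffelPair_smul (h : MetricField 3) (F : (Fin 2 → ℝ) → Fin 3 → ℝ)
    (X Y n : Fin 3 → ℝ) (a b : ℝ) (u : Fin 2 → ℝ) :
    christoffelPair h F (a • X) (b • Y) n u = a * b * christoffelPair h F X Y n u := by
  simp only [christoffelPair, Finset.mul_sum, Pi.smul_apply, smul_eq_mul]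
  exact Finset.sum_congr rfl fun j _ => Finset.sum_congr rfl fun i _ =>
    Finset.sum_congr rfl fun k _ => by ring

theorem smooth_pd_foldUnitNormal (H : FoldedFamily Ω V h F Δ e) (a : Fin 2) (j : Fin 3) :
    SmoothFamily (fun t u => pd a (fun v => foldUnitNormal (h t) (F t) (e t) v j) u) Ω :=
  SmoothFamily.pd (H.smooth_foldUnitNormal j) H.isOpen_dom a

/-- The weights `![Δ, 1]` express ∂_0 F = Δ e and ∂_1 F in the frame, where k has components `foldK`
/ Δ. Only the (0, 0) component is genuinely singular; the other entries of `foldK` carry an explicit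
factor Δ. -/
theorem extrinsic_eq (H : FoldedFamily Ω V h F Δ e) (hu : (t, u) ∈ Ω) (hΔ : 0 < Δ t u)
    (a b : Fin 2) : extrinsic (h t) (F t) a b u
      = (![Δ t u, 1] a * ![Δ t u, 1] b / Δ t u) * foldK (h t) (F t) (Δ t) (e t) u a b := by
  have o := H.isOpen_dom
  have dn := fun j => SmoothFamily.differentiableAt (H.smooth_foldUnitNormal j) o hu
  have dt := fun j => SmoothFamily.differentiableAt (H.smooth_tangent 1 j) o hu
  have hne := hΔ.ne'
  rw [extrinsic_eq_sum, H.unitNormal_eq hu hΔ]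
  simp only [H.pd_unitNormal hu hΔ]
  have c1 := fun X Y n => christoffelPair_smul (h t) (F t) X Y n (Δ t u) 1 u
  have c2 := fun X Y n => christoffelPair_smul (h t) (F t) X Y n 1 (Δ t u) u
  simp only [one_smul, one_mul, mul_one] at c1 c2
  have s1 : ∀ n : Fin 3 → ℝ, ∑ j, (Δ t u • e t u) j * n j = Δ t u * ∑ j, e t u j * n j := by
    intro n
    simp only [Pi.smul_apply, smul_eq_mul, mul_assoc, ← Finset.mul_sum]
  fin_cases a <;> fin_cases b <;>
    simp only [Fin.zero_eta, Fin.mk_one, H.tangent_zero hu, foldK, Matrix.of_apply,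
      Matrix.cons_val', Matrix.cons_val_zero, Matrix.cons_val_one, Matrix.cons_val_fin_one, s1]
  · rw [christoffelPair_smul]
    field_simp
  -- The derivative is moved from n to ∂_1 F. Since ∂_0 ∂_1 F = ∂_1Δ e + Δ ∂_1 e and e annihilates
  -- n, a factor Δ comes out.
  · rw [c1, sum_mul_pd 0 dt dn fun v => (dot_foldUnitNormal (h t) (F t) (e t) v).2]
    have h2 : ∑ j, pd 0 (fun v => tangent (F t) 1 v j) u * foldUnitNormal (h t) (F t) (e t) u j
        = Δ t u * ∑ j, pd 1 (fun v => e t v j) u * foldUnitNormal (h t) (F t) (e t) u j := by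
      simp only [H.pd_tangent hu, add_mul, Finset.sum_add_distrib, mul_assoc, ← Finset.mul_sum]
      rw [(dot_foldUnitNormal (h t) (F t) (e t) u).1, mul_zero, zero_add]
    rw [h2]
    field_simp
  · rw [c2]
    field_simp
  · field_simp

theorem inv_pullback_eq (H : FoldedFamily Ω V h F Δ e) (hu : (t, u) ∈ Ω) (hΔ : 0 < Δ t u)
    (a b : Fin 2) : (pullback (h t) (F t) u)⁻¹ a b
      = foldInv (h t) (F t) (e t) u a b / (![Δ t u, 1] a * ![Δ t u, 1] b) := by
  have hne := hΔ.ne'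
  have hw := H.gramDet_pos hu
  have hW2 : areaFactor (h t) (F t) (e t) u ^ 2 = _ := Real.sq_sqrt hw.le
  rw [H.pullback_eq hu, foldInv, hW2]
  have hw' := hw.ne'
  generalize gram (h t) (F t) (e t) (e t) = A at *
  generalize gram (h t) (F t) (e t) (tangent (F t) 1) = B at *
  generalize gram (h t) (F t) (tangent (F t) 1) (tangent (F t) 1) = D at *
  have hdet : Δ t u ^ 2 * A u * D u - Δ t u * B u * (Δ t u * B u)
      = Δ t u ^ 2 * (A u * D u - B u ^ 2) := by ring
  fin_cases a <;> fin_cases b <;>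
    simp [metricEFG, Matrix.inv_def, Matrix.det_fin_two, Matrix.adjugate_fin_two, hdet] <;>
    field_simp

/-- The frame weights cancel between the inverse metric and k, so the trace is O(1/Δ); its square
meets one factor Δ from the area density. -/
theorem traceSqDensity_eq (H : FoldedFamily Ω V h F Δ e) (hu : (t, u) ∈ Ω) (hΔ : 0 < Δ t u) :
    traceSqDensity (h t) (F t) u = traceSqFactor (h t) (F t) (Δ t) (e t) u / Δ t u := by
  have hne := hΔ.ne'
  have h1 : traceK (h t) (F t) u
      = (∑ a, ∑ b, foldInv (h t) (F t) (e t) u a b * foldK (h t) (F t) (Δ t) (e t) u a b)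
        / Δ t u := by
    simp only [traceK, Finset.sum_div]
    refine Finset.sum_congr rfl fun a _ => Finset.sum_congr rfl fun b _ => ?_
    have hs : ∀ a, ![Δ t u, 1] a ≠ 0 := fun a => by fin_cases a <;> simp [hne]
    have ha := hs a
    have hb := hs b
    rw [H.inv_pullback_eq hu hΔ, H.extrinsic_eq hu hΔ]
    field_simp
  rw [traceSqDensity, H.areaDensity_eq hu hΔ.le, h1, traceSqFactor]
  field_simp

theorem normSqDensity_eq (H : FoldedFamily Ω V h F Δ e) (hu : (t, u) ∈ Ω) (hΔ : 0 < Δ t u) :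
    normSqDensity (h t) (F t) u = normSqFactor (h t) (F t) (Δ t) (e t) u / Δ t u := by
  have hne := hΔ.ne'
  have h1 : normSqK (h t) (F t) u
      = (∑ a, ∑ b, ∑ c, ∑ d, foldInv (h t) (F t) (e t) u a c * foldInv (h t) (F t) (e t) u b d
          * foldK (h t) (F t) (Δ t) (e t) u a b * foldK (h t) (F t) (Δ t) (e t) u c d)
        / Δ t u ^ 2 := by
    simp only [normSqK, Finset.sum_div]
    refine Finset.sum_congr rfl fun a _ => Finset.sum_congr rfl fun b _ =>
      Finset.sum_congr rfl fun c _ => Finset.sum_congr rfl fun d _ => ?_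
    have hs : ∀ a, ![Δ t u, 1] a ≠ 0 := fun a => by fin_cases a <;> simp [hne]
    have ha := hs a
    have hb := hs b
    have hc := hs c
    have hd := hs d
    rw [H.inv_pullback_eq hu hΔ, H.inv_pullback_eq hu hΔ, H.extrinsic_eq hu hΔ,
      H.extrinsic_eq hu hΔ]
    field_simp
  rw [normSqDensity, H.areaDensity_eq hu hΔ.le, h1, normSqFactor]
  field_simp

theorem continuousOn_foldInv (H : FoldedFamily Ω V h F Δ e) (a b : Fin 2) :
    ContinuousOn (fun v : ℝ × (Fin 2 → ℝ) => foldInv (h v.1) (F v.1) (e v.1) v.2 a b) Ω := by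
  have sA := (H.smooth_gram H.smooth_e H.smooth_e).continuousOn
  have sB := (H.smooth_gram H.smooth_e (H.smooth_tangent 1)).continuousOn
  have sD := (H.smooth_gram (H.smooth_tangent 1) (H.smooth_tangent 1)).continuousOn
  have hw := (H.continuousOn_areaFactor.pow 2).inv₀ fun v hv =>
    (pow_pos (H.areaFactor_pos hv) 2).ne'
  refine ContinuousOn.mul hw ?_
  fin_cases a <;> fin_cases b
  · exact sD
  · exact sB.neg
  · exact sB.neg
  · exact sA

theorem continuousOn_christoffelPair (H : FoldedFamily Ω V h F Δ e)
    {X Y n : ℝ → (Fin 2 → ℝ) → Fin 3 → ℝ} (hX : ∀ i, SmoothFamily (fun t u => X t u i) Ω)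
    (hY : ∀ i, SmoothFamily (fun t u => Y t u i) Ω)
    (hn : ∀ i, SmoothFamily (fun t u => n t u i) Ω) :
    ContinuousOn (fun v : ℝ × (Fin 2 → ℝ) =>
      christoffelPair (h v.1) (F v.1) (X v.1 v.2) (Y v.1 v.2) (n v.1 v.2) v.2) Ω :=
  continuousOn_finsetSum _ fun j _ => continuousOn_finsetSum _ fun i _ =>
    continuousOn_finsetSum _ fun k _ => (((H.smooth_christoffel k i j).continuousOn.mul
      (hX i).continuousOn).mul (hY j).continuousOn).mul (hn k).continuousOn

theorem continuousOn_foldK (H : FoldedFamily Ω V h F Δ e) (a b : Fin 2) :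
    ContinuousOn (fun v : ℝ × (Fin 2 → ℝ) =>
      foldK (h v.1) (F v.1) (Δ v.1) (e v.1) v.2 a b) Ω := by
  have hs : ∀ X Y : ℝ → (Fin 2 → ℝ) → Fin 3 → ℝ, (∀ i, SmoothFamily (fun t u => X t u i) Ω) →
      (∀ i, SmoothFamily (fun t u => Y t u i) Ω) →
      ContinuousOn (fun v : ℝ × (Fin 2 → ℝ) => ∑ j, X v.1 v.2 j * Y v.1 v.2 j) Ω :=
    fun X Y hX hY => continuousOn_finsetSum _ fun j _ =>
      (hX j).continuousOn.mul (hY j).continuousOn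
  have cΔ := H.smooth_Δ.continuousOn
  have sn := H.smooth_foldUnitNormal
  have st := H.smooth_tangent 1
  have se := H.smooth_e
  have h0 := hs e (fun t u j => pd 0 (fun v => foldUnitNormal (h t) (F t) (e t) v j) u) se
    (H.smooth_pd_foldUnitNormal 0)
  have h1 := hs (fun t u j => pd 1 (fun v => e t v j) u)
    (fun t u => foldUnitNormal (h t) (F t) (e t) u)
    (fun i => SmoothFamily.pd (H.smooth_e i) H.isOpen_dom 1) sn
  have h2 := hs e (fun t u j => pd 1 (fun v => foldUnitNormal (h t) (F t) (e t) v j) u) se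
    (H.smooth_pd_foldUnitNormal 1)
  have h3 := hs (fun t u => tangent (F t) 1 u)
    (fun t u j => pd 1 (fun v => foldUnitNormal (h t) (F t) (e t) v j) u) st
    (H.smooth_pd_foldUnitNormal 1)
  have c0 := H.continuousOn_christoffelPair se se sn
  have c1 := H.continuousOn_christoffelPair se st sn
  have c2 := H.continuousOn_christoffelPair st se sn
  have c3 := H.continuousOn_christoffelPair st st sn
  fin_cases a <;> fin_cases b
  · exact h0.sub (cΔ.mul c0)
  · exact cΔ.mul (h1.neg.sub c1)
  · exact cΔ.mul (h2.sub c2)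
  · exact cΔ.mul (h3.sub c3)

theorem continuousOn_traceSqFactor (H : FoldedFamily Ω V h F Δ e) :
    ContinuousOn (fun v : ℝ × (Fin 2 → ℝ) =>
      traceSqFactor (h v.1) (F v.1) (Δ v.1) (e v.1) v.2) Ω :=
  H.continuousOn_areaFactor.mul ((continuousOn_finsetSum _ fun a _ =>
    continuousOn_finsetSum _ fun b _ =>
      (H.continuousOn_foldInv a b).mul (H.continuousOn_foldK a b)).pow 2)

theorem continuousOn_normSqFactor (H : FoldedFamily Ω V h F Δ e) :
    ContinuousOn (fun v : ℝ × (Fin 2 → ℝ) =>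
      normSqFactor (h v.1) (F v.1) (Δ v.1) (e v.1) v.2) Ω :=
  H.continuousOn_areaFactor.mul (continuousOn_finsetSum _ fun a _ =>
    continuousOn_finsetSum _ fun b _ => continuousOn_finsetSum _ fun c _ =>
    continuousOn_finsetSum _ fun d _ => (((H.continuousOn_foldInv a c).mul
      (H.continuousOn_foldInv b d)).mul (H.continuousOn_foldK a b)).mul
      (H.continuousOn_foldK c d))

/-- On Δ = 0 only the (0, 0) entry of `foldK` survives, and for such a form the squared norm is the
squared trace. Both integrals therefore have the same leading coefficient. -/
theorem normSqFactor_eq_traceSqFactor (hΔ : Δ t u = 0) :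
    normSqFactor (h t) (F t) (Δ t) (e t) u = traceSqFactor (h t) (F t) (Δ t) (e t) u := by
  simp [normSqFactor, traceSqFactor, foldK, hΔ, Fin.sum_univ_two]
  left
  ring

/-- The surviving entry is e · ∂_0 n = −∂_0 e · n, nonzero as soon as e turns out of the plane
spanned by e and ∂_1 F when u⁰ varies. -/
theorem traceSqFactor_pos (H : FoldedFamily Ω V h F Δ e) (hu : (t, u) ∈ Ω) (hΔ : Δ t u = 0)
    (he : ∑ j, pd 0 (fun v => e t v j) u * foldNormal (F t) (e t) u j ≠ 0) :
    0 < traceSqFactor (h t) (F t) (Δ t) (e t) u := by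
  have o := H.isOpen_dom
  have dn := fun j => SmoothFamily.differentiableAt (H.smooth_foldUnitNormal j) o hu
  have de := fun j => SmoothFamily.differentiableAt (H.smooth_e j) o hu
  have hD : gram (h t) (F t) (tangent (F t) 1) (tangent (F t) 1) u ≠ 0 := by
    refine (gram_pos_of_ne (H.posDef _ (H.mapsTo _ hu)) fun h0 => H.indep t u hu ?_).ne'
    rw [h0, map_zero]
  have hW := H.areaFactor_pos hu
  have hW' := hW.ne'
  have hN := (Real.sqrt_pos.2 (H.normal_pos hu)).ne'
  have key : ∑ j, e t u j * pd 0 (fun v => foldUnitNormal (h t) (F t) (e t) v j) u ≠ 0 := by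
    rw [sum_mul_pd 0 de dn fun v => (dot_foldUnitNormal (h t) (F t) (e t) v).1, neg_ne_zero]
    simp only [foldUnitNormal, Pi.smul_apply, smul_eq_mul, mul_left_comm, ← Finset.mul_sum]
    exact mul_ne_zero (inv_ne_zero hN) he
  have h1 : ∑ a, ∑ b, foldInv (h t) (F t) (e t) u a b * foldK (h t) (F t) (Δ t) (e t) u a b
      = (areaFactor (h t) (F t) (e t) u ^ 2)⁻¹
        * gram (h t) (F t) (tangent (F t) 1) (tangent (F t) 1) u
        * ∑ j, e t u j * pd 0 (fun v => foldUnitNormal (h t) (F t) (e t) v j) u := by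
    simp [foldInv, foldK, hΔ, Fin.sum_univ_two]
  rw [traceSqFactor, h1]
  have := mul_ne_zero (mul_ne_zero (inv_ne_zero (pow_ne_zero 2 hW')) hD) key
  positivity

end FoldedFamily

/-! ### Improper integrals over the smooth region -/

/-- The square window of size `a` in the parameter plane. -/
def window (a : ℝ) : Set (Fin 2 → ℝ) := {u | |u 0| ≤ a ∧ |u 1| ≤ a}

theorem window_eq (a : ℝ) :
    window a = MeasurableEquiv.finTwoArrow ⁻¹' (Icc (-a) a ×ˢ Icc (-a) a) := by
  ext u
  simp only [window, abs_le, MeasurableEquiv.finTwoArrow, mem_ofPred_eq, mem_preimage, mem_prod,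
    mem_Icc]
  rfl

theorem isCompact_window (a : ℝ) : IsCompact (window a) := by
  have : window a = univ.pi fun _ => Icc (-a) a := by
    ext u
    simp only [window, abs_le, mem_ofPred_eq, Set.mem_pi, mem_univ, forall_const, mem_Icc,
      Fin.forall_fin_two]
  rw [this]
  exact isCompact_univ_pi fun _ => isCompact_Icc

theorem smoothRegion_eq_iUnion (Q : (Fin 2 → ℝ) → ℝ) (a : ℝ) :
    smoothRegion Q a = ⋃ n : ℕ, window a ∩ (fun u => 2 * u 0 ^ 2 - Q u) ⁻¹' Ici (1 / (n + 1 : ℝ)) := by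
  ext u
  simp only [smoothRegion, mem_ofPred_eq, mem_iUnion, mem_inter_iff, mem_preimage, mem_Ici, window]
  constructor
  · rintro ⟨h0, h1, h⟩
    obtain ⟨n, hn⟩ := exists_nat_one_div_lt (sub_pos.2 h)
    exact ⟨n, ⟨h0, h1⟩, hn.le⟩
  · rintro ⟨n, ⟨h0, h1⟩, h⟩
    have : (0 : ℝ) < 1 / (n + 1) := by positivity
    exact ⟨h0, h1, by linarith⟩

theorem exists_compact_exhaustion {Q : (Fin 2 → ℝ) → ℝ} {a : ℝ} (hQ : ContinuousOn Q (window a)) :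
    ∃ K : ℕ → Set (Fin 2 → ℝ), (∀ n, IsCompact (K n)) ∧ Monotone K ∧
      smoothRegion Q a = ⋃ n, K n := by
  refine ⟨_, fun n => ?_, ?_, smoothRegion_eq_iUnion Q a⟩
  · refine (isCompact_window a).of_isClosed_subset
      (ContinuousOn.preimage_isClosed_of_isClosed ?_ (isCompact_window a).isClosed isClosed_Ici)
      inter_subset_left
    exact ContinuousOn.sub (by fun_prop) hQ
  · intro m n hmn
    refine inter_subset_inter_right _ (preimage_mono (Ici_subset_Ici.2 ?_))
    exact Nat.one_div_le_one_div hmn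

theorem measurableSet_smoothRegion {Q : (Fin 2 → ℝ) → ℝ} {a : ℝ}
    (hQ : ContinuousOn Q (window a)) : MeasurableSet (smoothRegion Q a) := by
  obtain ⟨K, hK, -, h⟩ := exists_compact_exhaustion hQ
  rw [h]
  exact MeasurableSet.iUnion fun n => (hK n).measurableSet

theorem smoothRegion_subset_window (Q : (Fin 2 → ℝ) → ℝ) (a : ℝ) :
    smoothRegion Q a ⊆ window a := fun _ h => ⟨h.1, h.2.1⟩

/-- The tail is controlled by |f|: once the integral of |f| over some K n is within ε of its total,
every larger compact set misses less than ε. -/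
theorem hasImproperIntegral_of_integrableOn {Q f : (Fin 2 → ℝ) → ℝ} {a : ℝ}
    (hQ : ContinuousOn Q (window a)) (hf : ContinuousOn f (smoothRegion Q a))
    (hi : IntegrableOn f (smoothRegion Q a)) :
    HasImproperIntegral f (smoothRegion Q a) (∫ u in smoothRegion Q a, f u) := by
  obtain ⟨K, hK, hm, h⟩ := exists_compact_exhaustion hQ
  have hD := measurableSet_smoothRegion hQ
  refine ⟨hf, fun ε hε => ?_⟩
  have hn : IntegrableOn (fun u => ‖f u‖) (⋃ n, K n) := by rw [← h]; exact hi.norm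
  have ht := tendsto_setIntegral_of_monotone (fun n => (hK n).measurableSet) hm hn
  rw [← h] at ht
  obtain ⟨n, hn⟩ := (ht.eventually (lt_mem_nhds (sub_lt_self _ hε))).exists
  refine ⟨K n, h ▸ subset_iUnion K n, hK n, fun L hL _ hKL hLD => ?_⟩
  rw [abs_sub_comm, ← setIntegral_sdiff hL.measurableSet hi hLD]
  calc |∫ u in smoothRegion Q a \ L, f u| ≤ ∫ u in smoothRegion Q a \ L, ‖f u‖ :=
        norm_integral_le_integral_norm f
    _ ≤ ∫ u in smoothRegion Q a \ K n, ‖f u‖ :=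
        setIntegral_mono_set (IntegrableOn.mono_set hi.norm sdiff_subset)
          (Eventually.of_forall fun u => norm_nonneg _)
          (sdiff_subset_sdiff_right hKL).eventuallyLE
    _ = (∫ u in smoothRegion Q a, ‖f u‖) - ∫ u in K n, ‖f u‖ :=
        setIntegral_sdiff (hK n).measurableSet hi.norm (h ▸ subset_iUnion K n)
    _ < ε := by linarith

/-- If the integrals over the exhaustion stayed below M, monotone convergence would make f
integrable. Nonnegativity passes a lower bound from K n to every larger compact set. -/
theorem improperIntegralDiverges_of_not_integrableOn {Q f : (Fin 2 → ℝ) → ℝ} {a : ℝ}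
    (hQ : ContinuousOn Q (window a)) (hf : ContinuousOn f (smoothRegion Q a))
    (h0 : ∀ u ∈ smoothRegion Q a, 0 ≤ f u) (hi : ¬IntegrableOn f (smoothRegion Q a)) :
    ImproperIntegralDiverges f (smoothRegion Q a) := by
  obtain ⟨K, hK, hm, h⟩ := exists_compact_exhaustion hQ
  have hD := measurableSet_smoothRegion hQ
  have hKD : ∀ n, K n ⊆ smoothRegion Q a := fun n => h ▸ subset_iUnion K n
  refine ⟨hf, fun M => ?_⟩
  have key : ∃ n, M ≤ ∫ u in K n, f u := by
    by_contra! hc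
    apply hi
    refine ⟨hf.aestronglyMeasurable hD, ?_⟩
    rw [hasFiniteIntegral_iff_ofReal ((ae_restrict_iff' hD).2 (Eventually.of_forall h0))]
    have h1 : ∫⁻ u in smoothRegion Q a, ENNReal.ofReal (f u)
        = ⨆ n, ∫⁻ u in K n, ENNReal.ofReal (f u) := by
      rw [h]
      exact setLIntegral_iUnion_of_directed _ hm.directed_le
    rw [h1]
    refine lt_of_le_of_lt (iSup_le fun n => ?_) (ENNReal.ofReal_lt_top (r := M))
    have hin : IntegrableOn f (K n) := (hf.mono (hKD n)).integrableOn_compact (hK n)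
    rw [← ofReal_integral_eq_lintegral_ofReal hin
      ((ae_restrict_iff' (hK n).measurableSet).2 (Eventually.of_forall fun u hu => h0 u (hKD n hu)))]
    exact ENNReal.ofReal_le_ofReal (hc n).le
  obtain ⟨n, hn⟩ := key
  refine ⟨K n, hKD n, hK n, fun L hL _ hKL hLD => hn.trans ?_⟩
  exact setIntegral_mono_set ((hf.mono hLD).integrableOn_compact hL)
    ((ae_restrict_iff' hL.measurableSet).2 (Eventually.of_forall fun u hu => h0 u (hLD hu)))
    hKL.eventuallyLE

theorem integrableOn_of_bounded {Q f : (Fin 2 → ℝ) → ℝ} {a C : ℝ}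
    (hQ : ContinuousOn Q (window a)) (hf : ContinuousOn f (smoothRegion Q a))
    (hC : ∀ u ∈ smoothRegion Q a, |f u| ≤ C) : IntegrableOn f (smoothRegion Q a) := by
  have hD := measurableSet_smoothRegion hQ
  refine Integrable.mono' (g := fun _ => C) (integrableOn_const (hs :=
    ((measure_mono (smoothRegion_subset_window Q a)).trans_lt
      (isCompact_window a).measure_lt_top).ne)) (hf.aestronglyMeasurable hD) ?_
  exact (ae_restrict_iff' hD).2 (Eventually.of_forall hC)

/-! ### Integrability near an isolated `A₃` point -/

theorem integrableOn_abs_rpow {r : ℝ} (hr : -1 < r) (a : ℝ) :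
    IntegrableOn (fun x : ℝ => |x| ^ r) (Icc (-a) a) := by
  rcases lt_or_ge a 0 with ha | ha
  · rw [Icc_eq_empty (by linarith)]; exact integrableOn_empty
  have h1 : IntervalIntegrable (fun x : ℝ => |x| ^ r) volume 0 a := by
    refine (intervalIntegral.intervalIntegrable_rpow' hr).congr fun x hx => ?_
    rw [uIoc_of_le ha] at hx
    simp [abs_of_pos hx.1]
  have h2 : IntervalIntegrable (fun x : ℝ => |x| ^ r) volume (-a) 0 := by
    have := (IntervalIntegrable.iff_comp_neg (by simp)).1 h1
    simpa using this.symm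
  exact (intervalIntegrable_iff_integrableOn_Icc_of_le (by linarith)).1 (h2.trans h1)

theorem integrableOn_window_mul {f g : ℝ → ℝ} {a : ℝ} (hf : IntegrableOn f (Icc (-a) a))
    (hg : IntegrableOn g (Icc (-a) a)) : IntegrableOn (fun u => f (u 0) * g (u 1)) (window a) := by
  have h1 : IntegrableOn (fun z : ℝ × ℝ => f z.1 * g z.2) (Icc (-a) a ×ˢ Icc (-a) a) := by
    have := Integrable.mul_prod hf hg
    rwa [Measure.prod_restrict] at this
  rw [window_eq]
  exact ((volume_preserving_finTwoArrow ℝ).integrableOn_comp_preimage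
    MeasurableEquiv.finTwoArrow.measurableEmbedding).2 h1

/-- On q < 2p² one has Δ ≥ p² + |q|, and weighted AM–GM bounds this below by a product of
one-variable powers whose inverses are integrable. -/
theorem integrableOn_div_Delta {f : (Fin 2 → ℝ) → ℝ} {a C : ℝ}
    (hf : ContinuousOn f (smoothRegion (fun u => u 1) a))
    (hC : ∀ u ∈ smoothRegion (fun u => u 1) a, |f u| ≤ C / Delta (fun u => u 1) u) :
    IntegrableOn f (smoothRegion (fun u => u 1) a) := by
  have hQ : ContinuousOn (fun u : Fin 2 → ℝ => u 1) (window a) := by fun_prop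
  have hD := measurableSet_smoothRegion hQ
  -- A weight θ in (0, 1/2) gives |p|^(2θ) |q|^(1−θ) with both exponents below 1; here θ = 1/4.
  have h1 := ((integrableOn_window_mul (integrableOn_abs_rpow (r := -(1 / 2)) (by norm_num) a)
    (integrableOn_abs_rpow (r := -(3 / 4)) (by norm_num) a)).mono_set
    (smoothRegion_subset_window (fun u => u 1) a)).const_mul (|C|)
  -- On the axes the dominating function has the default value 0 of a negative power of 0, so this
  -- null set is discarded.
  have hz : ∀ i : Fin 2, ∀ᵐ u : Fin 2 → ℝ, u i ≠ 0 := fun i =>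
    (Measure.quasiMeasurePreserving_eval (fun _ : Fin 2 => (volume : Measure ℝ)) i).ae
      (p := fun x : ℝ => x ≠ 0) (by simp [ae_iff])
  refine Integrable.mono' h1 (hf.aestronglyMeasurable hD) ?_
  rw [ae_restrict_iff' hD]
  filter_upwards [hz 0, hz 1] with u h0 h1 hu
  refine (hC u hu).trans ?_
  have hp : 0 < |u 0| := abs_pos.2 h0
  have hq : 0 < |u 1| := abs_pos.2 h1
  have hu2 : u 1 < 2 * u 0 ^ 2 := hu.2.2
  have hX : 0 < u 0 ^ 2 := by positivity
  have hY : u 0 ^ 2 + |u 1| ≤ Delta (fun u => u 1) u := by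
    unfold Delta
    rcases le_total 0 (u 1) with h | h
    · rw [abs_of_nonneg h]; linarith
    · rw [abs_of_nonpos h]; linarith
  have hW : |u 0| ^ (1 / 2 : ℝ) * |u 1| ^ (3 / 4 : ℝ) ≤ u 0 ^ 2 + |u 1| := by
    have h2 := Real.geom_mean_le_arith_mean2_weighted (w₁ := 1 / 4) (w₂ := 3 / 4) (by norm_num)
      (by norm_num) hX.le hq.le (by norm_num)
    have h3 : (u 0 ^ 2) ^ (1 / 4 : ℝ) = |u 0| ^ (1 / 2 : ℝ) := by
      rw [← sq_abs, ← Real.rpow_natCast, ← Real.rpow_mul hp.le]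
      norm_num
    rw [h3] at h2
    linarith
  have hW0 : 0 < |u 0| ^ (1 / 2 : ℝ) * |u 1| ^ (3 / 4 : ℝ) :=
    mul_pos (Real.rpow_pos_of_pos hp _) (Real.rpow_pos_of_pos hq _)
  rw [Real.rpow_neg hp.le, Real.rpow_neg hq.le, ← mul_inv, ← div_eq_mul_inv]
  calc C / Delta (fun u => u 1) u ≤ |C| / Delta (fun u => u 1) u := by
        gcongr
        · exact hW0.le.trans (hW.trans hY)
        · exact le_abs_self C
    _ ≤ |C| / (|u 0| ^ (1 / 2 : ℝ) * |u 1| ^ (3 / 4 : ℝ)) := by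
        gcongr
        exact hW.trans hY

/-! ### Logarithmic divergence -/

/-- By Fubini: the slice at p has length 2kp, which leaves the divergent integral of 2k/p. -/
theorem not_integrableOn_cone {a k : ℝ} (ha : 0 < a) (hk : 0 < k) :
    ¬IntegrableOn (fun u : Fin 2 → ℝ => (u 0 ^ 2)⁻¹) {u | u 0 ∈ Ioc 0 a ∧ |u 1| ≤ k * u 0} := by
  intro hi
  set T : Set (ℝ × ℝ) := {z | z.1 ∈ Ioc 0 a ∧ |z.2| ≤ k * z.1} with hT
  have hTm : MeasurableSet T :=
    (measurable_fst measurableSet_Ioc).inter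
      (measurableSet_le (f := fun z : ℝ × ℝ => |z.2|) (g := fun z : ℝ × ℝ => k * z.1)
        (by fun_prop) (by fun_prop))
  have h1 : IntegrableOn (fun z : ℝ × ℝ => (z.1 ^ 2)⁻¹) T :=
    ((volume_preserving_finTwoArrow ℝ).integrableOn_comp_preimage
      MeasurableEquiv.finTwoArrow.measurableEmbedding).1 hi
  have h2 := Integrable.integral_prod_left ((integrable_indicator_iff hTm).2 h1)
  have h3 : IntegrableOn (fun p : ℝ => 2 * k * p⁻¹) (Ioc 0 a) := by
    refine (h2.integrableOn (s := Ioc 0 a)).congr_fun (fun p hp => ?_) measurableSet_Ioc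
    have h4 : (fun q : ℝ => T.indicator (fun z : ℝ × ℝ => (z.1 ^ 2)⁻¹) (p, q))
        = (Icc (-(k * p)) (k * p)).indicator fun _ => (p ^ 2)⁻¹ := by
      ext q
      simp only [indicator, hT, mem_ofPred_eq, hp, true_and, mem_Icc, abs_le]
    have hp0 : 0 < p := hp.1
    have hkp : 0 ≤ k * p := by positivity
    simp only [h4]
    rw [integral_indicator measurableSet_Icc, setIntegral_const, Real.volume_real_Icc]
    rw [max_eq_left (by linarith), smul_eq_mul]
    field_simp
    ring
  have h5 : IntervalIntegrable (fun p : ℝ => p⁻¹) volume 0 a := by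
    rw [intervalIntegrable_iff_integrableOn_Ioc_of_le ha.le]
    refine (h3.const_mul (2 * k)⁻¹).congr (Eventually.of_forall fun p => ?_)
    field_simp
  rcases intervalIntegrable_inv_iff.1 h5 with h | h
  · exact ha.ne h
  · exact h (by simp [ha.le])

theorem arctan_le_self {x : ℝ} (hx : 0 < x) : Real.arctan x ≤ x := by
  have h := Real.lt_tan (Real.arctan_pos.2 hx) (Real.arctan_lt_pi_div_two x)
  rw [Real.tan_arctan] at h
  exact h.le

/-- The inner integral, up to a bounded error. -/
theorem integral_inv_sq_add_sq {A k a : ℝ} (hA : 0 < A) (hk : 0 < k) (ha : 0 < a) :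
    |(∫ r in (-a)..a, (A ^ 2 + k ^ 2 * r ^ 2)⁻¹) - Real.pi / k * A⁻¹| ≤ 2 / (k ^ 2 * a) := by
  have h1 : ∀ r ∈ uIcc (-a) a, HasDerivAt (fun r => (k * A)⁻¹ * Real.arctan (k / A * r))
      ((A ^ 2 + k ^ 2 * r ^ 2)⁻¹) r := by
    intro r _
    have h := ((hasDerivAt_id' r).const_mul (k / A)).arctan.const_mul (k * A)⁻¹
    refine h.congr_deriv ?_
    field_simp
  have hc : Continuous fun r : ℝ => (A ^ 2 + k ^ 2 * r ^ 2)⁻¹ :=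
    Continuous.inv₀ (by fun_prop) fun r => by positivity
  rw [intervalIntegral.integral_eq_sub_of_hasDerivAt h1 (hc.intervalIntegrable _ _), mul_neg,
    Real.arctan_neg]
  have hx : 0 < k / A * a := by positivity
  -- Writing arctan x = π/2 − arctan(1/x) splits off the main term; the remainder is at most 1/x.
  have h2 := Real.arctan_inv_of_pos hx
  have h3 := arctan_le_self (inv_pos.2 hx)
  have h4 := (Real.arctan_pos.2 (inv_pos.2 hx)).le
  have h5 : (k * A)⁻¹ * Real.arctan (k / A * a) - (k * A)⁻¹ * -Real.arctan (k / A * a)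
      - Real.pi / k * A⁻¹ = -(2 * (k * A)⁻¹ * Real.arctan (k / A * a)⁻¹) := by
    rw [h2]; field_simp; ring
  rw [h5, abs_neg, abs_of_nonneg (by positivity)]
  calc 2 * (k * A)⁻¹ * Real.arctan (k / A * a)⁻¹ ≤ 2 * (k * A)⁻¹ * (k / A * a)⁻¹ := by gcongr
    _ = 2 / (k ^ 2 * a) := by field_simp

theorem integral_inv_sqrt {s α a : ℝ} (hs : 0 < s) (hα : 0 < α) :
    ∫ p in (-a)..a, (√(s + α ^ 2 * p ^ 2))⁻¹ = 2 / α * Real.arsinh (α * a / √s) := by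
  have hs' := Real.sqrt_pos.2 hs
  have h1 : ∀ p ∈ uIcc (-a) a, HasDerivAt (fun p => α⁻¹ * Real.arsinh (α / √s * p))
      ((√(s + α ^ 2 * p ^ 2))⁻¹) p := by
    intro p _
    have h := ((hasDerivAt_id' p).const_mul (α / √s)).arsinh.const_mul α⁻¹
    refine h.congr_deriv ?_
    have h2 : √(s + α ^ 2 * p ^ 2) = √s * √(1 + (α / √s * p) ^ 2) := by
      rw [← Real.sqrt_mul hs.le, mul_pow, div_pow, Real.sq_sqrt hs.le]
      congr 1
      field_simp
    have h3 : 0 < √(1 + (α / √s * p) ^ 2) := Real.sqrt_pos.2 (by positivity)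
    rw [h2, smul_eq_mul]
    field_simp
  have hc : Continuous fun p : ℝ => (√(s + α ^ 2 * p ^ 2))⁻¹ :=
    Continuous.inv₀ (by fun_prop) fun r => (Real.sqrt_pos.2 (by positivity)).ne'
  rw [intervalIntegral.integral_eq_sub_of_hasDerivAt h1 (hc.intervalIntegrable _ _), mul_neg,
    Real.arsinh_neg, div_mul_eq_mul_div]
  ring

theorem tendsto_neg_log : Tendsto (fun t : ℝ => -Real.log t) (𝓝[>] 0) atTop :=
  tendsto_neg_atBot_atTop.comp Real.tendsto_log_nhdsGT_zero

/-- Up to the term −½ log t, the function arsinh(x/√(bt)) equals log(x + √(bt + x²)) − ½ log b,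
which stays bounded as t → 0. -/
theorem tendsto_arsinh_div_log {b x : ℝ} (hb : 0 < b) (hx : 0 < x) :
    Tendsto (fun t => Real.arsinh (x / √(b * t)) / -Real.log t) (𝓝[>] 0) (𝓝 (1 / 2)) := by
  have h1 : Tendsto (fun t => Real.log (x + √(b * t + x ^ 2)) - Real.log b / 2) (𝓝[>] 0)
      (𝓝 (Real.log (x + √(b * 0 + x ^ 2)) - Real.log b / 2)) := by
    refine Tendsto.mono_left (ContinuousAt.tendsto ?_) nhdsWithin_le_nhds
    have : x + √(b * 0 + x ^ 2) ≠ 0 := by positivity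
    exact ContinuousAt.sub (ContinuousAt.log (by fun_prop) this) continuousAt_const
  have h2 := (h1.div_atTop tendsto_neg_log).add_const (1 / 2 : ℝ)
  rw [zero_add] at h2
  refine h2.congr' ?_
  filter_upwards [Ioo_mem_nhdsGT (show (0 : ℝ) < 1 by norm_num)] with t ht
  have ht0 : 0 < t := ht.1
  have hl : Real.log t < 0 := Real.log_neg ht.1 ht.2
  have hbt : 0 < b * t := by positivity
  have hs := Real.sqrt_pos.2 hbt
  have h3 : Real.arsinh (x / √(b * t))
      = Real.log (x + √(b * t + x ^ 2)) - Real.log b / 2 - Real.log t / 2 := by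
    rw [Real.arsinh]
    have h4 : x / √(b * t) + √(1 + (x / √(b * t)) ^ 2) = (x + √(b * t + x ^ 2)) / √(b * t) := by
      rw [add_div, ← Real.sqrt_div' _ hbt.le, div_pow, Real.sq_sqrt hbt.le]
      congr 2
      field_simp
    rw [h4, Real.log_div (by positivity) hs.ne', Real.log_sqrt hbt.le,
      Real.log_mul hb.ne' ht0.ne']
    ring
  have hl' := hl.ne
  rw [h3]
  field_simp
  ring

theorem integral_window {f : ℝ × ℝ → ℝ} {a : ℝ} (ha : 0 ≤ a) (hf : Continuous f) :
    ∫ u in window a, f (u 0, u 1) = ∫ p in (-a)..a, ∫ r in (-a)..a, f (p, r) := by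
  have h1 := (volume_preserving_finTwoArrow ℝ).setIntegral_preimage_emb
    MeasurableEquiv.finTwoArrow.measurableEmbedding f (Icc (-a) a ×ˢ Icc (-a) a)
  rw [← window_eq] at h1
  have h2 : IntegrableOn f (Icc (-a) a ×ˢ Icc (-a) a) (volume.prod volume) :=
    hf.continuousOn.integrableOn_compact (isCompact_Icc.prod isCompact_Icc)
  have h3 := setIntegral_prod f h2
  have haa : -a ≤ a := by linarith
  simp only [intervalIntegral.integral_of_le haa, ← integral_Icc_eq_integral_Ioc]
  exact h1.trans h3

/-- The model for `Δ` near a disappearing crease. -/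
def modelDelta (b α k t : ℝ) (u : Fin 2 → ℝ) : ℝ := b * t + α ^ 2 * u 0 ^ 2 + k ^ 2 * u 1 ^ 2

theorem modelDelta_pos {b t : ℝ} (α k : ℝ) (hb : 0 < b) (ht : 0 < t) (u : Fin 2 → ℝ) :
    0 < modelDelta b α k t u := by
  unfold modelDelta; positivity

theorem continuous_modelDelta (b α k t : ℝ) : Continuous (modelDelta b α k t) := by
  unfold modelDelta; fun_prop

theorem continuous_inv_modelDelta {b t : ℝ} (α k : ℝ) (hb : 0 < b) (ht : 0 < t) :
    Continuous fun u => (modelDelta b α k t u)⁻¹ :=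
  (continuous_modelDelta b α k t).inv₀ fun u => (modelDelta_pos α k hb ht u).ne'

/-- The r-integral is π/(k √(bt + α²p²)) up to a bounded error. The p-integral of this is an arsinh
with coefficient 2π/(kα), and the arsinh contributes −½ log t. -/
theorem tendsto_integral_modelDelta {b α k a : ℝ} (hb : 0 < b) (hα : 0 < α) (hk : 0 < k)
    (ha : 0 < a) :
    Tendsto (fun t => (∫ u in window a, (modelDelta b α k t u)⁻¹) / -Real.log t) (𝓝[>] 0)
      (𝓝 (Real.pi / (k * α))) := by
  have key : ∀ t > 0, |(∫ u in window a, (modelDelta b α k t u)⁻¹)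
      - Real.pi / k * (2 / α * Real.arsinh (α * a / √(b * t)))| ≤ 2 / (k ^ 2 * a) * |a - (-a)| := by
    intro t ht
    have hbt : 0 < b * t := by positivity
    have hf : Continuous fun z : ℝ × ℝ => (b * t + α ^ 2 * z.1 ^ 2 + k ^ 2 * z.2 ^ 2)⁻¹ :=
      Continuous.inv₀ (by fun_prop) fun z => by positivity
    have h1 : ∫ u in window a, (modelDelta b α k t u)⁻¹
        = ∫ p in (-a)..a, ∫ r in (-a)..a, (b * t + α ^ 2 * p ^ 2 + k ^ 2 * r ^ 2)⁻¹ :=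
      integral_window ha.le hf
    have hc : Continuous fun p : ℝ => (√(b * t + α ^ 2 * p ^ 2))⁻¹ :=
      Continuous.inv₀ (by fun_prop) fun r => (Real.sqrt_pos.2 (by positivity)).ne'
    have hi : Continuous fun p : ℝ =>
        ∫ r in (-a)..a, (b * t + α ^ 2 * p ^ 2 + k ^ 2 * r ^ 2)⁻¹ :=
      intervalIntegral.continuous_parametric_intervalIntegral_of_continuous' hf _ _
    rw [h1, ← integral_inv_sqrt hbt hα, ← intervalIntegral.integral_const_mul,
      ← intervalIntegral.integral_sub (hi.intervalIntegrable _ _)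
        ((hc.const_mul _).intervalIntegrable _ _), ← Real.norm_eq_abs]
    refine intervalIntegral.norm_integral_le_of_norm_le_const fun p _ => ?_
    have hA : 0 < b * t + α ^ 2 * p ^ 2 := by positivity
    have h2 := integral_inv_sq_add_sq (Real.sqrt_pos.2 hA) hk ha
    rwa [Real.sq_sqrt hA.le] at h2
  have h1 := (tendsto_arsinh_div_log (x := α * a) hb (by positivity)).const_mul
    (Real.pi / k * (2 / α))
  have h2 : Tendsto (fun t => ((∫ u in window a, (modelDelta b α k t u)⁻¹)
      - Real.pi / k * (2 / α * Real.arsinh (α * a / √(b * t)))) / -Real.log t) (𝓝[>] 0)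
      (𝓝 0) := by
    refine squeeze_zero_norm' (a := fun t => 2 / (k ^ 2 * a) * |a - (-a)| / -Real.log t) ?_
      (tendsto_const_nhds.div_atTop tendsto_neg_log)
    filter_upwards [Ioo_mem_nhdsGT (show (0 : ℝ) < 1 by norm_num)] with t ht
    have hl : 0 < -Real.log t := neg_pos.2 (Real.log_neg ht.1 ht.2)
    rw [norm_div, Real.norm_eq_abs, Real.norm_eq_abs, abs_of_pos hl]
    gcongr
    exact key t ht.1
  have h3 := h2.add h1
  convert h3 using 2
  · ring
  · field_simp
    ring

/-- Only the origin matters: away from it the model is bounded below and the contribution dies after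
division by log t, while near it f equals g divided by the model up to ε divided by the model. -/
theorem tendsto_integral_div_log {b α k a δ B g : ℝ} {f : ℝ → (Fin 2 → ℝ) → ℝ} (hb : 0 < b)
    (hα : 0 < α) (hk : 0 < k) (ha : 0 < a) (hδ : 0 < δ)
    (hi : ∀ t ∈ Ioo 0 δ, IntegrableOn (f t) (window a))
    (hB : ∀ t ∈ Ioo 0 δ, ∀ u ∈ window a, |f t u| ≤ B / modelDelta b α k t u)
    (hg : ∀ ε > 0, ∃ η > 0, ∀ t ∈ Ioo 0 η, ∀ u ∈ window η,
      |f t u - g / modelDelta b α k t u| ≤ ε / modelDelta b α k t u) :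
    Tendsto (fun t => (∫ u in window a, f t u) / Real.log t) (𝓝[>] 0)
      (𝓝 (-(g * (Real.pi / (k * α))))) := by
  have hI := tendsto_integral_modelDelta hb hα hk ha
  set c₀ := Real.pi / (k * α) with hc₀
  have hc : 0 < c₀ := by positivity
  suffices h : Tendsto (fun t => ((∫ u in window a, f t u)
      - g * ∫ u in window a, (modelDelta b α k t u)⁻¹) / -Real.log t) (𝓝[>] 0) (𝓝 0) by
    have h2 := (h.add (hI.const_mul g)).neg
    rw [zero_add] at h2
    refine h2.congr fun t => ?_
    ring
  rw [Metric.tendsto_nhds]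
  intro ε' hε'
  -- Here c₀ + 1 is an eventual upper bound for the model integral divided by −log t.
  obtain ⟨ε, hε, hε2⟩ : ∃ ε > 0, ε * (c₀ + 1) < ε' / 2 :=
    ⟨ε' / (4 * (c₀ + 1)), by positivity, by
      rw [div_mul_eq_mul_div, div_lt_div_iff₀ (by positivity) (by norm_num)]; nlinarith⟩
  obtain ⟨η, hη, hηf⟩ := hg ε hε
  -- A lower bound for the model outside the window of size η, uniform in t > 0.
  set m := min (α ^ 2) (k ^ 2) * η ^ 2 with hm
  have hm0 : 0 < m := by have := lt_min (pow_pos hα 2) (pow_pos hk 2); positivity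
  set K := (|B| + |g|) / m with hK
  have hK0 : 0 ≤ K := by positivity
  have hpt : ∀ t ∈ Ioo 0 (min δ η), ∀ u ∈ window a,
      |f t u - g / modelDelta b α k t u| ≤ ε * (modelDelta b α k t u)⁻¹ + K := by
    intro t ht u hu
    have hM := modelDelta_pos α k hb ht.1 u
    have htδ : t ∈ Ioo 0 δ := ⟨ht.1, ht.2.trans_le (min_le_left _ _)⟩
    by_cases huη : u ∈ window η
    · have := hηf t ⟨ht.1, ht.2.trans_le (min_le_right _ _)⟩ u huη
      rw [div_eq_mul_inv ε] at this
      linarith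
    · have hmM : m ≤ modelDelta b α k t u := by
        have hbt : 0 < b * t := mul_pos hb ht.1
        have h0 : 0 ≤ α ^ 2 * u 0 ^ 2 := by positivity
        have h1 : 0 ≤ k ^ 2 * u 1 ^ 2 := by positivity
        rw [window, mem_ofPred_eq, not_and_or, not_le, not_le] at huη
        unfold modelDelta
        rcases huη with h | h
        · have h2 : η ^ 2 ≤ u 0 ^ 2 := by rw [← sq_abs (u 0)]; gcongr
          have h3 : m ≤ α ^ 2 * u 0 ^ 2 := by
            rw [hm]
            gcongr
            exact min_le_left _ _
          linarith
        · have h2 : η ^ 2 ≤ u 1 ^ 2 := by rw [← sq_abs (u 1)]; gcongr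
          have h3 : m ≤ k ^ 2 * u 1 ^ 2 := by
            rw [hm]
            gcongr
            exact min_le_right _ _
          linarith
      have h1 : |f t u| ≤ |B| / modelDelta b α k t u := (hB t htδ u hu).trans (by
        gcongr; exact le_abs_self B)
      have h2 : |g / modelDelta b α k t u| = |g| / modelDelta b α k t u := by
        rw [abs_div, abs_of_pos hM]
      calc |f t u - g / modelDelta b α k t u| ≤ |f t u| + |g / modelDelta b α k t u| := abs_sub _ _
        _ ≤ |B| / modelDelta b α k t u + |g| / modelDelta b α k t u := by rw [h2]; gcongr
        _ = (|B| + |g|) / modelDelta b α k t u := by ring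
        _ ≤ K := by rw [hK]; gcongr
        _ ≤ ε * (modelDelta b α k t u)⁻¹ + K := by
          have : 0 ≤ ε * (modelDelta b α k t u)⁻¹ := by positivity
          linarith
  set v := volume.real (window a) with hv
  have hint : ∀ t ∈ Ioo 0 (min δ η), |(∫ u in window a, f t u)
      - g * ∫ u in window a, (modelDelta b α k t u)⁻¹|
      ≤ ε * (∫ u in window a, (modelDelta b α k t u)⁻¹) + K * v := by
    intro t ht
    have i1 : IntegrableOn (fun u => (modelDelta b α k t u)⁻¹) (window a) :=
      (continuous_inv_modelDelta α k hb ht.1).continuousOn.integrableOn_compact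
        (isCompact_window a)
    have i2 := hi t ⟨ht.1, ht.2.trans_le (min_le_left _ _)⟩
    have i3 : IntegrableOn (fun _ : Fin 2 → ℝ => K) (window a) :=
      integrableOn_const (hs := (isCompact_window a).measure_lt_top.ne)
    rw [← integral_const_mul, ← integral_sub i2 (i1.const_mul g), ← Real.norm_eq_abs]
    have h1 : ∫ u in window a, (ε * (modelDelta b α k t u)⁻¹ + K)
        = ε * (∫ u in window a, (modelDelta b α k t u)⁻¹) + K * v := by
      rw [integral_add (i1.const_mul ε) i3, integral_const_mul, setIntegral_const, smul_eq_mul,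
        mul_comm v]
    rw [← h1]
    refine norm_integral_le_of_norm_le ((i1.const_mul ε).add i3) ?_
    refine (ae_restrict_iff' (isCompact_window a).measurableSet).2 (Eventually.of_forall ?_)
    intro u hu
    have := hpt t ht u hu
    rwa [div_eq_mul_inv] at this
  have hKv := (tendsto_const_nhds (x := K * v)).div_atTop tendsto_neg_log
  filter_upwards [Ioo_mem_nhdsGT (show (0 : ℝ) < 1 by norm_num),
    Ioo_mem_nhdsGT (lt_min hδ hη), hI.eventually (gt_mem_nhds (lt_add_one c₀)),
    hKv.eventually (gt_mem_nhds (half_pos hε'))] with t h1 h2 h3 h4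
  have hl : 0 < -Real.log t := neg_pos.2 (Real.log_neg h1.1 h1.2)
  rw [Real.dist_eq, sub_zero, abs_div, abs_of_pos hl]
  calc _ ≤ (ε * (∫ u in window a, (modelDelta b α k t u)⁻¹) + K * v) / -Real.log t := by
        gcongr; exact hint t h2
    _ = ε * ((∫ u in window a, (modelDelta b α k t u)⁻¹) / -Real.log t)
        + K * v / -Real.log t := by ring
    _ < ε * (c₀ + 1) + ε' / 2 := by
        have := mul_lt_mul_of_pos_left h3 hε
        linarith
    _ < ε' := by linarith

theorem Delta_pos {Q : (Fin 2 → ℝ) → ℝ} {a : ℝ} {u : Fin 2 → ℝ} (hu : u ∈ smoothRegion Q a) :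
    0 < Delta Q u := by
  have h1 : Q u < 2 * u 0 ^ 2 := hu.2.2
  unfold Delta
  nlinarith [sq_nonneg (u 0)]

theorem smoothRegion_subset_closedRegion (Q : (Fin 2 → ℝ) → ℝ) (a : ℝ) :
    smoothRegion Q a ⊆ closedRegion Q a := fun _ h => ⟨h.1, h.2.1, h.2.2.le⟩

/-! ### Estimates for a fold on a small window -/

namespace FoldedFamily

variable {Ω : Set (ℝ × (Fin 2 → ℝ))} {V : Set (ℝ × (Fin 3 → ℝ))}
  {h : ℝ → MetricField 3} {F : ℝ → (Fin 2 → ℝ) → Fin 3 → ℝ} {Q : ℝ → (Fin 2 → ℝ) → ℝ}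
  {e : ℝ → (Fin 2 → ℝ) → Fin 3 → ℝ}

/-- The coefficients of the fold are bounded by `C` at `v`. -/
structure BoundedAt (Ω : Set (ℝ × (Fin 2 → ℝ))) (h : ℝ → MetricField 3)
    (F : ℝ → (Fin 2 → ℝ) → Fin 3 → ℝ) (Δ : ℝ → (Fin 2 → ℝ) → ℝ)
    (e : ℝ → (Fin 2 → ℝ) → Fin 3 → ℝ) (C : ℝ) (v : ℝ × (Fin 2 → ℝ)) : Prop where
  mem : v ∈ Ω
  area : areaFactor (h v.1) (F v.1) (e v.1) v.2 ≤ C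
  gb : |gbExtension (h v.1) (F v.1) (Δ v.1) (e v.1) v.2| ≤ C
  ricci : |gbExtension (h v.1) (F v.1) (Δ v.1) (e v.1) v.2|
    / areaFactor (h v.1) (F v.1) (e v.1) v.2 ≤ C
  trace : |traceSqFactor (h v.1) (F v.1) (Δ v.1) (e v.1) v.2| ≤ C
  norm : |normSqFactor (h v.1) (F v.1) (Δ v.1) (e v.1) v.2| ≤ C

/-- The regularised quantities are continuous in (t, u) jointly, so one constant serves near a
point, for all nearby t at once. -/
theorem exists_boundedAt {Δ : ℝ → (Fin 2 → ℝ) → ℝ} (H : FoldedFamily Ω V h F Δ e)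
    {v₀ : ℝ × (Fin 2 → ℝ)} (h0 : v₀ ∈ Ω) :
    ∃ C, ∀ᶠ v in 𝓝 v₀, BoundedAt Ω h F Δ e C v := by
  have hn := H.isOpen_dom.mem_nhds h0
  have c1 := H.continuousOn_areaFactor.continuousAt hn
  have c2 := (H.continuousOn_gbExtension.continuousAt hn).abs
  have c3 := c2.div c1 (H.areaFactor_pos h0).ne'
  have c4 := (H.continuousOn_traceSqFactor.continuousAt hn).abs
  have c5 := (H.continuousOn_normSqFactor.continuousAt hn).abs
  obtain ⟨C1, h1⟩ := exists_gt (areaFactor (h v₀.1) (F v₀.1) (e v₀.1) v₀.2)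
  obtain ⟨C2, h2⟩ := exists_gt (|gbExtension (h v₀.1) (F v₀.1) (Δ v₀.1) (e v₀.1) v₀.2|)
  obtain ⟨C3, h3⟩ := exists_gt (|gbExtension (h v₀.1) (F v₀.1) (Δ v₀.1) (e v₀.1) v₀.2|
    / areaFactor (h v₀.1) (F v₀.1) (e v₀.1) v₀.2)
  obtain ⟨C4, h4⟩ := exists_gt (|traceSqFactor (h v₀.1) (F v₀.1) (Δ v₀.1) (e v₀.1) v₀.2|)
  obtain ⟨C5, h5⟩ := exists_gt (|normSqFactor (h v₀.1) (F v₀.1) (Δ v₀.1) (e v₀.1) v₀.2|)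
  refine ⟨max C1 (max C2 (max C3 (max C4 C5))), ?_⟩
  filter_upwards [hn, c1.eventually_lt_const h1, c2.eventually_lt_const h2,
    c3.eventually_lt_const h3, c4.eventually_lt_const h4, c5.eventually_lt_const h5]
    with v m0 m1 m2 m3 m4 m5
  exact ⟨m0, le_max_of_le_left m1.le, le_max_of_le_right (le_max_of_le_left m2.le),
    le_max_of_le_right (le_max_of_le_right (le_max_of_le_left m3.le)),
    le_max_of_le_right (le_max_of_le_right (le_max_of_le_right (le_max_of_le_left m4.le))),
    le_max_of_le_right (le_max_of_le_right (le_max_of_le_right (le_max_of_le_right m5.le)))⟩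

variable {t a C : ℝ}

theorem continuousOn_section {f : ℝ × (Fin 2 → ℝ) → ℝ} (hf : ContinuousOn f Ω)
    {s : Set (Fin 2 → ℝ)} (hs : ∀ u ∈ s, (t, u) ∈ Ω) : ContinuousOn (fun u => f (t, u)) s :=
  hf.comp (f := fun u => (t, u)) (by fun_prop) hs

theorem gaussBonnetRegular (H : FoldedFamily Ω V h F (fun t => Delta (Q t)) e)
    (hQ : ContinuousOn (Q t) (window a))
    (hb : ∀ u ∈ closedRegion (Q t) a, BoundedAt Ω h F (fun t => Delta (Q t)) e C (t, u)) :
    GaussBonnetRegular (h t) (F t) (Q t) a C := by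
  have hsub := smoothRegion_subset_closedRegion (Q t) a
  have hgb : EqOn (gbDensity (h t) (F t)) (gbExtension (h t) (F t) (Delta (Q t)) (e t))
      (smoothRegion (Q t) a) := fun u hu => H.gbDensity_eq (hb u (hsub hu)).mem (Delta_pos hu)
  have hG : ContinuousOn (gbExtension (h t) (F t) (Delta (Q t)) (e t)) (closedRegion (Q t) a) :=
    continuousOn_section H.continuousOn_gbExtension fun u hu => (hb u hu).mem
  have hgc : ContinuousOn (gbDensity (h t) (F t)) (smoothRegion (Q t) a) :=
    (hG.mono hsub).congr hgb
  have hle : ∀ u ∈ smoothRegion (Q t) a, |gbDensity (h t) (F t) u| ≤ C := fun u hu => by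
    rw [hgb hu]; exact (hb u (hsub hu)).gb
  have har : ∀ u ∈ smoothRegion (Q t) a, areaDensity (h t) (F t) u
      = Delta (Q t) u * areaFactor (h t) (F t) (e t) u := fun u hu =>
    H.areaDensity_eq (hb u (hsub hu)).mem (Delta_pos hu).le
  refine ⟨fun u hu => ?_, fun u hu => ?_, fun u hu => ?_, hle, ⟨_, hG, hgb⟩, ⟨_,
    hasImproperIntegral_of_integrableOn hQ hgc (integrableOn_of_bounded hQ hgc hle)⟩⟩
  · have hΔ := Delta_pos hu
    have hW := H.areaFactor_pos (hb u (hsub hu)).mem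
    have h1 := hgb hu
    rw [gbDensity, har u hu] at h1
    have h2 : surfaceRicci (h t) (F t) u = gbExtension (h t) (F t) (Delta (Q t)) (e t) u
        / areaFactor (h t) (F t) (e t) u / Delta (Q t) u := by
      rw [← h1]; field_simp
    rw [h2, abs_div, abs_div, abs_of_pos hΔ, abs_of_pos hW]
    gcongr
    exact (hb u (hsub hu)).ricci
  · rw [har u hu]
    exact mul_pos (Delta_pos hu) (H.areaFactor_pos (hb u (hsub hu)).mem)
  · rw [har u hu, mul_comm]
    have hΔ := Delta_pos hu
    gcongr
    exact (hb u (hsub hu)).area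

theorem continuousOn_traceSqDensity (H : FoldedFamily Ω V h F (fun t => Delta (Q t)) e)
    (hb : ∀ u ∈ smoothRegion (Q t) a, (t, u) ∈ Ω) :
    ContinuousOn (traceSqDensity (h t) (F t)) (smoothRegion (Q t) a) := by
  refine ContinuousOn.congr ?_ fun u hu => H.traceSqDensity_eq (hb u hu) (Delta_pos hu)
  exact (continuousOn_section H.continuousOn_traceSqFactor hb).div
    (continuousOn_section H.smooth_Δ.continuousOn hb) fun u hu => (Delta_pos hu).ne'

theorem continuousOn_normSqDensity (H : FoldedFamily Ω V h F (fun t => Delta (Q t)) e)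
    (hb : ∀ u ∈ smoothRegion (Q t) a, (t, u) ∈ Ω) :
    ContinuousOn (normSqDensity (h t) (F t)) (smoothRegion (Q t) a) := by
  refine ContinuousOn.congr ?_ fun u hu => H.normSqDensity_eq (hb u hu) (Delta_pos hu)
  exact (continuousOn_section H.continuousOn_normSqFactor hb).div
    (continuousOn_section H.smooth_Δ.continuousOn hb) fun u hu => (Delta_pos hu).ne'

theorem abs_traceSqDensity_le (H : FoldedFamily Ω V h F (fun t => Delta (Q t)) e) {u : Fin 2 → ℝ}
    (hb : BoundedAt Ω h F (fun t => Delta (Q t)) e C (t, u)) (hu : u ∈ smoothRegion (Q t) a) :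
    |traceSqDensity (h t) (F t) u| ≤ C / Delta (Q t) u := by
  have hΔ := Delta_pos hu
  rw [H.traceSqDensity_eq hb.mem hΔ, abs_div, abs_of_pos hΔ]
  gcongr
  exact hb.trace

theorem abs_normSqDensity_le (H : FoldedFamily Ω V h F (fun t => Delta (Q t)) e) {u : Fin 2 → ℝ}
    (hb : BoundedAt Ω h F (fun t => Delta (Q t)) e C (t, u)) (hu : u ∈ smoothRegion (Q t) a) :
    |normSqDensity (h t) (F t) u| ≤ C / Delta (Q t) u := by
  have hΔ := Delta_pos hu
  rw [H.normSqDensity_eq hb.mem hΔ, abs_div, abs_of_pos hΔ]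
  gcongr
  exact hb.norm

end FoldedFamily

/-! ### The swallowtail -/

/-- The horizon is the graph of the convex function `max_s (x s + y s² - s⁴)`. -/
theorem swallowtail_identity (p q s : ℝ) :
    3 * p ^ 4 - q * p ^ 2 - ((4 * p ^ 3 - 2 * q * p) * s + q * s ^ 2 - s ^ 4)
      = (s - p) ^ 2 * ((s + p) ^ 2 + (2 * p ^ 2 - q)) := by
  ring

/-- This is `swallowtail_identity` at s = p': below the crease value of q the maximum over s is
attained at p alone. -/
theorem swallowtail_param_unique {p p' q : ℝ} (hp : q < 2 * p ^ 2)
    (hx : 4 * p ^ 3 - 2 * q * p = 4 * p' ^ 3 - 2 * q * p')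
    (hz : 3 * p ^ 4 - q * p ^ 2 = 3 * p' ^ 4 - q * p' ^ 2) : p = p' := by
  have h1 := swallowtail_identity p q p'
  rw [hx, hz] at h1
  have h2 : (p' - p) ^ 2 * ((p' + p) ^ 2 + (2 * p ^ 2 - q)) = 0 := by rw [← h1]; ring
  rcases mul_eq_zero.1 h2 with h | h
  · have := pow_eq_zero_iff (two_ne_zero) |>.1 h
    linarith
  · nlinarith [sq_nonneg (p' + p)]

/-- Properness, needed for the window to cover a neighbourhood: since x = p(4p² − 2q), a large |p|
forces a large |x| when |q| is small. -/
theorem abs_le_of_swallowtail {p q a : ℝ} (ha : 0 < a) (hq : |q| ≤ a ^ 2)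
    (hx : |4 * p ^ 3 - 2 * q * p| < 2 * a ^ 3) : |p| ≤ a := by
  by_contra! h
  have h1 : |4 * p ^ 3 - 2 * q * p| = |p| * |4 * p ^ 2 - 2 * q| := by
    rw [← abs_mul]; ring_nf
  have h2 : 2 * a ^ 2 ≤ |4 * p ^ 2 - 2 * q| := by
    have h3 : a ^ 2 ≤ p ^ 2 := by rw [← sq_abs p]; gcongr
    refine le_trans ?_ (le_abs_self _)
    linarith [(abs_le.1 hq).2]
  have h4 : a * (2 * a ^ 2) ≤ |p| * |4 * p ^ 2 - 2 * q| := by gcongr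
  rw [h1] at hx
  linarith

theorem continuous_swallowtail : Continuous swallowtail := by
  refine continuous_pi fun i => ?_
  fin_cases i <;> simp only [swallowtail] <;> dsimp <;> fun_prop

/-- The fold direction of the swallowtail. -/
def swallowtailFold (u : Fin 2 → ℝ) : Fin 3 → ℝ := ![1, 0, u 0]

theorem swallowtail_tangent_one (u : Fin 2 → ℝ) :
    tangent swallowtail 1 u = ![-2 * u 0, 1, -u 0 ^ 2] := by
  have d0 : DifferentiableAt ℝ (fun v : Fin 2 → ℝ => v 0) u := by fun_prop
  have d1 : DifferentiableAt ℝ (fun v : Fin 2 → ℝ => v 1) u := by fun_prop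
  funext i
  fin_cases i <;> simp only [tangent, swallowtail] <;> dsimp <;>
    simp (disch := fun_prop) [pd_sub, pd_mul, pd_pow, pd_const, pd_coord]

/-- A single surface enters as a family constant in t. At fixed q the p-derivative is Δ (1, 0, p),
and the last component of e × ∂_q F is 1. -/
theorem foldedFamily_swallowtail {U : Set (Fin 3 → ℝ)} {h : MetricField 3} (hU : IsOpen U)
    (hh : SmoothOn h U) (hp : ∀ x ∈ U, (h x).PosDef) :
    FoldedFamily (univ ×ˢ (swallowtail ⁻¹' U)) (univ ×ˢ U) (fun _ => h) (fun _ => swallowtail)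
      (fun _ => Delta fun u => u 1) (fun _ => swallowtailFold) where
  isOpen_dom := isOpen_univ.prod (hU.preimage continuous_swallowtail)
  isOpen_cod := isOpen_univ.prod hU
  smooth_h i j := (hh i j).comp contDiffOn_snd fun v hv => hv.2
  posDef v hv := hp _ hv.2
  smooth_F i := by
    refine ContDiff.contDiffOn ?_
    fin_cases i <;> simp only [swallowtail] <;> dsimp <;> fun_prop
  mapsTo v hv := ⟨mem_univ _, hv.2⟩
  smooth_Δ := by
    refine ContDiff.contDiffOn ?_
    simp only [Delta]
    fun_prop
  smooth_e i := by
    refine ContDiff.contDiffOn ?_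
    fin_cases i <;> simp only [swallowtailFold] <;> dsimp <;> fun_prop
  fold t u _ i := by
    have d0 : DifferentiableAt ℝ (fun v : Fin 2 → ℝ => v 0) u := by fun_prop
    have d1 : DifferentiableAt ℝ (fun v : Fin 2 → ℝ => v 1) u := by fun_prop
    fin_cases i <;> simp only [swallowtail, swallowtailFold, Delta] <;> dsimp <;>
      simp (disch := fun_prop) [pd_sub, pd_mul, pd_pow, pd_const, pd_coord] <;> ring
  indep t u _ := by
    rw [swallowtail_tangent_one, swallowtailFold, cross_apply]
    intro h0
    simpa using congrFun h0 2

theorem genericCrossSection (U : Set (Fin 3 → ℝ)) (h : MetricField 3) (hU : IsOpen U)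
    (h0 : (0 : Fin 3 → ℝ) ∈ U) (hh : SmoothOn h U) (hp : ∀ x ∈ U, (h x).PosDef) :
    ∃ a₀ > 0, ∃ C : ℝ, ∀ a ∈ Ioo 0 a₀,
      MapsTo swallowtail (closedRegion (fun u => u 1) a) U ∧
      InjOn swallowtail (smoothRegion (fun u => u 1) a) ∧
      (∀ᶠ P in 𝓝[crossSection] (0 : Fin 3 → ℝ),
        ∃ u ∈ closedRegion (fun u => u 1) a, P = swallowtail u) ∧
      GaussBonnetRegular h swallowtail (fun u => u 1) a C ∧
      (∃ S₁ : ℝ, HasImproperIntegral (traceSqDensity h swallowtail)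
        (smoothRegion (fun u => u 1) a) S₁) ∧
      (∃ S₂ : ℝ, HasImproperIntegral (normSqDensity h swallowtail)
        (smoothRegion (fun u => u 1) a) S₂) := by
  have H := foldedFamily_swallowtail hU hh hp
  have hs0 : swallowtail 0 = 0 := by
    funext i; fin_cases i <;> simp [swallowtail]
  have hm0 : ((0 : ℝ), (0 : Fin 2 → ℝ)) ∈ univ ×ˢ (swallowtail ⁻¹' U) :=
    ⟨mem_univ _, by rw [mem_preimage, hs0]; exact h0⟩
  obtain ⟨C, hC⟩ := H.exists_boundedAt hm0
  have hC' := ((Continuous.prodMk_right (0 : ℝ)).tendsto (0 : Fin 2 → ℝ)).eventually hC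
  obtain ⟨a₀, ha₀, hball⟩ := Metric.eventually_nhds_iff_ball.1 hC'
  refine ⟨a₀, ha₀, C, fun a ha => ?_⟩
  have hwin : ∀ u ∈ window a, u ∈ Metric.ball (0 : Fin 2 → ℝ) a₀ := by
    intro u hu
    rw [mem_ball_zero_iff, pi_norm_lt_iff ha₀, Fin.forall_fin_two]
    exact ⟨hu.1.trans_lt ha.2, hu.2.trans_lt ha.2⟩
  have hb : ∀ u ∈ closedRegion (fun u : Fin 2 → ℝ => u 1) a, FoldedFamily.BoundedAt
      (univ ×ˢ (swallowtail ⁻¹' U)) (fun _ => h) (fun _ => swallowtail)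
      (fun _ => Delta fun u => u 1) (fun _ => swallowtailFold) C (0, u) := fun u hu =>
    hball u (hwin u ⟨hu.1, hu.2.1⟩)
  have hsub := smoothRegion_subset_closedRegion (fun u : Fin 2 → ℝ => u 1) a
  have hQ : ContinuousOn (fun u : Fin 2 → ℝ => u 1) (window a) := by fun_prop
  have ct := FoldedFamily.continuousOn_traceSqDensity (Q := fun _ u => u 1) (t := 0) (a := a) H
    fun u hu => (hb u (hsub hu)).mem
  have cn := FoldedFamily.continuousOn_normSqDensity (Q := fun _ u => u 1) (t := 0) (a := a) H
    fun u hu => (hb u (hsub hu)).mem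
  refine ⟨fun u hu => (hb u hu).mem.2, ?_, ?_, ?_, ?_, ?_⟩
  · intro u hu v _ huv
    have e0 : 4 * u 0 ^ 3 - 2 * u 1 * u 0 = 4 * v 0 ^ 3 - 2 * v 1 * v 0 := congrFun huv 0
    have e1 : u 1 = v 1 := congrFun huv 1
    have e2 : 3 * u 0 ^ 4 - u 1 * u 0 ^ 2 = 3 * v 0 ^ 4 - v 1 * v 0 ^ 2 := congrFun huv 2
    have hu2 : u 1 < 2 * u 0 ^ 2 := hu.2.2
    rw [← e1] at e0 e2
    have := swallowtail_param_unique hu2 e0 e2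
    funext i
    fin_cases i
    · exact this
    · exact e1
  · have c0 : ∀ᶠ P in 𝓝 (0 : Fin 3 → ℝ), |P 0| < 2 * a ^ 3 :=
      (by fun_prop : Continuous fun P : Fin 3 → ℝ => |P 0|).continuousAt.eventually_lt_const
        (by have := ha.1; simp; positivity)
    have c1 : ∀ᶠ P in 𝓝 (0 : Fin 3 → ℝ), |P 1| < min a (a ^ 2) :=
      (by fun_prop : Continuous fun P : Fin 3 → ℝ => |P 1|).continuousAt.eventually_lt_const
        (by have := ha.1; simp; exact ⟨this, by positivity⟩)
    filter_upwards [nhdsWithin_le_nhds c0, nhdsWithin_le_nhds c1, self_mem_nhdsWithin]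
      with P h1 h2 ⟨u, hu, hP⟩
    subst hP
    have h3 : |u 1| < min a (a ^ 2) := h2
    refine ⟨u, ⟨?_, (h3.trans_le (min_le_left _ _)).le, hu⟩, rfl⟩
    exact abs_le_of_swallowtail ha.1 (h3.trans_le (min_le_right _ _)).le h1
  · exact FoldedFamily.gaussBonnetRegular (Q := fun _ u => u 1) (t := 0) H hQ hb
  · exact ⟨_, hasImproperIntegral_of_integrableOn hQ ct (integrableOn_div_Delta ct fun u hu =>
      FoldedFamily.abs_traceSqDensity_le (Q := fun _ u => u 1) (t := 0) H (hb u (hsub hu)) hu)⟩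
  · exact ⟨_, hasImproperIntegral_of_integrableOn hQ cn (integrableOn_div_Delta cn fun u hu =>
      FoldedFamily.abs_normSqDensity_le (Q := fun _ u => u 1) (t := 0) H (hb u (hsub hu)) hu)⟩

/-! ### Lorentzian linear algebra -/

/-- The Minkowski pairing. -/
def mink (a b : Fin 4 → ℝ) : ℝ := -(a 0 * b 0) + a 1 * b 1 + a 2 * b 2 + a 3 * b 3

/-- Here a is a covector and v a vector, paired without a metric. Cauchy–Schwarz on the spatial
parts, whose a-part is shorter than |a 0|, makes v spacelike. -/
theorem mink_pos_of_orthogonal {a v : Fin 4 → ℝ} (ha : mink a a < 0)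
    (h : ∑ i, a i * v i = 0) (hv : v ≠ 0) : 0 < mink v v := by
  unfold mink at *
  rw [Fin.sum_univ_four] at h
  have hcs : (a 1 * v 1 + a 2 * v 2 + a 3 * v 3) ^ 2
      ≤ (a 1 ^ 2 + a 2 ^ 2 + a 3 ^ 2) * (v 1 ^ 2 + v 2 ^ 2 + v 3 ^ 2) := by
    nlinarith [sq_nonneg (a 1 * v 2 - a 2 * v 1), sq_nonneg (a 1 * v 3 - a 3 * v 1),
      sq_nonneg (a 2 * v 3 - a 3 * v 2)]
  have h0 : (a 0 * v 0) ^ 2 = (a 1 * v 1 + a 2 * v 2 + a 3 * v 3) ^ 2 := by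
    have : a 0 * v 0 = -(a 1 * v 1 + a 2 * v 2 + a 3 * v 3) := by linarith
    rw [this, neg_sq]
  have ha0 : 0 < a 0 ^ 2 := by nlinarith [sq_nonneg (a 1), sq_nonneg (a 2), sq_nonneg (a 3)]
  set S := v 1 ^ 2 + v 2 ^ 2 + v 3 ^ 2 with hS
  have hS0 : 0 < S := by
    by_contra hn
    have h1 : v 1 = 0 := by nlinarith [sq_nonneg (v 1), sq_nonneg (v 2), sq_nonneg (v 3)]
    have h2 : v 2 = 0 := by nlinarith [sq_nonneg (v 1), sq_nonneg (v 2), sq_nonneg (v 3)]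
    have h3 : v 3 = 0 := by nlinarith [sq_nonneg (v 1), sq_nonneg (v 2), sq_nonneg (v 3)]
    rw [h1, h2, h3] at h0
    have h4 : a 0 ^ 2 * v 0 ^ 2 = 0 := by rw [← mul_pow, h0]; ring
    have h5 : v 0 = 0 := by
      rcases mul_eq_zero.1 h4 with h | h
      · exact absurd h ha0.ne'
      · simpa using h
    exact hv (by funext i; fin_cases i <;> assumption)
  have h1 : a 0 ^ 2 * v 0 ^ 2 < a 0 ^ 2 * S := by
    calc a 0 ^ 2 * v 0 ^ 2 ≤ (a 1 ^ 2 + a 2 ^ 2 + a 3 ^ 2) * S := by rw [← mul_pow, h0]; exact hcs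
      _ < a 0 ^ 2 * S := by
        apply mul_lt_mul_of_pos_right _ hS0
        linarith
  have h2 := lt_of_mul_lt_mul_left h1 ha0.le
  rw [hS] at h2
  linarith

/-- Subtracting the multiple of n with the same time component leaves a purely spatial vector, whose
Minkowski square is that of b and so nonpositive. -/
theorem mink_null_parallel {n b : Fin 4 → ℝ} (hn : mink n n = 0) (hn0 : n ≠ 0)
    (hnb : mink n b = 0) (hb : mink b b ≤ 0) : ∃ c : ℝ, b = c • n := by
  unfold mink at *
  have h0 : n 0 ≠ 0 := by
    intro h
    rw [h] at hn
    have h1 : n 1 = 0 := by nlinarith [sq_nonneg (n 1), sq_nonneg (n 2), sq_nonneg (n 3)]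
    have h2 : n 2 = 0 := by nlinarith [sq_nonneg (n 1), sq_nonneg (n 2), sq_nonneg (n 3)]
    have h3 : n 3 = 0 := by nlinarith [sq_nonneg (n 1), sq_nonneg (n 2), sq_nonneg (n 3)]
    exact hn0 (by funext i; fin_cases i <;> assumption)
  set c := b 0 / n 0 with hc
  have hc0 : b 0 = c * n 0 := by rw [hc]; field_simp
  have key : (b 1 - c * n 1) ^ 2 + (b 2 - c * n 2) ^ 2 + (b 3 - c * n 3) ^ 2 ≤ 0 := by
    have : (b 1 - c * n 1) ^ 2 + (b 2 - c * n 2) ^ 2 + (b 3 - c * n 3) ^ 2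
        = (-(b 0 * b 0) + b 1 * b 1 + b 2 * b 2 + b 3 * b 3)
          - 2 * c * (-(n 0 * b 0) + n 1 * b 1 + n 2 * b 2 + n 3 * b 3)
          + c ^ 2 * (-(n 0 * n 0) + n 1 * n 1 + n 2 * n 2 + n 3 * n 3) := by
      rw [hc0]; ring
    rw [this, hnb, hn]
    linarith
  have k1 := sq_nonneg (b 1 - c * n 1)
  have k2 := sq_nonneg (b 2 - c * n 2)
  have k3 := sq_nonneg (b 3 - c * n 3)
  have e1 : b 1 - c * n 1 = 0 := by apply pow_eq_zero_iff two_ne_zero |>.1; linarith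
  have e2 : b 2 - c * n 2 = 0 := by apply pow_eq_zero_iff two_ne_zero |>.1; linarith
  have e3 : b 3 - c * n 3 = 0 := by apply pow_eq_zero_iff two_ne_zero |>.1; linarith
  refine ⟨c, ?_⟩
  funext i
  fin_cases i
  · exact hc0
  · exact sub_eq_zero.1 e1
  · exact sub_eq_zero.1 e2
  · exact sub_eq_zero.1 e3

namespace IsLorentzian

variable {G : Matrix (Fin 4) (Fin 4) ℝ}

theorem exists_frame (hG : IsLorentzian G) : ∃ P R : Matrix (Fin 4) (Fin 4) ℝ, P * R = 1 ∧
    R * P = 1 ∧ G = R.transpose * Matrix.diagonal ![-1, 1, 1, 1] * R ∧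
    G⁻¹ = P * Matrix.diagonal ![-1, 1, 1, 1] * P.transpose := by
  obtain ⟨P, hP, h⟩ := hG
  have h1 : P * P⁻¹ = 1 := Matrix.mul_nonsing_inv P hP
  have h2 : P⁻¹ * P = 1 := Matrix.nonsing_inv_mul P hP
  have h3 : P⁻¹.transpose * P.transpose = 1 := by rw [← Matrix.transpose_mul, h1, Matrix.transpose_one]
  have h4 : P.transpose * P⁻¹.transpose = 1 := by rw [← Matrix.transpose_mul, h2, Matrix.transpose_one]
  have hG : G = P⁻¹.transpose * Matrix.diagonal ![-1, 1, 1, 1] * P⁻¹ := by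
    rw [← h]
    calc G = (P⁻¹.transpose * P.transpose) * G * (P * P⁻¹) := by rw [h3, h1]; simp
      _ = _ := by simp only [Matrix.mul_assoc]
  have hd : (Matrix.diagonal ![-1, 1, 1, 1] : Matrix (Fin 4) (Fin 4) ℝ)
      * Matrix.diagonal ![-1, 1, 1, 1] = 1 := by
    rw [Matrix.diagonal_mul_diagonal, ← Matrix.diagonal_one]
    congr 1
    funext i
    fin_cases i <;> simp
  refine ⟨P, P⁻¹, h1, h2, hG, Matrix.inv_eq_right_inv ?_⟩
  calc G * (P * Matrix.diagonal ![-1, 1, 1, 1] * P.transpose)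
      = P⁻¹.transpose * Matrix.diagonal ![-1, 1, 1, 1] * (P⁻¹ * P)
        * Matrix.diagonal ![-1, 1, 1, 1] * P.transpose := by
        nth_rewrite 1 [hG]; simp only [Matrix.mul_assoc]
    _ = P⁻¹.transpose * (Matrix.diagonal ![-1, 1, 1, 1] * Matrix.diagonal ![-1, 1, 1, 1])
        * P.transpose := by rw [h2]; simp only [Matrix.mul_assoc, Matrix.one_mul]
    _ = 1 := by rw [hd, Matrix.mul_one, h3]

theorem det_ne_zero (hG : IsLorentzian G) : G.det ≠ 0 := by
  obtain ⟨P, R, h1, h2, h3, h4⟩ := hG.exists_frame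
  have hR : R.det ≠ 0 := by
    intro h0
    have := congrArg Matrix.det h1
    rw [Matrix.det_mul, h0, mul_zero, Matrix.det_one] at this
    exact zero_ne_one this
  rw [h3, Matrix.det_mul, Matrix.det_mul, Matrix.det_transpose, Matrix.det_diagonal]
  simp [Fin.prod_univ_four, hR]

theorem symm (hG : IsLorentzian G) (i j : Fin 4) : G i j = G j i := by
  obtain ⟨P, R, h1, h2, h3, h4⟩ := hG.exists_frame
  have : G.transpose = G := by
    rw [h3]; simp [Matrix.transpose_mul, Matrix.mul_assoc]
  exact congrFun (congrFun this j) i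

theorem inv_symm (hG : IsLorentzian G) (i j : Fin 4) : G⁻¹ i j = G⁻¹ j i := by
  obtain ⟨P, R, h1, h2, h3, h4⟩ := hG.exists_frame
  have : (G⁻¹).transpose = G⁻¹ := by
    rw [h4]; simp [Matrix.transpose_mul, Matrix.mul_assoc]
  exact congrFun (congrFun this j) i

theorem sum_eq_mink {M S : Matrix (Fin 4) (Fin 4) ℝ}
    (hM : M = S * Matrix.diagonal ![-1, 1, 1, 1] * S.transpose) (α β : Fin 4 → ℝ) :
    ∑ i, ∑ j, M i j * α i * β j = mink (Matrix.vecMul α S) (Matrix.vecMul β S) := by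
  rw [hM]
  simp only [mink, Matrix.vecMul, dotProduct, Matrix.mul_apply, Matrix.diagonal_apply,
    Matrix.transpose_apply, Fin.sum_univ_four]
  simp
  ring

/-- Coordinates in which the metric is the Minkowski metric. -/
theorem exists_coords (hG : IsLorentzian G) :
    ∃ (A B : (Fin 4 → ℝ) →ₗ[ℝ] (Fin 4 → ℝ)), Function.Injective A ∧ Function.Injective B ∧
      (∀ α β, ∑ i, ∑ j, G⁻¹ i j * α i * β j = mink (A α) (A β)) ∧
      (∀ v w, ∑ i, ∑ j, G i j * v i * w j = mink (B v) (B w)) ∧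
      (∀ α v, ∑ i, α i * v i = ∑ i, A α i * B v i) := by
  obtain ⟨P, R, h1, h2, h3, h4⟩ := hG.exists_frame
  refine ⟨P.vecMulLinear, R.transpose.vecMulLinear, ?_, ?_, fun α β => sum_eq_mink h4 α β,
    fun v w => sum_eq_mink (by rw [h3, Matrix.transpose_transpose]) v w, fun α v => ?_⟩
  · intro α β h
    have h' : Matrix.vecMul α P = Matrix.vecMul β P := h
    have := congrArg (fun x => Matrix.vecMul x R) h'
    simpa [Matrix.vecMul_vecMul, h1] using this
  · intro α β h
    have h' : Matrix.vecMul α R.transpose = Matrix.vecMul β R.transpose := h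
    have := congrArg (fun x => Matrix.vecMul x P.transpose) h'
    simpa [Matrix.vecMul_vecMul, ← Matrix.transpose_mul, h1] using this
  · change α ⬝ᵥ v = Matrix.vecMul α P ⬝ᵥ Matrix.vecMul v R.transpose
    rw [Matrix.vecMul_transpose, Matrix.dotProduct_mulVec, Matrix.vecMul_vecMul, h1,
      Matrix.vecMul_one]

theorem pos_of_orthogonal (hG : IsLorentzian G) {α v : Fin 4 → ℝ}
    (hα : ∑ i, ∑ j, G⁻¹ i j * α i * α j < 0) (h : ∑ i, α i * v i = 0) (hv : v ≠ 0) :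
    0 < ∑ i, ∑ j, G i j * v i * v j := by
  obtain ⟨A, B, hA, hB, h1, h2, h3⟩ := hG.exists_coords
  rw [h1] at hα
  rw [h3] at h
  rw [h2]
  exact mink_pos_of_orthogonal hα h fun h0 => hv (hB (by rw [h0, map_zero]))

theorem coPair_pos_of_null (hG : IsLorentzian G) {n β : Fin 4 → ℝ}
    (hn : ∑ i, ∑ j, G⁻¹ i j * n i * n j = 0) (hn0 : n ≠ 0)
    (hnb : ∑ i, ∑ j, G⁻¹ i j * n i * β j = 0) (hb : ∀ c : ℝ, β ≠ c • n) :
    0 < ∑ i, ∑ j, G⁻¹ i j * β i * β j := by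
  obtain ⟨A, B, hA, hB, h1, h2, h3⟩ := hG.exists_coords
  rw [h1] at *
  by_contra! hc
  obtain ⟨c, hc⟩ := mink_null_parallel hn (fun h0 => hn0 (hA (by rw [h0, map_zero]))) hnb hc
  exact hb c (hA (by rw [hc, map_smul]))

/-- Raising the index flips the time component of n in Minkowski coordinates. If α annihilated the
raised vector, that vector would be spacelike, yet it is null. -/
theorem coPair_ne_zero (hG : IsLorentzian G) {α n : Fin 4 → ℝ}
    (hα : ∑ i, ∑ j, G⁻¹ i j * α i * α j < 0)
    (hn : ∑ i, ∑ j, G⁻¹ i j * n i * n j = 0) (hn0 : n ≠ 0) :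
    ∑ i, ∑ j, G⁻¹ i j * α i * n j ≠ 0 := by
  obtain ⟨A, B, hA, hB, h1, h2, h3⟩ := hG.exists_coords
  rw [h1] at *
  intro h0
  have hA0 : A n ≠ 0 := fun h => hn0 (hA (by rw [h, map_zero]))
  have h5 := mink_pos_of_orthogonal (v := ![-A n 0, A n 1, A n 2, A n 3]) hα
    (by rw [← h0, mink, Fin.sum_univ_four]; simp) (by
      intro h
      apply hA0
      have e0 := congrFun h 0
      have e1 := congrFun h 1
      have e2 := congrFun h 2
      have e3 := congrFun h 3
      simp at e0 e1 e2 e3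
      funext i
      fin_cases i <;> assumption)
  have h6 : mink ![-A n 0, A n 1, A n 2, A n 3] ![-A n 0, A n 1, A n 2, A n 3]
      = mink (A n) (A n) := by
    simp [mink]
  linarith

/-- The vector v with its index lowered is null and orthogonal to the null n, hence parallel to it;
so v is c times n with its index raised. -/
theorem null_vector (hG : IsLorentzian G) {n v : Fin 4 → ℝ}
    (hn : ∑ i, ∑ j, G⁻¹ i j * n i * n j = 0) (hn0 : n ≠ 0)
    (hv : ∑ i, ∑ j, G i j * v i * v j = 0) (hnv : ∑ i, n i * v i = 0) :
    ∃ c : ℝ, ∀ α : Fin 4 → ℝ, ∑ i, α i * v i = c * ∑ i, ∑ j, G⁻¹ i j * α i * n j := by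
  obtain ⟨A, B, hA, hB, h1, h2, h3⟩ := hG.exists_coords
  rw [h1] at hn
  rw [h2] at hv
  rw [h3] at hnv
  obtain ⟨c, hc⟩ := mink_null_parallel (b := ![-B v 0, B v 1, B v 2, B v 3]) hn
    (fun h0 => hn0 (hA (by rw [h0, map_zero])))
    (by rw [← hnv, mink, Fin.sum_univ_four]; simp)
    (by rw [← hv]; simp [mink])
  refine ⟨c, fun α => ?_⟩
  rw [h1, h3]
  have e0 := congrFun hc 0
  have e1 := congrFun hc 1
  have e2 := congrFun hc 2
  have e3 := congrFun hc 3
  simp at e0 e1 e2 e3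
  rw [mink, Fin.sum_univ_four, e1, e2, e3, show B v 0 = -(c * A n 0) by linarith]
  ring

end IsLorentzian

/-! ### Tangent vectors of the horizon at the crease -/

theorem nonneg_of_hasDerivWithinAt {f : ℝ → ℝ} {f' ε : ℝ} (hε : 0 < ε)
    (hf : HasDerivWithinAt f f' (Ici 0) 0) (h0 : f 0 = 0) (hnn : ∀ s ∈ Ico 0 ε, 0 ≤ f s) :
    0 ≤ f' := by
  have h1 := hasDerivWithinAt_iff_tendsto_slope.1 hf
  rw [Ici_sdiff_left] at h1
  refine ge_of_tendsto h1 ?_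
  filter_upwards [Ioo_mem_nhdsGT hε] with s hs
  rw [slope_def_field, h0, sub_zero, sub_zero]
  exact div_nonneg (hnn s ⟨hs.1.le, hs.2⟩) hs.1.le

theorem horizon_ge {P : Fin 4 → ℝ} (hP : P ∈ horizon) (s : ℝ) :
    0 ≤ P 3 - s * P 1 - s ^ 2 * P 2 + s ^ 4 := by
  obtain ⟨w, p, q, hq, rfl⟩ := hP
  have h1 := swallowtail_identity p q s
  have h2 : 0 ≤ (s - p) ^ 2 * ((s + p) ^ 2 + (2 * p ^ 2 - q)) :=
    mul_nonneg (sq_nonneg _) (add_nonneg (sq_nonneg _) (by linarith))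
  simp [bigWavefront]
  linarith

/-- On the wavefront z − q²/4 = x p − (p² − q/2)², and the bound on |x| confines |p| to at most m.
-/
theorem horizon_le {P : Fin 4 → ℝ} (hP : P ∈ horizon) {m : ℝ} (hm : 0 ≤ m)
    (h1 : |P 1| < m * (4 * m ^ 2 - 2 * P 2)) : P 3 - P 2 ^ 2 / 4 ≤ |P 1| * m := by
  obtain ⟨w, p, q, hq, rfl⟩ := hP
  simp only [bigWavefront] at *
  simp at h1 ⊢
  have hp : |p| ≤ m := by
    by_contra! h
    have h2 : |4 * p ^ 3 - 2 * q * p| = |p| * |4 * p ^ 2 - 2 * q| := by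
      rw [← abs_mul]; ring_nf
    have h3 : m ^ 2 ≤ p ^ 2 := by rw [← sq_abs p]; gcongr
    have h5 : 4 * m ^ 2 - 2 * q ≤ |4 * p ^ 2 - 2 * q| := le_trans (by linarith) (le_abs_self _)
    have h6 : m * (4 * m ^ 2 - 2 * q) ≤ m * |4 * p ^ 2 - 2 * q| := by gcongr
    have h7 : m * |4 * p ^ 2 - 2 * q| ≤ |p| * |4 * p ^ 2 - 2 * q| := by gcongr
    rw [h2] at h1
    linarith
  have h2 : (4 * p ^ 3 - 2 * q * p) * p ≤ |4 * p ^ 3 - 2 * q * p| * m := by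
    refine (le_abs_self _).trans ?_
    rw [abs_mul]
    gcongr
  nlinarith [sq_nonneg (q - 2 * p ^ 2)]

/-- Near the crease the horizon is the upper envelope of the sheets ±p₀, so v 3 = p₀² v 2 + p₀ |v
1|. The sign of p is that of v 1, and the last inequality puts v on or above the other sheet. -/
theorem crease_tangent {γ : ℝ → Fin 4 → ℝ} {v : Fin 4 → ℝ} {ε p₀ : ℝ} (hε : 0 < ε) (hp₀ : 0 < p₀)
    (h0 : γ 0 = bigWavefront 0 p₀ (2 * p₀ ^ 2)) (hγ : ∀ s ∈ Ico 0 ε, γ s ∈ horizon)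
    (hd : HasDerivWithinAt γ v (Ici 0) 0) :
    ∃ p : ℝ, p ^ 2 = p₀ ^ 2 ∧ v 3 - p * v 1 - p ^ 2 * v 2 = 0 ∧
      0 ≤ v 3 + p * v 1 - p ^ 2 * v 2 := by
  have e1 : γ 0 1 = 0 := by rw [h0]; simp [bigWavefront]; ring
  have e2 : γ 0 2 = 2 * p₀ ^ 2 := by rw [h0]; simp [bigWavefront]
  have e3 : γ 0 3 = p₀ ^ 4 := by rw [h0]; simp [bigWavefront]; ring
  have hdi : ∀ i, HasDerivWithinAt (fun s => γ s i) (v i) (Ici 0) 0 := hasDerivWithinAt_pi.1 hd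
  have hge : ∀ p : ℝ, p ^ 2 = p₀ ^ 2 → 0 ≤ v 3 - p * v 1 - p ^ 2 * v 2 := by
    intro p hp
    refine nonneg_of_hasDerivWithinAt (f := fun s => γ s 3 - p * γ s 1 - p ^ 2 * γ s 2 + p ^ 4) hε
      ((((hdi 3).sub ((hdi 1).const_mul p)).sub ((hdi 2).const_mul (p ^ 2))).add_const _) ?_
      fun s hs => horizon_ge (hγ s hs) p
    have : p ^ 4 = p₀ ^ 4 := by rw [show p ^ 4 = (p ^ 2) ^ 2 by ring, hp]; ring
    simp only [e1, e2, e3, this, hp]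
    ring
  have hsl : ∀ {f : ℝ → ℝ} {f' : ℝ}, HasDerivWithinAt f f' (Ici 0) 0 →
      Tendsto (fun s => (f s - f 0) / s) (𝓝[>] 0) (𝓝 f') := by
    intro f f' hf
    have h1 := hasDerivWithinAt_iff_tendsto_slope.1 hf
    rw [Ici_sdiff_left] at h1
    refine h1.congr fun s => ?_
    rw [slope_def_field, sub_zero]
  -- At the crease 4p₀² − 2y = 0, so m = p₀ is excluded from `horizon_le`; m = p₀ + η is allowed
  -- near the crease, and η tends to 0 afterwards.
  have hle : ∀ η > 0, v 3 - p₀ ^ 2 * v 2 ≤ |v 1| * (p₀ + η) := by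
    intro η hη
    have t1 := ((hsl (hdi 1)).abs.mul_const (p₀ + η)).sub
      (hsl ((hdi 3).sub (((hdi 2).pow 2).div_const 4)))
    have hcont : Tendsto γ (𝓝[>] 0) (𝓝 (γ 0)) :=
      hd.continuousWithinAt.tendsto.mono_left (nhdsWithin_mono _ Ioi_subset_Ici_self)
    have hF : ContinuousAt (fun P : Fin 4 → ℝ =>
        (p₀ + η) * (4 * (p₀ + η) ^ 2 - 2 * P 2) - |P 1|) (γ 0) := by fun_prop
    have hev : ∀ᶠ s in 𝓝[>] 0,
        0 < (p₀ + η) * (4 * (p₀ + η) ^ 2 - 2 * γ s 2) - |γ s 1| := by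
      refine (hF.tendsto.comp hcont).eventually (lt_mem_nhds ?_)
      rw [e1, e2, abs_zero, sub_zero]
      have : 0 < 4 * (p₀ + η) ^ 2 - 2 * (2 * p₀ ^ 2) := by nlinarith
      positivity
    have hlim := ge_of_tendsto t1 (b := 0) (by
      filter_upwards [hev, Ioo_mem_nhdsGT hε] with s hs hsε
      have h2 := horizon_le (hγ s ⟨hsε.1.le, hsε.2⟩) (by positivity : 0 ≤ p₀ + η) (by linarith)
      have hs0 : 0 < s := hsε.1
      simp only [Pi.sub_apply, Pi.pow_apply, e1, e2, e3, sub_zero]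
      rw [abs_div, abs_of_pos hs0, div_mul_eq_mul_div, ← sub_div]
      refine div_nonneg ?_ hs0.le
      nlinarith)
    simp only [e2] at hlim
    norm_num at hlim
    linarith
  have hle' : v 3 - p₀ ^ 2 * v 2 ≤ |v 1| * p₀ := by
    have t : Tendsto (fun η => |v 1| * (p₀ + η)) (𝓝[>] 0) (𝓝 (|v 1| * (p₀ + 0))) :=
      (Continuous.tendsto (by fun_prop) 0).mono_left nhdsWithin_le_nhds
    rw [add_zero] at t
    exact ge_of_tendsto t (eventually_mem_nhdsWithin.mono fun η hη => hle η hη)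
  rcases le_total 0 (v 1) with h | h
  · rw [abs_of_nonneg h] at hle'
    have g1 := hge p₀ rfl
    have g2 := hge (-p₀) (by ring)
    exact ⟨p₀, rfl, by linarith, by linarith⟩
  · rw [abs_of_nonpos h] at hle'
    have g1 := hge p₀ rfl
    have g2 := hge (-p₀) (by ring)
    exact ⟨-p₀, by ring, by linarith, by linarith⟩

theorem continuous_bigWavefront :
    Continuous fun v : ℝ × ℝ × ℝ => bigWavefront v.1 v.2.1 v.2.2 := by
  refine continuous_pi fun i => ?_
  fin_cases i <;> simp only [bigWavefront] <;> dsimp <;> fun_prop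

theorem bigWavefront_zero : bigWavefront 0 0 0 = 0 := by
  funext i; fin_cases i <;> simp [bigWavefront]

/-! ### Causal constraints on the metric and on τ at the A₃ point -/

namespace IsA3Perestroika

variable {U : Set (Fin 4 → ℝ)} {g : MetricField 4} {τ : (Fin 4 → ℝ) → ℝ}

theorem smooth_inv (H : IsA3Perestroika U g τ) (i j : Fin 4) :
    ContDiffOn ℝ ∞ (fun x => (g x)⁻¹ i j) U :=
  contDiffOn_matrix_inv H.smooth_metric (fun v hv => (H.lorentzian v hv).det_ne_zero) i j

theorem continuousAt_inv (H : IsA3Perestroika U g τ) {x : Fin 4 → ℝ} (hx : x ∈ U) (i j : Fin 4) :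
    ContinuousAt (fun x => (g x)⁻¹ i j) x :=
  (H.smooth_inv i j).continuousOn.continuousAt (H.isOpen.mem_nhds hx)

theorem contDiffAt_time (H : IsA3Perestroika U g τ) {x : Fin 4 → ℝ} (hx : x ∈ U) :
    ContDiffAt ℝ ∞ τ x :=
  H.smooth_time.contDiffAt (H.isOpen.mem_nhds hx)

/-- Nullness passes to the crease by continuity, letting q increase to its value at fixed p. -/
theorem null_of_le (H : IsA3Perestroika U g τ) {w p q : ℝ} (hq : q ≤ 2 * p ^ 2)
    (hU : bigWavefront w p q ∈ U) :
    coPair g (bigWavefront w p q) ![0, -p, -p ^ 2, 1] ![0, -p, -p ^ 2, 1] = 0 := by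
  have hc : ContinuousAt (fun q' => bigWavefront w p q') q :=
    (continuous_bigWavefront.comp (f := fun q' => (w, p, q')) (by fun_prop)).continuousAt
  have hf : ContinuousAt (fun q' => coPair g (bigWavefront w p q') ![0, -p, -p ^ 2, 1]
      ![0, -p, -p ^ 2, 1]) q := by
    unfold coPair
    exact tendsto_finsetSum _ fun i _ => tendsto_finsetSum _ fun j _ =>
      (((H.continuousAt_inv hU i j).comp (f := fun q' => bigWavefront w p q') hc).mul
        continuousAt_const).mul continuousAt_const
  refine tendsto_nhds_unique (hf.tendsto.mono_left nhdsWithin_le_nhds)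
    (tendsto_const_nhds.congr' (f₁ := fun _ => 0) (l₁ := 𝓝[<] q) ?_)
  filter_upwards [self_mem_nhdsWithin,
    nhdsWithin_le_nhds (hc.eventually_mem (H.isOpen.mem_nhds hU))] with q' h1 h2
  exact (H.null w p q' (lt_of_lt_of_le h1 hq) h2).symm

theorem coPair_conormal (H : IsA3Perestroika U g τ) {x : Fin 4 → ℝ} (hx : x ∈ U) (p : ℝ) :
    coPair g x ![0, -p, -p ^ 2, 1] ![0, -p, -p ^ 2, 1]
      = (g x)⁻¹ 3 3 + p ^ 2 * ((g x)⁻¹ 1 1 - 2 * (g x)⁻¹ 2 3) + p ^ 4 * (g x)⁻¹ 2 2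
        - 2 * p * ((g x)⁻¹ 1 3 - p ^ 2 * (g x)⁻¹ 1 2) := by
  have hs := (H.lorentzian x hx).inv_symm
  simp [coPair, Fin.sum_univ_four]
  rw [hs 2 1, hs 3 1, hs 3 2]
  ring

/-- The crease through the `A₃` point at the origin. -/
theorem eventually_crease (H : IsA3Perestroika U g τ) : ∀ᶠ s in 𝓝[>] (0 : ℝ),
    ![0, 0, 2 * s, s ^ 2] ∈ U ∧
    (g ![0, 0, 2 * s, s ^ 2])⁻¹ 1 3 = s * (g ![0, 0, 2 * s, s ^ 2])⁻¹ 1 2 ∧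
    (g ![0, 0, 2 * s, s ^ 2])⁻¹ 3 3 + s * ((g ![0, 0, 2 * s, s ^ 2])⁻¹ 1 1
      - 2 * (g ![0, 0, 2 * s, s ^ 2])⁻¹ 2 3) + s ^ 2 * (g ![0, 0, 2 * s, s ^ 2])⁻¹ 2 2 = 0 := by
  have hc : Continuous fun s : ℝ => (![0, 0, 2 * s, s ^ 2] : Fin 4 → ℝ) := by
    refine continuous_pi fun i => ?_
    fin_cases i <;> dsimp <;> fun_prop
  have h0 : (![0, 0, 2 * 0, 0 ^ 2] : Fin 4 → ℝ) = 0 := by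
    funext i; fin_cases i <;> simp
  have hU : ∀ᶠ s in 𝓝 (0 : ℝ), ![0, 0, 2 * s, s ^ 2] ∈ U :=
    hc.continuousAt.eventually_mem (H.isOpen.mem_nhds (by rw [h0]; exact H.zero_mem))
  filter_upwards [nhdsWithin_le_nhds hU, self_mem_nhdsWithin] with s hs hs0
  have hs0' : (0 : ℝ) < s := hs0
  have hn : ∀ p : ℝ, p ^ 2 = s →
      coPair g ![0, 0, 2 * s, s ^ 2] ![0, -p, -p ^ 2, 1] ![0, -p, -p ^ 2, 1] = 0 := by
    intro p hp
    have hb : bigWavefront 0 p (2 * p ^ 2) = ![0, 0, 2 * s, s ^ 2] := by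
      rw [← hp]
      funext i; fin_cases i <;> simp [bigWavefront] <;> ring
    have := H.null_of_le (w := 0) (le_refl (2 * p ^ 2)) (by rw [hb]; exact hs)
    rwa [hb] at this
  -- The parameters √s and −√s give the same point, so the null condition splits into its even and
  -- odd parts in p.
  have h1 := hn (√s) (Real.sq_sqrt hs0'.le)
  have h2 := hn (-√s) (by rw [neg_sq, Real.sq_sqrt hs0'.le])
  rw [H.coPair_conormal hs] at h1 h2
  have e2 : √s ^ 2 = s := Real.sq_sqrt hs0'.le
  have e4 : √s ^ 4 = s ^ 2 := by rw [show √s ^ 4 = (√s ^ 2) ^ 2 by ring, e2]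
  have e4' : (-√s) ^ 4 = s ^ 2 := by rw [← e4]; ring
  rw [neg_sq] at h2
  rw [e2, e4] at h1
  rw [e2, e4'] at h2
  refine ⟨hs, ?_, by linarith⟩
  have h3 : √s * ((g ![0, 0, 2 * s, s ^ 2])⁻¹ 1 3 - s * (g ![0, 0, 2 * s, s ^ 2])⁻¹ 1 2) = 0 := by
    linarith
  rcases mul_eq_zero.1 h3 with h | h
  · exact absurd h (Real.sqrt_pos.2 hs0').ne'
  · linarith

theorem tendsto_crease : Tendsto (fun s : ℝ => (![0, 0, 2 * s, s ^ 2] : Fin 4 → ℝ)) (𝓝 0) (𝓝 0) := by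
  have hc : Continuous fun s : ℝ => (![0, 0, 2 * s, s ^ 2] : Fin 4 → ℝ) := by
    refine continuous_pi fun i => ?_
    fin_cases i <;> dsimp <;> fun_prop
  have h0 : (![0, 0, 2 * 0, 0 ^ 2] : Fin 4 → ℝ) = 0 := by
    funext i; fin_cases i <;> simp
  have := hc.tendsto 0
  rwa [h0] at this

/-- For the third relation: g³³ vanishes on the half-line p = 0, q < 0, so its y-derivative at the
origin is 0. The crease starts in the y-direction, so g³³ = o(s) along it, and the even crease
relation divided by s gives g¹¹ = 2g²³ in the limit. -/
theorem inv_at_zero (H : IsA3Perestroika U g τ) :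
    (g 0)⁻¹ 3 3 = 0 ∧ (g 0)⁻¹ 1 3 = 0 ∧ (g 0)⁻¹ 1 1 = 2 * (g 0)⁻¹ 2 3 := by
  have hI : ∀ i j, Tendsto (fun s : ℝ => (g ![0, 0, 2 * s, s ^ 2])⁻¹ i j) (𝓝[>] 0)
      (𝓝 ((g 0)⁻¹ i j)) := fun i j =>
    (H.continuousAt_inv H.zero_mem i j).tendsto.comp
      (tendsto_crease.mono_left nhdsWithin_le_nhds)
  have hs : Tendsto (fun s : ℝ => s) (𝓝[>] 0) (𝓝 0) := tendsto_id.mono_left nhdsWithin_le_nhds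
  have h33 : (g 0)⁻¹ 3 3 = 0 := by
    have h1 := H.null_of_le (w := 0) (p := 0) (q := 0) (by norm_num)
      (by rw [bigWavefront_zero]; exact H.zero_mem)
    rw [bigWavefront_zero, H.coPair_conormal H.zero_mem] at h1
    simpa using h1
  have h13 : (g 0)⁻¹ 1 3 = 0 := by
    have h2 := hs.mul (hI 1 2)
    rw [zero_mul] at h2
    exact tendsto_nhds_unique (hI 1 3) (h2.congr' (H.eventually_crease.mono fun s h => h.2.1.symm))
  refine ⟨h33, h13, ?_⟩
  set f : (Fin 4 → ℝ) → ℝ := fun x => (g x)⁻¹ 3 3 with hf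
  have hd : HasFDerivAt f (fderiv ℝ f 0) 0 :=
    (((H.smooth_inv 3 3).contDiffAt (H.isOpen.mem_nhds H.zero_mem)).differentiableAt
      (by simp)).hasFDerivAt
  have hline : HasDerivAt (fun s : ℝ => (![0, 0, s, 0] : Fin 4 → ℝ)) ![0, 0, 1, 0] 0 := by
    refine hasDerivAt_pi.2 fun i => ?_
    fin_cases i
    · exact hasDerivAt_const _ _
    · exact hasDerivAt_const _ _
    · exact hasDerivAt_id' _
    · exact hasDerivAt_const _ _
  have hcurve : HasDerivAt (fun s : ℝ => (![0, 0, 2 * s, s ^ 2] : Fin 4 → ℝ)) ![0, 0, 2, 0] 0 := by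
    refine hasDerivAt_pi.2 fun i => ?_
    fin_cases i
    · exact hasDerivAt_const _ _
    · exact hasDerivAt_const _ _
    · simpa using (hasDerivAt_id' (0 : ℝ)).const_mul 2
    · simpa using hasDerivAt_pow 2 (0 : ℝ)
  have hl0 : (![0, 0, 0, 0] : Fin 4 → ℝ) = 0 := by funext i; fin_cases i <;> simp
  have hc0 : (![0, 0, 2 * 0, 0 ^ 2] : Fin 4 → ℝ) = 0 := by funext i; fin_cases i <;> simp
  have hd1 : HasFDerivAt f (fderiv ℝ f 0) ![0, 0, 0, 0] := by rw [hl0]; exact hd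
  have hd2 : HasFDerivAt f (fderiv ℝ f 0) ![0, 0, 2 * 0, 0 ^ 2] := by rw [hc0]; exact hd
  have d1 : HasDerivAt (fun s : ℝ => f ![0, 0, s, 0]) (fderiv ℝ f 0 ![0, 0, 1, 0]) 0 := by
    have := HasFDerivAt.comp_hasDerivAt (l := f) (0 : ℝ) hd1 hline
    exact this
  have d2 : HasDerivAt (fun s : ℝ => f ![0, 0, 2 * s, s ^ 2]) (fderiv ℝ f 0 ![0, 0, 2, 0]) 0 := by
    have := HasFDerivAt.comp_hasDerivAt (l := f) (0 : ℝ) hd2 hcurve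
    exact this
  have z1 : fderiv ℝ f 0 ![0, 0, 1, 0] = 0 := by
    have t1 := hasDerivAt_iff_tendsto_slope.1 d1
    refine tendsto_nhds_unique (t1.mono_left (nhdsWithin_mono 0 (s := Iio 0) ?_))
      (tendsto_const_nhds.congr' (f₁ := fun _ => 0) ?_)
    · intro s hs; exact (ne_of_lt hs)
    · have hU : ∀ᶠ s in 𝓝 (0 : ℝ), ![0, 0, s, 0] ∈ U :=
        hline.continuousAt.eventually_mem (H.isOpen.mem_nhds (by rw [hl0]; exact H.zero_mem))
      filter_upwards [self_mem_nhdsWithin, nhdsWithin_le_nhds hU] with s hs hsU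
      have hs' : s < 0 := hs
      have hb : bigWavefront 0 0 s = ![0, 0, s, 0] := by
        funext i; fin_cases i <;> simp [bigWavefront]
      have h1 := H.null 0 0 s (by simpa using hs') (by rw [hb]; exact hsU)
      rw [hb, H.coPair_conormal hsU] at h1
      have h2 : f ![0, 0, s, 0] = 0 := by simpa using h1
      rw [slope_def_field, h2, hl0, show f 0 = 0 from h33]
      simp
  have z2 : fderiv ℝ f 0 ![0, 0, 2, 0] = 0 := by
    have : (![0, 0, 2, 0] : Fin 4 → ℝ) = (2 : ℝ) • ![0, 0, 1, 0] := by
      funext i; fin_cases i <;> simp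
    rw [this, map_smul, z1, smul_zero]
  rw [z2] at d2
  have t2 := (hasDerivAt_iff_tendsto_slope.1 d2).mono_left
    (nhdsWithin_mono (0 : ℝ) (s := Ioi 0) fun s hs => ne_of_gt hs)
  have t3 := (t2.add ((hI 1 1).sub ((hI 2 3).const_mul 2))).add (hs.mul (hI 2 2))
  have t4 : Tendsto (fun _ : ℝ => (0 : ℝ)) (𝓝[>] 0) (𝓝 (0 + ((g 0)⁻¹ 1 1 - 2 * (g 0)⁻¹ 2 3)
      + 0 * (g 0)⁻¹ 2 2)) := by
    refine t3.congr' ?_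
    filter_upwards [H.eventually_crease, self_mem_nhdsWithin] with s h hs0
    have hs0' : (0 : ℝ) < s := hs0
    rw [slope_def_field, hc0, show f 0 = 0 from h33, sub_zero, sub_zero]
    have h3 := h.2.2
    have h4 : f ![0, 0, 2 * s, s ^ 2] = (g ![0, 0, 2 * s, s ^ 2])⁻¹ 3 3 := rfl
    rw [h4]
    field_simp
    linarith
  have := tendsto_nhds_unique t4 tendsto_const_nhds
  linarith

theorem coPair_grad_conormal (g : MetricField 4) (τ : (Fin 4 → ℝ) → ℝ) (x : Fin 4 → ℝ) (p : ℝ) :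
    ∑ i, ∑ j, (g x)⁻¹ i j * grad τ x i * (![0, -p, -p ^ 2, 1] : Fin 4 → ℝ) j
      = ∑ i, pd i τ x * ((g x)⁻¹ i 3 - p * (g x)⁻¹ i 1 - p ^ 2 * (g x)⁻¹ i 2) := by
  simp [grad, Fin.sum_univ_four]
  ring

/-- Future directed null curves on the horizon leave the crease, so `τ` decreases along it. -/
theorem pd_time_neg (H : IsA3Perestroika U g τ) : pd 2 τ 0 < 0 := by
  obtain ⟨h33, h13, h11⟩ := H.inv_at_zero
  have hL := H.lorentzian 0 H.zero_mem
  have hs := hL.inv_symm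
  have hN0 : (![0, 0, 0, 1] : Fin 4 → ℝ) ≠ 0 := fun h => by simpa using congrFun h 3
  have hnull : ∑ i, ∑ j, (g 0)⁻¹ i j * (![0, 0, 0, 1] : Fin 4 → ℝ) i
      * (![0, 0, 0, 1] : Fin 4 → ℝ) j = 0 := by
    simp [Fin.sum_univ_four, h33]
  -- The covector dx is orthogonal to the null covector dz and not proportional to it.
  have h11p : 0 < (g 0)⁻¹ 1 1 := by
    have h1 := hL.coPair_pos_of_null (β := ![0, 1, 0, 0]) hnull hN0
      (by simp [Fin.sum_univ_four, hs 3 1, h13]) (fun c hc => by simpa using congrFun hc 1)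
    simpa [Fin.sum_univ_four] using h1
  have hgn : ∑ i, ∑ j, (g 0)⁻¹ i j * grad τ 0 i * (![0, 0, 0, 1] : Fin 4 → ℝ) j
      = pd 2 τ 0 * (g 0)⁻¹ 2 3 := by
    have h1 : pd 0 τ 0 = 0 := H.tangency
    simp [Fin.sum_univ_four, grad, h33, h13, h1]
    ring
  have hne : pd 2 τ 0 * (g 0)⁻¹ 2 3 ≠ 0 := by
    rw [← hgn]
    exact hL.coPair_ne_zero (H.timelike 0 H.zero_mem) hnull hN0
  have h23 : 0 < (g 0)⁻¹ 2 3 := by linarith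
  -- If ∂_y τ were positive, dτ would pair positively with the conormals with small p near the
  -- origin. A future null curve starting at a crease point contradicts this.
  by_contra! hpos
  have hpos' : 0 < pd 2 τ 0 * (g 0)⁻¹ 2 3 :=
    lt_of_le_of_ne (mul_nonneg hpos h23.le) hne.symm
  have hpd : ∀ i, ContinuousAt (pd i τ) 0 := fun i =>
    (contDiffAt_pd i (H.contDiffAt_time H.zero_mem)).continuousAt
  have hI := fun i j => H.continuousAt_inv H.zero_mem i j
  have hcont : ContinuousAt (fun v : (Fin 4 → ℝ) × ℝ => ∑ i, pd i τ v.1 * ((g v.1)⁻¹ i 3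
      - v.2 * (g v.1)⁻¹ i 1 - v.2 ^ 2 * (g v.1)⁻¹ i 2)) (0, 0) := by
    have c1 : ∀ i, ContinuousAt (fun v : (Fin 4 → ℝ) × ℝ => pd i τ v.1) (0, 0) := fun i =>
      ContinuousAt.comp (f := Prod.fst) (g := pd i τ) (hpd i) continuousAt_fst
    have c2 : ∀ i j, ContinuousAt (fun v : (Fin 4 → ℝ) × ℝ => (g v.1)⁻¹ i j) (0, 0) := fun i j =>
      ContinuousAt.comp (f := Prod.fst) (g := fun x => (g x)⁻¹ i j) (hI i j) continuousAt_fst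
    exact tendsto_finsetSum _ fun i _ => (c1 i).mul (((c2 i 3).sub
      (continuousAt_snd.mul (c2 i 1))).sub ((continuousAt_snd.pow 2).mul (c2 i 2)))
  have hev := hcont.eventually (lt_mem_nhds (a := 0) (by
    have h1 : pd 0 τ 0 = 0 := H.tangency
    simpa [Fin.sum_univ_four, h33, h13, h1] using hpos'))
  rw [nhds_prod_eq] at hev
  obtain ⟨S, hS, T, hT, hST⟩ := Filter.eventually_prod_iff.1 hev
  obtain ⟨η, hη, hηT⟩ := Metric.eventually_nhds_iff_ball.1 hT
  have hsmall : ∀ᶠ s in 𝓝[>] (0 : ℝ), s < η ^ 2 :=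
    nhdsWithin_le_nhds (gt_mem_nhds (by positivity))
  have hI11 : ∀ᶠ s in 𝓝[>] (0 : ℝ), 0 < (g ![0, 0, 2 * s, s ^ 2])⁻¹ 1 1 :=
    ((hI 1 1).tendsto.comp (tendsto_crease.mono_left nhdsWithin_le_nhds)).eventually
      (lt_mem_nhds h11p)
  have hSs : ∀ᶠ s in 𝓝[>] (0 : ℝ), S ![0, 0, 2 * s, s ^ 2] :=
    (tendsto_crease.mono_left nhdsWithin_le_nhds).eventually hS
  obtain ⟨s, hc, hsη, hs11, hsS, hs0⟩ :=
    (H.eventually_crease.and (hsmall.and (hI11.and (hSs.and self_mem_nhdsWithin)))).exists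
  obtain ⟨hsU, h1, h2⟩ := hc
  have hs0' : (0 : ℝ) < s := hs0
  set x : Fin 4 → ℝ := ![0, 0, 2 * s, s ^ 2] with hx
  have hp0 := Real.sqrt_pos.2 hs0'
  have hsq : √s ^ 2 = s := Real.sq_sqrt hs0'.le
  have hb : bigWavefront 0 (√s) (2 * √s ^ 2) = x := by
    have e4 : √s ^ 4 = s ^ 2 := by rw [show √s ^ 4 = (√s ^ 2) ^ 2 by ring, hsq]
    have e3 : √s ^ 3 = s * √s := by rw [show √s ^ 3 = √s ^ 2 * √s by ring, hsq]
    rw [hx]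
    funext i; fin_cases i <;> simp [bigWavefront, hsq, e4, e3] <;> ring
  have hxh : x ∈ horizon := ⟨0, √s, 2 * √s ^ 2, le_rfl, hb.symm⟩
  obtain ⟨γ, ε, hε, hγ0, hγ⟩ := H.ruled x ⟨hxh, hsU⟩
  obtain ⟨-, v, hv, hvn, hvf⟩ := hγ 0 ⟨le_rfl, hε⟩
  rw [hγ0] at hvn hvf
  obtain ⟨p, hp, hpv, hpv'⟩ := crease_tangent hε hp0 (hγ0.trans hb.symm)
    (fun r hr => (hγ r hr).1.1) hv
  rw [hsq] at hp
  have hp4 : p ^ 4 = s ^ 2 := by rw [show p ^ 4 = (p ^ 2) ^ 2 by ring, hp]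
  have hLx := H.lorentzian x hsU
  have hnx : coPair g x ![0, -p, -p ^ 2, 1] ![0, -p, -p ^ 2, 1] = 0 := by
    rw [H.coPair_conormal hsU, hp, hp4, h1]
    linarith
  obtain ⟨c, hcv⟩ := hLx.null_vector hnx (fun h => by simpa using congrFun h 3) hvn
    (by simp [Fin.sum_univ_four]; linarith)
  -- The first covector is the conormal of the other sheet, so the raised conormal n points strictly
  -- below that sheet.
  have hpair : ∑ i, ∑ j, (g x)⁻¹ i j * (![0, p, -p ^ 2, 1] : Fin 4 → ℝ) i
      * (![0, -p, -p ^ 2, 1] : Fin 4 → ℝ) j = -2 * s * (g x)⁻¹ 1 1 := by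
    have hsx := hLx.inv_symm
    have h5 := H.coPair_conormal hsU p
    rw [hnx] at h5
    simp [Fin.sum_univ_four]
    rw [hsx 2 1, hsx 3 1, hsx 3 2]
    rw [← hp]
    rw [← hp] at h1
    linear_combination (-1) * h5 + 2 * p * h1
  -- The velocity is c times the raised n and lies on or above the other sheet.
  have hcle : c ≤ 0 := by
    have h3 := hcv ![0, p, -p ^ 2, 1]
    rw [hpair] at h3
    simp [Fin.sum_univ_four] at h3
    have h4 : 0 ≤ -(c * (2 * s * (g x)⁻¹ 1 1)) := by linarith
    by_contra! hc
    have : 0 < c * (2 * s * (g x)⁻¹ 1 1) := by positivity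
    linarith
  rw [hcv, coPair_grad_conormal] at hvf
  have hball : p ∈ Metric.ball (0 : ℝ) η := by
    rw [mem_ball_zero_iff, Real.norm_eq_abs]
    refine abs_lt_of_sq_lt_sq ?_ hη.le
    rwa [hp]
  have hfin := hST hsS (hηT p hball)
  simp only at hfin
  nlinarith

end IsA3Perestroika

/-! ### Implicit functions -/

/-- The map `z ↦ (ℓ z, z.1)` as an equivalence, for `ℓ` nonzero on the second factor. -/
noncomputable def graphEquiv {E : Type*} [NormedAddCommGroup E] [NormedSpace ℝ E]
    (ℓ : E × ℝ →L[ℝ] ℝ) (h : ℓ (0, 1) ≠ 0) : (E × ℝ) ≃L[ℝ] ℝ × E :=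
  ContinuousLinearEquiv.equivOfInverse (ℓ.prod (ContinuousLinearMap.fst ℝ E ℝ))
    ((ContinuousLinearMap.snd ℝ ℝ E).prod ((ℓ (0, 1))⁻¹ • (ContinuousLinearMap.fst ℝ ℝ E
      - ℓ.comp ((ContinuousLinearMap.inl ℝ E ℝ).comp (ContinuousLinearMap.snd ℝ ℝ E)))))
    (by
      rintro ⟨s, y⟩
      have h1 : ℓ (s, y) = ℓ (s, 0) + y * ℓ (0, 1) := by
        have : ((s, y) : E × ℝ) = (s, 0) + y • (0, 1) := by simp
        rw [this, map_add, map_smul, smul_eq_mul]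
      simp [h1]
      field_simp)
    (by
      rintro ⟨c, s⟩
      have h1 : ∀ y : ℝ, ℓ (s, y) = ℓ (s, 0) + y * ℓ (0, 1) := by
        intro y
        have : ((s, y) : E × ℝ) = (s, 0) + y • (0, 1) := by simp
        rw [this, map_add, map_smul, smul_eq_mul]
      simp [h1 (_ * _)]
      field_simp
      ring)

/-- The inverse function theorem for (s, y) ↦ (T(s, y), s). The level value t is one of the
inverse's variables, which makes Z jointly smooth in t and s. -/
theorem exists_implicit {n : ℕ} {T : (Fin n → ℝ) × ℝ → ℝ} {W : Set ((Fin n → ℝ) × ℝ)} {d : ℝ}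
    (hW : IsOpen W) (h0 : (0 : (Fin n → ℝ) × ℝ) ∈ W) (hT : ContDiffOn ℝ ∞ T W) (hT0 : T 0 = 0)
    (hd : HasDerivAt (fun y => T (0, y)) d 0) (hd0 : d ≠ 0) :
    ∃ r > 0, ∃ Z : ℝ → (Fin n → ℝ) → ℝ,
      ContDiffOn ℝ ∞ (fun v : ℝ × (Fin n → ℝ) => Z v.1 v.2) (Ioo (-r) r ×ˢ Metric.ball 0 r) ∧
      (∀ t ∈ Ioo (-r) r, ∀ s ∈ Metric.ball (0 : Fin n → ℝ) r,
        (s, Z t s) ∈ W ∧ T (s, Z t s) = t) ∧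
      (∀ᶠ z in 𝓝 (0 : (Fin n → ℝ) × ℝ), z.2 = Z (T z) z.1) ∧ Z 0 0 = 0 := by
  have hTa : ∀ z ∈ W, ContDiffAt ℝ ∞ T z := fun z hz => hT.contDiffAt (hW.mem_nhds hz)
  have hTd : ∀ z ∈ W, HasFDerivAt T (fderiv ℝ T z) z := fun z hz =>
    ((hTa z hz).differentiableAt (by simp)).hasFDerivAt
  have hfd : ContinuousOn (fun z => fderiv ℝ T z (0, 1)) W :=
    ((ContDiffOn.fderiv_of_isOpen hT hW (m := ∞) (by simp)).clm_apply contDiffOn_const).continuousOn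
  -- Restricting to points with ∂_y T ≠ 0 makes the local inverse smooth on a whole box rather than
  -- only at the origin.
  set W' := W ∩ (fun z => fderiv ℝ T z (0, 1)) ⁻¹' {0}ᶜ with hW'
  have hW'o : IsOpen W' := hfd.isOpen_inter_preimage hW isOpen_compl_singleton
  have hd1 : fderiv ℝ T 0 (0, 1) = d := by
    have h1 : HasDerivAt (fun y : ℝ => ((0 : Fin n → ℝ), y)) (0, 1) 0 :=
      (hasDerivAt_const _ _).prodMk (hasDerivAt_id' _)
    have h2 := HasFDerivAt.comp_hasDerivAt (l := T) (0 : ℝ) (hTd 0 h0) h1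
    exact h2.unique hd
  have h0' : (0 : (Fin n → ℝ) × ℝ) ∈ W' := ⟨h0, by rw [mem_preimage, hd1]; exact hd0⟩
  set Ψ : (Fin n → ℝ) × ℝ → ℝ × (Fin n → ℝ) := fun z => (T z, z.1) with hΨ
  have hΨc : ∀ z ∈ W', ContDiffAt ℝ ∞ Ψ z := fun z hz => (hTa z hz.1).prodMk contDiffAt_fst
  have hΨd : ∀ z (hz : z ∈ W'), HasFDerivAt Ψ
      (graphEquiv (fderiv ℝ T z) hz.2 : (Fin n → ℝ) × ℝ →L[ℝ] ℝ × (Fin n → ℝ)) z := by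
    intro z hz
    exact (hTd z hz.1).prodMk hasFDerivAt_fst
  have hΨ0 : Ψ 0 = 0 := by simp [hΨ, hT0]
  set f := (hΨc 0 h0').toOpenPartialHomeomorph Ψ (hΨd 0 h0') (by simp) with hf
  have hfΨ : ∀ z, f z = Ψ z := fun z => rfl
  have hsrc : (0 : (Fin n → ℝ) × ℝ) ∈ f.source :=
    (hΨc 0 h0').mem_toOpenPartialHomeomorph_source (hΨd 0 h0') (by simp)
  have hA : IsOpen (f.target ∩ f.symm ⁻¹' W') := f.isOpen_inter_preimage_symm hW'o
  have hA0 : (0 : ℝ × (Fin n → ℝ)) ∈ f.target ∩ f.symm ⁻¹' W' := by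
    have h1 : f 0 = 0 := hΨ0
    rw [← h1]
    exact ⟨f.map_source hsrc, by rw [mem_preimage, f.left_inv hsrc]; exact h0'⟩
  obtain ⟨r, hr, hrA⟩ := Metric.isOpen_iff.1 hA 0 hA0
  have hrA' : Ioo (-r) r ×ˢ Metric.ball (0 : Fin n → ℝ) r ⊆ f.target ∩ f.symm ⁻¹' W' := by
    refine Subset.trans ?_ hrA
    rw [show (0 : ℝ × (Fin n → ℝ)) = (0, 0) from rfl, ← ball_prod_same, Real.ball_eq_Ioo]
    simp
  have hfst : ∀ v ∈ Ioo (-r) r ×ˢ Metric.ball (0 : Fin n → ℝ) r,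
      f.symm v ∈ W' ∧ T (f.symm v) = v.1 ∧ (f.symm v).1 = v.2 := by
    intro v hv
    have h1 := f.right_inv (hrA' hv).1
    rw [hfΨ] at h1
    exact ⟨(hrA' hv).2, congrArg Prod.fst h1, congrArg Prod.snd h1⟩
  refine ⟨r, hr, fun t s => (f.symm (t, s)).2, ?_, ?_, ?_, ?_⟩
  · intro v hv
    have h1 : ContDiffAt ℝ ∞ f.symm v :=
      f.contDiffAt_symm (hrA' hv).1 (hΨd _ (hfst v hv).1) (hΨc _ (hfst v hv).1)
    exact (contDiffAt_snd.comp v h1).contDiffWithinAt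
  · intro t ht s hs
    obtain ⟨h1, h2, h3⟩ := hfst (t, s) ⟨ht, hs⟩
    have h4 : (s, (f.symm (t, s)).2) = f.symm (t, s) := Prod.ext h3.symm rfl
    rw [h4]
    exact ⟨h1.1, h2⟩
  · filter_upwards [f.open_source.mem_nhds hsrc] with z hz
    exact (congrArg Prod.snd (f.left_inv hz)).symm
  · have h1 := f.left_inv hsrc
    have h2 : f 0 = (0, 0) := hΨ0
    rw [h2] at h1
    change (f.symm (0, 0)).2 = 0
    rw [h1]; rfl

/-! ### The level sets of the time function -/

namespace IsA3Perestroika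

variable {U : Set (Fin 4 → ℝ)} {g : MetricField 4} {τ : (Fin 4 → ℝ) → ℝ}

theorem hasDerivAt_time (H : IsA3Perestroika U g τ) :
    HasDerivAt (fun y => τ ![0, 0, y, 0]) (pd 2 τ 0) 0 := by
  have hline : HasDerivAt (fun s : ℝ => (![0, 0, s, 0] : Fin 4 → ℝ)) (Pi.single 2 1) 0 := by
    refine hasDerivAt_pi.2 fun i => ?_
    fin_cases i
    · simpa using hasDerivAt_const _ _
    · simpa using hasDerivAt_const _ _
    · simpa using hasDerivAt_id' _
    · simpa using hasDerivAt_const _ _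
  have hl0 : (![0, 0, 0, 0] : Fin 4 → ℝ) = 0 := by funext i; fin_cases i <;> simp
  have hd : HasFDerivAt τ (fderiv ℝ τ 0) ![0, 0, 0, 0] := by
    rw [hl0]
    exact ((H.contDiffAt_time H.zero_mem).differentiableAt (by simp)).hasFDerivAt
  exact HasFDerivAt.comp_hasDerivAt (l := τ) (0 : ℝ) hd hline

/-- The denominator of the slope of `q` along the cross-section. -/
noncomputable def foldDenominator (τ : (Fin 4 → ℝ) → ℝ) (p : ℝ) (P : Fin 4 → ℝ) : ℝ :=
  pd 2 τ P - 2 * p * pd 1 τ P - p ^ 2 * pd 3 τ P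

/-- The implicit function is used twice, for y in spacetime and for q on the wavefront. Both
derivatives are ∂_y τ(0) ≠ 0, since w = p = 0 is the y-axis. All smaller a₀ and δ are allowed so
that they can be shrunk later. -/
theorem exists_slice (H : IsA3Perestroika U g τ) :
    ∃ r > 0, ∃ ρ > 0, ∃ (Y : ℝ → (Fin 3 → ℝ) → ℝ) (Q : ℝ → (Fin 2 → ℝ) → ℝ),
      (∀ a₀ ∈ Ioc 0 r, ∀ δ ∈ Ioc 0 r, IsSliceParam U τ a₀ ρ δ Y Q) ∧ Q 0 0 = 0 ∧
      (∀ t ∈ Ioo (-r) r, ∀ u ∈ Metric.ball (0 : Fin 2 → ℝ) r,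
        bigWavefront (u 1) (u 0) (Q t u) ∈ U ∧ τ (bigWavefront (u 1) (u 0) (Q t u)) = t ∧
        foldDenominator τ (u 0) (bigWavefront (u 1) (u 0) (Q t u)) ≠ 0) := by
  have hc := H.pd_time_neg
  -- the level sets
  have hι : ContDiff ℝ ∞ fun z : (Fin 3 → ℝ) × ℝ => (![z.1 0, z.1 1, z.2, z.1 2] : Fin 4 → ℝ) := by
    refine contDiff_pi.2 fun i => ?_
    fin_cases i <;> dsimp <;> fun_prop
  obtain ⟨r₁, hr₁, Y, hY1, hY2, hY3, -⟩ := exists_implicit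
    (T := fun z : (Fin 3 → ℝ) × ℝ => τ ![z.1 0, z.1 1, z.2, z.1 2])
    (W := (fun z : (Fin 3 → ℝ) × ℝ => (![z.1 0, z.1 1, z.2, z.1 2] : Fin 4 → ℝ)) ⁻¹' U)
    (H.isOpen.preimage hι.continuous)
    (by
      have : (![0, 0, 0, 0] : Fin 4 → ℝ) = 0 := by funext i; fin_cases i <;> simp
      simpa [this] using H.zero_mem)
    (H.smooth_time.comp hι.contDiffOn fun z hz => hz)
    (by
      have : (![0, 0, 0, 0] : Fin 4 → ℝ) = 0 := by funext i; fin_cases i <;> simp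
      simpa [this] using H.time_zero)
    (by simpa using H.hasDerivAt_time) hc.ne
  have hpr : Continuous fun P : Fin 4 → ℝ => ((![P 0, P 1, P 3], P 2) : (Fin 3 → ℝ) × ℝ) := by
    refine Continuous.prodMk (continuous_pi fun i => ?_) (by fun_prop)
    fin_cases i <;> dsimp <;> fun_prop
  have hpr0 : ((![(0 : Fin 4 → ℝ) 0, (0 : Fin 4 → ℝ) 1, (0 : Fin 4 → ℝ) 3], (0 : Fin 4 → ℝ) 2) :
      (Fin 3 → ℝ) × ℝ) = 0 := by
    refine Prod.ext ?_ rfl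
    funext i; fin_cases i <;> rfl
  have hcov : ∀ᶠ P in 𝓝 (0 : Fin 4 → ℝ), P = slice (Y (τ P)) ![P 0, P 1, P 3] := by
    have h1 := hpr.tendsto 0
    rw [hpr0] at h1
    filter_upwards [h1.eventually hY3] with P hP
    have h2 : (![P 0, P 1, P 2, P 3] : Fin 4 → ℝ) = P := by
      funext i; fin_cases i <;> rfl
    have h3 : P 2 = Y (τ ![P 0, P 1, P 2, P 3]) ![P 0, P 1, P 3] := by simpa using hP
    rw [h2] at h3
    funext i
    fin_cases i
    · rfl
    · rfl
    · exact h3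
    · rfl
  -- the cross-sections
  have hB : ContDiff ℝ ∞ fun z : (Fin 2 → ℝ) × ℝ => bigWavefront (z.1 1) (z.1 0) z.2 := by
    refine contDiff_pi.2 fun i => ?_
    fin_cases i <;> simp only [bigWavefront] <;> dsimp <;> fun_prop
  have hB0 : bigWavefront ((0 : (Fin 2 → ℝ) × ℝ).1 1) ((0 : (Fin 2 → ℝ) × ℝ).1 0)
      (0 : (Fin 2 → ℝ) × ℝ).2 = 0 := bigWavefront_zero
  have hBt : Tendsto (fun z : (Fin 2 → ℝ) × ℝ => bigWavefront (z.1 1) (z.1 0) z.2)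
      (𝓝 0) (𝓝 0) := by
    have := hB.continuous.tendsto 0
    rwa [hB0] at this
  have hgood : ∀ᶠ z in 𝓝 (0 : (Fin 2 → ℝ) × ℝ), bigWavefront (z.1 1) (z.1 0) z.2 ∈ U ∧
      (bigWavefront (z.1 1) (z.1 0) z.2 = slice (Y (τ (bigWavefront (z.1 1) (z.1 0) z.2)))
        ![z.1 1, 4 * z.1 0 ^ 3 - 2 * z.2 * z.1 0, 3 * z.1 0 ^ 4 - z.2 * z.1 0 ^ 2]) ∧
      (![z.1 1, 4 * z.1 0 ^ 3 - 2 * z.2 * z.1 0, 3 * z.1 0 ^ 4 - z.2 * z.1 0 ^ 2] : Fin 3 → ℝ)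
        ∈ Metric.ball (0 : Fin 3 → ℝ) r₁ ∧
      foldDenominator τ (z.1 0) (bigWavefront (z.1 1) (z.1 0) z.2) ≠ 0 := by
    have g1 := hBt.eventually (H.isOpen.mem_nhds H.zero_mem)
    have g2 := hBt.eventually hcov
    have g3 : ∀ᶠ z in 𝓝 (0 : (Fin 2 → ℝ) × ℝ), (![z.1 1, 4 * z.1 0 ^ 3 - 2 * z.2 * z.1 0,
        3 * z.1 0 ^ 4 - z.2 * z.1 0 ^ 2] : Fin 3 → ℝ) ∈ Metric.ball (0 : Fin 3 → ℝ) r₁ := by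
      have hcc : Continuous fun z : (Fin 2 → ℝ) × ℝ => (![z.1 1, 4 * z.1 0 ^ 3 - 2 * z.2 * z.1 0,
        3 * z.1 0 ^ 4 - z.2 * z.1 0 ^ 2] : Fin 3 → ℝ) := by
        refine continuous_pi fun i => ?_
        fin_cases i <;> dsimp <;> fun_prop
      refine hcc.continuousAt.eventually_mem (Metric.isOpen_ball.mem_nhds ?_)
      have hz : (![(0 : (Fin 2 → ℝ) × ℝ).1 1, 4 * (0 : (Fin 2 → ℝ) × ℝ).1 0 ^ 3
          - 2 * (0 : (Fin 2 → ℝ) × ℝ).2 * (0 : (Fin 2 → ℝ) × ℝ).1 0,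
          3 * (0 : (Fin 2 → ℝ) × ℝ).1 0 ^ 4
          - (0 : (Fin 2 → ℝ) × ℝ).2 * (0 : (Fin 2 → ℝ) × ℝ).1 0 ^ 2] : Fin 3 → ℝ) = 0 := by
        funext i; fin_cases i <;> simp
      rw [hz]
      exact Metric.mem_ball_self hr₁
    have g4 : ∀ᶠ z in 𝓝 (0 : (Fin 2 → ℝ) × ℝ),
        foldDenominator τ (z.1 0) (bigWavefront (z.1 1) (z.1 0) z.2) ≠ 0 := by
      have hp : ∀ i, Tendsto (fun z : (Fin 2 → ℝ) × ℝ =>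
          pd i τ (bigWavefront (z.1 1) (z.1 0) z.2)) (𝓝 0) (𝓝 (pd i τ 0)) := fun i =>
        (contDiffAt_pd i (H.contDiffAt_time H.zero_mem)).continuousAt.tendsto.comp hBt
      have h0 : Tendsto (fun z : (Fin 2 → ℝ) × ℝ => z.1 0) (𝓝 0) (𝓝 0) :=
        (by fun_prop : Continuous fun z : (Fin 2 → ℝ) × ℝ => z.1 0).tendsto 0
      have h1 := ((hp 2).sub ((h0.const_mul 2).mul (hp 1))).sub ((h0.pow 2).mul (hp 3))
      refine h1.eventually_ne ?_
      simpa using hc.ne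
    filter_upwards [g1, g2, g3, g4] with z k1 k2 k3 k4
    exact ⟨k1, k2, k3, k4⟩
  obtain ⟨W, hWsub, hWo, hW0⟩ := mem_nhds_iff.1 hgood
  have hTQ : ContDiffOn ℝ ∞ (fun z : (Fin 2 → ℝ) × ℝ => τ (bigWavefront (z.1 1) (z.1 0) z.2)) W :=
    H.smooth_time.comp hB.contDiffOn fun z hz => (hWsub hz).1
  obtain ⟨r₂, hr₂, Q, hQ1, hQ2, hQ3, hQ4⟩ := exists_implicit (d := pd 2 τ 0) hWo hW0 hTQ
    (by rw [hB0]; exact H.time_zero)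
    (by
      refine H.hasDerivAt_time.congr_of_eventuallyEq (Eventually.of_forall fun y => ?_)
      have : bigWavefront 0 0 y = ![0, 0, y, 0] := by
        funext i; fin_cases i <;> simp [bigWavefront]
      simp [this]) hc.ne
  set r := min r₁ r₂ with hr
  have hr0 : 0 < r := lt_min hr₁ hr₂
  have sub1 : Ioo (-r) r ⊆ Ioo (-r₁) r₁ := Ioo_subset_Ioo (neg_le_neg (min_le_left _ _)) (min_le_left _ _)
  have sub2 : Ioo (-r) r ⊆ Ioo (-r₂) r₂ := Ioo_subset_Ioo (neg_le_neg (min_le_right _ _)) (min_le_right _ _)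
  have hQ : ∀ t ∈ Ioo (-r) r, ∀ u ∈ Metric.ball (0 : Fin 2 → ℝ) r,
      (u, Q t u) ∈ W ∧ τ (bigWavefront (u 1) (u 0) (Q t u)) = t := fun t ht u hu =>
    hQ2 t (sub2 ht) u (Metric.ball_subset_ball (min_le_right _ _) hu)
  have hsm : ∀ t ∈ Ioo (-r) r, ∀ u ∈ Metric.ball (0 : Fin 2 → ℝ) r,
      sliceSurface (Q t) u ∈ Metric.ball 0 r₁ ∧
      slice (Y t) (sliceSurface (Q t) u) = bigWavefront (u 1) (u 0) (Q t u) := by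
    intro t ht u hu
    obtain ⟨h1, h2⟩ := hQ t ht u hu
    obtain ⟨-, h3, h4, -⟩ := hWsub h1
    refine ⟨h4, ?_⟩
    simp only [h2] at h3
    exact h3.symm
  refine ⟨r, hr0, r₁, hr₁, Y, Q, ?_, hQ4, fun t ht u hu => ?_⟩
  · intro a₀ ha₀ δ hδ
    have hδr : Ioo (-δ) δ ⊆ Ioo (-r) r := Ioo_subset_Ioo (neg_le_neg hδ.2) hδ.2
    have har : Metric.ball (0 : Fin 2 → ℝ) a₀ ⊆ Metric.ball 0 r := Metric.ball_subset_ball ha₀.2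
    refine
      { smooth_Y := hY1.mono (prod_mono (hδr.trans sub1) subset_rfl)
        slice_mem := fun t ht s hs => hY2 t (sub1 (hδr ht)) s hs
        slice_covers := hcov
        smooth_Q := hQ1.mono (prod_mono (hδr.trans sub2)
          (har.trans (Metric.ball_subset_ball (min_le_right _ _))))
        surface_mem := fun t ht u hu => hsm t (hδr ht) u (har hu)
        surface_inj := ?_
        surface_covers := ?_ }
    · intro t ht a ha u hu u' hu' he
      have hmem : ∀ u ∈ smoothRegion (Q t) a, u ∈ Metric.ball (0 : Fin 2 → ℝ) r := by
        intro u hu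
        refine har ?_
        rw [mem_ball_zero_iff, pi_norm_lt_iff ha₀.1, Fin.forall_fin_two]
        exact ⟨lt_of_le_of_lt hu.1 ha.2, lt_of_le_of_lt hu.2.1 ha.2⟩
      have h1 := (hsm t (hδr ht) u (hmem u hu)).2
      have h2 := (hsm t (hδr ht) u' (hmem u' hu')).2
      rw [he, h2] at h1
      have k0 : u' 1 = u 1 := congrFun h1 0
      have k1 : 4 * u' 0 ^ 3 - 2 * Q t u' * u' 0 = 4 * u 0 ^ 3 - 2 * Q t u * u 0 := congrFun h1 1
      have k2 : Q t u' = Q t u := congrFun h1 2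
      have k3 : 3 * u' 0 ^ 4 - Q t u' * u' 0 ^ 2 = 3 * u 0 ^ 4 - Q t u * u 0 ^ 2 := congrFun h1 3
      rw [k2] at k1 k3
      have k4 : u 0 = u' 0 := swallowtail_param_unique hu.2.2 k1.symm k3.symm
      funext i
      fin_cases i
      · exact k4
      · exact k0.symm
    · intro a ha
      obtain ⟨η, hη, hηQ⟩ := Metric.eventually_nhds_iff_ball.1 hQ3
      -- The bound b ≤ a puts the parameters in the window, and b < η puts them where the local
      -- uniqueness of Q holds.
      set b := min a (η / 2) with hb
      have hb0 : 0 < b := lt_min ha.1 (by positivity)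
      have hτ : ∀ᶠ P in 𝓝 (0 : Fin 4 → ℝ), τ P ∈ Ioo (-δ) δ := by
        refine (H.contDiffAt_time H.zero_mem).continuousAt.eventually_mem (isOpen_Ioo.mem_nhds ?_)
        rw [H.time_zero]
        exact ⟨neg_lt_zero.2 hδ.1, hδ.1⟩
      have hco : ∀ (i : Fin 4) (c : ℝ), 0 < c → ∀ᶠ P in 𝓝 (0 : Fin 4 → ℝ), |P i| < c := by
        intro i c hc
        have : ContinuousAt (fun P : Fin 4 → ℝ => |P i|) 0 :=
          (continuous_apply i).abs.continuousAt
        exact this.eventually (gt_mem_nhds (by simpa using hc))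
      rw [eventually_nhdsWithin_iff]
      filter_upwards [hτ, hco 0 b hb0, hco 1 (2 * b ^ 3) (by positivity),
        hco 2 (min b (b ^ 2)) (lt_min hb0 (by positivity))] with P p1 p2 p3 p4 hP
      obtain ⟨w, p, q, hq, rfl⟩ := hP
      simp [bigWavefront] at p2 p3 p4
      have hpb : |p| ≤ b := abs_le_of_swallowtail hb0 p4.2.le p3
      have hz : ((![p, w], q) : (Fin 2 → ℝ) × ℝ) ∈ Metric.ball (0 : (Fin 2 → ℝ) × ℝ) η := by
        have hbη : b < η := lt_of_le_of_lt (min_le_right _ _) (by linarith)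
        rw [mem_ball_zero_iff, Prod.norm_def, max_lt_iff, pi_norm_lt_iff hη, Fin.forall_fin_two]
        exact ⟨⟨lt_of_le_of_lt hpb hbη, p2.trans hbη⟩, p4.1.trans hbη⟩
      have hqQ : q = Q (τ (bigWavefront w p q)) ![p, w] := by simpa using hηQ _ hz
      refine ⟨p1, ![p, w], ⟨?_, ?_, ?_⟩, ?_⟩
      · simpa using hpb.trans (min_le_left _ _)
      · simpa using p2.le.trans (min_le_left _ _)
      · rw [← hqQ]; simpa using hq
      · rw [← hqQ]; simp
  · obtain ⟨h1, h2⟩ := hQ t ht u hu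
    exact ⟨(hWsub h1).1, h2, (hWsub h1).2.2.2⟩

end IsA3Perestroika

/-- Tangent vectors of a level set are annihilated by the timelike dτ, hence spacelike. The slice is
an immersion because w, x, z are among its components. -/
theorem pullback_posDef {g : MetricField 4} {τ : (Fin 4 → ℝ) → ℝ} {Y : (Fin 3 → ℝ) → ℝ}
    {s : Fin 3 → ℝ} {t : ℝ} (hg : IsLorentzian (g (slice Y s)))
    (ht : coPair g (slice Y s) (grad τ (slice Y s)) (grad τ (slice Y s)) < 0)
    (hτ : DifferentiableAt ℝ τ (slice Y s)) (hY : DifferentiableAt ℝ Y s)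
    (he : ∀ᶠ s' in 𝓝 s, τ (slice Y s') = t) : (pullback g (slice Y) s).PosDef := by
  have dS : ∀ i, DifferentiableAt ℝ (fun s' => slice Y s' i) s := by
    intro i
    fin_cases i <;> simp only [slice] <;> dsimp <;> fun_prop
  have dS' : DifferentiableAt ℝ (slice Y) s := differentiableAt_pi.2 dS
  have hsum : ∀ v : Fin 3 → ℝ, ∑ a, ∑ b, pullback g (slice Y) s a b * v a * v b
      = ∑ i, ∑ j, g (slice Y s) i j * (∑ a, pd a (fun s' => slice Y s' i) s * v a)
        * (∑ b, pd b (fun s' => slice Y s' j) s * v b) := by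
    intro v
    simp only [pullback, Matrix.of_apply, Finset.sum_mul, Finset.mul_sum]
    rw [Finset.sum_congr rfl fun a _ => Finset.sum_comm]
    rw [Finset.sum_comm]
    refine Finset.sum_congr rfl fun i _ => ?_
    rw [Finset.sum_congr rfl fun a _ => Finset.sum_comm]
    rw [Finset.sum_comm]
    refine Finset.sum_congr rfl fun j _ => ?_
    rw [Finset.sum_comm]
    refine Finset.sum_congr rfl fun a _ => Finset.sum_congr rfl fun b _ => ?_
    ring
  have hort : ∀ v : Fin 3 → ℝ, ∑ i, grad τ (slice Y s) i
      * (∑ a, pd a (fun s' => slice Y s' i) s * v a) = 0 := by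
    intro v
    have h1 : ∀ a, ∑ i, pd i τ (slice Y s) * pd a (fun s' => slice Y s' i) s = 0 := by
      intro a
      rw [← pd_comp a hτ dS', pd_congr a (g := fun _ => t) he, pd_const]
    simp only [grad, Finset.mul_sum]
    rw [Finset.sum_comm]
    refine Finset.sum_eq_zero fun a _ => ?_
    have h2 := h1 a
    rw [← zero_mul (v a), ← h2, Finset.sum_mul]
    exact Finset.sum_congr rfl fun i _ => by ring
  refine Matrix.PosDef.of_dotProduct_mulVec_pos ?_ fun v hv => ?_
  · ext a b
    simp only [Matrix.conjTranspose_apply, star_trivial, pullback, Matrix.of_apply]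
    rw [Finset.sum_comm]
    refine Finset.sum_congr rfl fun i _ => Finset.sum_congr rfl fun j _ => ?_
    rw [hg.symm]
    ring
  · have h1 : star v ⬝ᵥ (pullback g (slice Y) s).mulVec v
        = ∑ a, ∑ b, pullback g (slice Y) s a b * v a * v b := by
      simp only [dotProduct, Matrix.mulVec, star_trivial, Finset.mul_sum]
      exact Finset.sum_congr rfl fun a _ => Finset.sum_congr rfl fun b _ => by ring
    rw [h1, hsum v]
    refine hg.pos_of_orthogonal ht (hort v) fun h0 => hv ?_
    have c0 := congrFun h0 0
    have c1 := congrFun h0 1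
    have c3 := congrFun h0 3
    simp [slice, pd_coord] at c0 c1 c3
    funext a
    fin_cases a
    · exact c0
    · exact c1
    · exact c3

/-! ### The cross-sections as a folded family -/

namespace IsA3Perestroika

variable {U : Set (Fin 4 → ℝ)} {g : MetricField 4} {τ : (Fin 4 → ℝ) → ℝ}
  {Y : ℝ → (Fin 3 → ℝ) → ℝ} {Q : ℝ → (Fin 2 → ℝ) → ℝ} {a₀ ρ δ : ℝ}

/-- The ratio of `∂q/∂p` along the cross-section to `Δ`. -/
noncomputable def foldSlope (τ : (Fin 4 → ℝ) → ℝ) (Q : (Fin 2 → ℝ) → ℝ) (u : Fin 2 → ℝ) : ℝ :=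
  -(pd 1 τ (bigWavefront (u 1) (u 0) (Q u)) + u 0 * pd 3 τ (bigWavefront (u 1) (u 0) (Q u)))
    / foldDenominator τ (u 0) (bigWavefront (u 1) (u 0) (Q u))

/-- The fold direction of the cross-section. -/
noncomputable def sliceFold (τ : (Fin 4 → ℝ) → ℝ) (Q : (Fin 2 → ℝ) → ℝ) (u : Fin 2 → ℝ) :
    Fin 3 → ℝ :=
  ![0, 1 - 2 * u 0 * foldSlope τ Q u, u 0 - u 0 ^ 2 * foldSlope τ Q u]

/-- The wavefront has p-derivative Δ (0, 1, 0, p) and q-derivative (0, −2p, 1, −p²). Differentiating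
τ = t in p and solving for ∂_p Q therefore leaves a factor Δ. -/
theorem pd_eq_foldSlope {Q : (Fin 2 → ℝ) → ℝ} {u : Fin 2 → ℝ} {t : ℝ}
    (hτ : DifferentiableAt ℝ τ (bigWavefront (u 1) (u 0) (Q u))) (hQ : DifferentiableAt ℝ Q u)
    (he : ∀ᶠ v in 𝓝 u, τ (bigWavefront (v 1) (v 0) (Q v)) = t)
    (h0 : foldDenominator τ (u 0) (bigWavefront (u 1) (u 0) (Q u)) ≠ 0) :
    pd 0 Q u = Delta Q u * foldSlope τ Q u := by
  have d0 : DifferentiableAt ℝ (fun v : Fin 2 → ℝ => v 0) u := by fun_prop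
  have d1 : DifferentiableAt ℝ (fun v : Fin 2 → ℝ => v 1) u := by fun_prop
  have dB : ∀ i, DifferentiableAt ℝ (fun v : Fin 2 → ℝ => bigWavefront (v 1) (v 0) (Q v) i) u := by
    intro i
    fin_cases i <;> simp only [bigWavefront] <;> dsimp <;> fun_prop
  have h1 := pd_comp (f := τ) (F := fun v => bigWavefront (v 1) (v 0) (Q v)) 0 hτ
    (differentiableAt_pi.2 dB)
  rw [pd_congr 0 (g := fun _ => t) he, pd_const, Fin.sum_univ_four] at h1
  have e0 : pd 0 (fun v : Fin 2 → ℝ => bigWavefront (v 1) (v 0) (Q v) 0) u = 0 := by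
    simp [bigWavefront, pd_coord]
  have e1 : pd 0 (fun v : Fin 2 → ℝ => bigWavefront (v 1) (v 0) (Q v) 1) u
      = 12 * u 0 ^ 2 - 2 * Q u - 2 * u 0 * pd 0 Q u := by
    simp only [bigWavefront]
    dsimp
    simp (disch := fun_prop) [pd_sub, pd_mul, pd_pow, pd_const, pd_coord]
    ring
  have e2 : pd 0 (fun v : Fin 2 → ℝ => bigWavefront (v 1) (v 0) (Q v) 2) u = pd 0 Q u := rfl
  have e3 : pd 0 (fun v : Fin 2 → ℝ => bigWavefront (v 1) (v 0) (Q v) 3) u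
      = 12 * u 0 ^ 3 - 2 * u 0 * Q u - u 0 ^ 2 * pd 0 Q u := by
    simp only [bigWavefront]
    dsimp
    simp (disch := fun_prop) [pd_sub, pd_mul, pd_pow, pd_const, pd_coord]
    ring
  rw [e0, e1, e2, e3] at h1
  rw [foldSlope, ← mul_div_assoc, eq_div_iff h0, foldDenominator, Delta]
  linear_combination -h1

theorem foldedFamily_slice (H : IsA3Perestroika U g τ) (hS : IsSliceParam U τ a₀ ρ δ Y Q)
    (hQ : ∀ t ∈ Ioo (-δ) δ, ∀ u ∈ Metric.ball (0 : Fin 2 → ℝ) a₀,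
      bigWavefront (u 1) (u 0) (Q t u) ∈ U ∧ τ (bigWavefront (u 1) (u 0) (Q t u)) = t ∧
      foldDenominator τ (u 0) (bigWavefront (u 1) (u 0) (Q t u)) ≠ 0) :
    FoldedFamily (Ioo (-δ) δ ×ˢ Metric.ball 0 a₀) (Ioo (-δ) δ ×ˢ Metric.ball 0 ρ)
      (fun t => pullback g (slice (Y t))) (fun t => sliceSurface (Q t))
      (fun t => Delta (Q t)) (fun t => sliceFold τ (Q t)) := by
  have hΩ : IsOpen (Ioo (-δ) δ ×ˢ Metric.ball (0 : Fin 2 → ℝ) a₀) :=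
    isOpen_Ioo.prod Metric.isOpen_ball
  have hV : IsOpen (Ioo (-δ) δ ×ˢ Metric.ball (0 : Fin 3 → ℝ) ρ) :=
    isOpen_Ioo.prod Metric.isOpen_ball
  have sY : SmoothFamily Y (Ioo (-δ) δ ×ˢ Metric.ball 0 ρ) := hS.smooth_Y
  have sQ : SmoothFamily Q (Ioo (-δ) δ ×ˢ Metric.ball 0 a₀) := hS.smooth_Q
  have dQ : ∀ t u, (t, u) ∈ Ioo (-δ) δ ×ˢ Metric.ball (0 : Fin 2 → ℝ) a₀ →
      DifferentiableAt ℝ (Q t) u := fun t u h => SmoothFamily.differentiableAt sQ hΩ h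
  have s0 : ∀ k : Fin 2, SmoothFamily (fun _ (u : Fin 2 → ℝ) => u k)
      (Ioo (-δ) δ ×ˢ Metric.ball 0 a₀) := fun k => by
    refine ContDiff.contDiffOn ?_; fun_prop
  have sS : ∀ i, SmoothFamily (fun t s => slice (Y t) s i) (Ioo (-δ) δ ×ˢ Metric.ball 0 ρ) := by
    have sc : ∀ k : Fin 3, SmoothFamily (fun _ (s : Fin 3 → ℝ) => s k)
        (Ioo (-δ) δ ×ˢ Metric.ball 0 ρ) := fun k => by
      refine ContDiff.contDiffOn ?_; fun_prop
    intro i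
    fin_cases i
    · exact sc 0
    · exact sc 1
    · exact sY
    · exact sc 2
  have sB : ∀ i, SmoothFamily (fun t (u : Fin 2 → ℝ) => bigWavefront (u 1) (u 0) (Q t u) i)
      (Ioo (-δ) δ ×ˢ Metric.ball 0 a₀) := by
    intro i
    fin_cases i
    · exact s0 1
    · exact (contDiffOn_const.mul (ContDiffOn.pow (s0 0) 3)).sub
        ((contDiffOn_const.mul sQ).mul (s0 0))
    · exact sQ
    · exact (contDiffOn_const.mul (ContDiffOn.pow (s0 0) 4)).sub
        (ContDiffOn.mul sQ (ContDiffOn.pow (s0 0) 2))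
  have sF : ∀ i, SmoothFamily (fun t u => sliceSurface (Q t) u i)
      (Ioo (-δ) δ ×ˢ Metric.ball 0 a₀) := by
    intro i
    fin_cases i
    · exact sB 0
    · exact sB 1
    · exact sB 3
  have sP : ∀ i, SmoothFamily (fun t (u : Fin 2 → ℝ) => pd i τ (bigWavefront (u 1) (u 0) (Q t u)))
      (Ioo (-δ) δ ×ˢ Metric.ball 0 a₀) := by
    intro i
    refine SmoothFamily.comp (f := fun _ => pd i τ) (V := univ ×ˢ U) ?_ sB
      fun v hv => ⟨mem_univ _, (hQ v.1 hv.1 v.2 hv.2).1⟩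
    exact fun v hv => ((contDiffAt_pd i (H.contDiffAt_time hv.2)).comp v
      contDiffAt_snd).contDiffWithinAt
  have sφ : SmoothFamily (fun t => foldSlope τ (Q t)) (Ioo (-δ) δ ×ˢ Metric.ball 0 a₀) := by
    refine ContDiffOn.div (ContDiffOn.neg (ContDiffOn.add (sP 1) (ContDiffOn.mul (s0 0) (sP 3))))
      ?_ fun v hv => (hQ v.1 hv.1 v.2 hv.2).2.2
    exact (ContDiffOn.sub (sP 2) ((contDiffOn_const.mul (s0 0)).mul (sP 1))).sub
      ((ContDiffOn.pow (s0 0) 2).mul (sP 3))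
  refine
    { isOpen_dom := hΩ
      isOpen_cod := hV
      smooth_h := fun a b => ?_
      posDef := ?_
      smooth_F := sF
      mapsTo := fun v hv => ⟨hv.1, (hS.surface_mem v.1 hv.1 v.2 hv.2).1⟩
      smooth_Δ := ?_
      smooth_e := fun i => ?_
      fold := ?_
      indep := ?_ }
  · have hg : ∀ i j, SmoothFamily (fun t s => g (slice (Y t) s) i j)
        (Ioo (-δ) δ ×ˢ Metric.ball 0 ρ) := fun i j =>
      SmoothFamily.comp (f := fun _ x => g x i j) (V := univ ×ˢ U)
        ((H.smooth_metric i j).comp contDiffOn_snd fun v hv => hv.2) sS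
        fun v hv => ⟨mem_univ _, (hS.slice_mem v.1 hv.1 v.2 hv.2).1⟩
    simp only [SmoothFamily, pullback, Matrix.of_apply]
    exact ContDiffOn.sum fun i _ => ContDiffOn.sum fun j _ =>
      (ContDiffOn.mul (hg i j) (SmoothFamily.pd (sS i) hV a)).mul (SmoothFamily.pd (sS j) hV b)
  · rintro ⟨t, s⟩ hv
    have hU := (hS.slice_mem t hv.1 s hv.2).1
    refine pullback_posDef (t := t) (H.lorentzian _ hU) (H.timelike _ hU)
      ((H.contDiffAt_time hU).differentiableAt (by simp))
      (SmoothFamily.differentiableAt sY hV hv) ?_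
    filter_upwards [Metric.isOpen_ball.mem_nhds hv.2] with s' hs'
    exact (hS.slice_mem t hv.1 s' hs').2
  · exact (contDiffOn_const.mul (ContDiffOn.pow (s0 0) 2)).sub (contDiffOn_const.mul sQ)
  · fin_cases i
    · exact contDiffOn_const
    · exact contDiffOn_const.sub ((contDiffOn_const.mul (s0 0)).mul sφ)
    · exact ContDiffOn.sub (s0 0) ((ContDiffOn.pow (s0 0) 2).mul sφ)
  · intro t u hu i
    have dq := dQ t u hu
    obtain ⟨h1, h2, h3⟩ := hQ t hu.1 u hu.2
    have hp : pd 0 (Q t) u = Delta (Q t) u * foldSlope τ (Q t) u := by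
      refine pd_eq_foldSlope (t := t) ((H.contDiffAt_time h1).differentiableAt (by simp)) dq ?_ h3
      filter_upwards [Metric.isOpen_ball.mem_nhds hu.2] with v hv
      exact (hQ t hu.1 v hv).2.1
    have d0 : DifferentiableAt ℝ (fun v : Fin 2 → ℝ => v 0) u := by fun_prop
    fin_cases i <;> simp only [sliceSurface, sliceFold] <;> dsimp <;>
      simp (disch := fun_prop) [pd_sub, pd_mul, pd_pow, pd_const, pd_coord, hp] <;>
      simp only [Delta] <;> ring
  · intro t u hu h0
    have hf : tangent (sliceSurface (Q t)) 1 u 0 = 1 := by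
      simp [tangent, sliceSurface, pd_coord]
    have h1 := congrFun h0 1
    have h2 := congrFun h0 2
    simp [cross_apply, sliceFold, hf] at h1 h2
    set φ := foldSlope τ (Q t) u
    -- The components 1 − 2pφ and p − p²φ of e cannot both vanish: together they force p = 0, and
    -- then the first equals 1.
    have h3 : u 0 = 0 := by linear_combination 2 * h1 + u 0 * h2
    rw [h3] at h2
    norm_num at h2

end IsA3Perestroika

/-! ### Expansion of the cross-sections at the perestroika -/

theorem quadratic_expansion {φ φ' : ℝ → ℝ} {c : ℝ} (hd : ∀ᶠ r in 𝓝 0, HasDerivAt φ (φ' r) r)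
    (h0 : φ 0 = 0) (h0' : φ' 0 = 0) (h2 : HasDerivAt φ' c 0) {ε : ℝ} (hε : 0 < ε) :
    ∀ᶠ r in 𝓝 0, |φ r - c / 2 * r ^ 2| ≤ ε * r ^ 2 := by
  have h3 := (hasDerivAt_iff_isLittleO_nhds_zero.1 h2).def hε
  simp only [zero_add, h0', sub_zero, smul_eq_mul, Real.norm_eq_abs] at h3
  obtain ⟨η, hη, hball⟩ := Metric.eventually_nhds_iff_ball.1 (hd.and h3)
  filter_upwards [Metric.ball_mem_nhds 0 hη] with r hr
  have hsub : ∀ x ∈ Metric.closedBall (0 : ℝ) |r|, x ∈ Metric.ball (0 : ℝ) η := fun x hx => by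
    rw [mem_closedBall_zero_iff, Real.norm_eq_abs] at hx
    rw [mem_ball_zero_iff, Real.norm_eq_abs] at *
    exact hx.trans_lt hr
  have h4 := Convex.norm_image_sub_le_of_norm_hasDerivWithin_le
    (f := fun r => φ r - c / 2 * r ^ 2) (f' := fun r => φ' r - c * r) (C := ε * |r|)
    (s := Metric.closedBall (0 : ℝ) |r|) (x := 0) (y := r) ?_ ?_ (convex_closedBall _ _) (by simp) (by simp)
  · simp only [h0, sub_zero, Real.norm_eq_abs] at h4
    rw [show ε * r ^ 2 = ε * |r| * |r| by rw [mul_assoc, ← sq, sq_abs]]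
    simpa using h4
  · intro x hx
    have := (hball x (hsub x hx)).1.sub ((hasDerivAt_pow 2 x).const_mul (c / 2))
    exact (this.congr_deriv (by simp; ring)).hasDerivWithinAt
  · intro x hx
    have h5 := (hball x (hsub x hx)).2
    rw [mem_closedBall_zero_iff, Real.norm_eq_abs] at hx
    rw [Real.norm_eq_abs, mul_comm c]
    exact h5.trans (by gcongr)

namespace IsA3Perestroika

variable {U : Set (Fin 4 → ℝ)} {g : MetricField 4} {τ : (Fin 4 → ℝ) → ℝ}

theorem eventually_time_line (H : IsA3Perestroika U g τ) {ε : ℝ} (hε : 0 < ε) :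
    ∀ᶠ r in 𝓝 (0 : ℝ), |τ ![r, 0, 0, 0] - pd 0 (pd 0 τ) 0 / 2 * r ^ 2| ≤ ε * r ^ 2 := by
  have hl0 : (![0, 0, 0, 0] : Fin 4 → ℝ) = 0 := by funext i; fin_cases i <;> simp
  have hline : ∀ r, HasDerivAt (fun s : ℝ => (![s, 0, 0, 0] : Fin 4 → ℝ)) (Pi.single 0 1) r := by
    intro r
    refine hasDerivAt_pi.2 fun i => ?_
    fin_cases i
    · simpa using hasDerivAt_id' _
    · simpa using hasDerivAt_const _ _
    · simpa using hasDerivAt_const _ _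
    · simpa using hasDerivAt_const _ _
  have key : ∀ (f : (Fin 4 → ℝ) → ℝ) (r : ℝ), ContDiffAt ℝ ∞ f ![r, 0, 0, 0] →
      HasDerivAt (fun s => f ![s, 0, 0, 0]) (pd 0 f ![r, 0, 0, 0]) r := by
    intro f r hf
    have hd := (hf.differentiableAt (by simp)).hasFDerivAt
    exact HasFDerivAt.comp_hasDerivAt (l := f) r hd (hline r)
  refine quadratic_expansion (φ := fun r => τ ![r, 0, 0, 0])
    (φ' := fun r => pd 0 τ ![r, 0, 0, 0]) ?_ ?_ ?_ ?_ hε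
  · have hU : ∀ᶠ r in 𝓝 (0 : ℝ), ![r, 0, 0, 0] ∈ U :=
      (hline 0).continuousAt.eventually_mem (H.isOpen.mem_nhds (by rw [hl0]; exact H.zero_mem))
    exact hU.mono fun r hr => key τ r (H.contDiffAt_time hr)
  · rw [hl0]; exact H.time_zero
  · rw [hl0]; exact H.tangency
  · have := key (pd 0 τ) 0 (by rw [hl0]; exact contDiffAt_pd 0 (H.contDiffAt_time H.zero_mem))
    rwa [hl0] at this

/-- Strict differentiability compares τ at the wavefront point with τ at (r, 0, 0, 0), so the error
is small relative to their distance O(p² + |q|) rather than to |r|. The x and z components are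
O(|p|(p² + |q|)), so only the y-term survives. -/
theorem eventually_time_bigWavefront (H : IsA3Perestroika U g τ) {ε : ℝ} (hε : 0 < ε) :
    ∀ᶠ v in 𝓝 (0 : ℝ × ℝ × ℝ), |τ (bigWavefront v.1 v.2.1 v.2.2)
      - pd 0 (pd 0 τ) 0 / 2 * v.1 ^ 2 - pd 2 τ 0 * v.2.2| ≤
        ε * (v.1 ^ 2 + v.2.1 ^ 2 + |v.2.2|) := by
  have hs : HasStrictFDerivAt τ (fderiv ℝ τ 0) 0 :=
    (H.contDiffAt_time H.zero_mem).hasStrictFDerivAt (by simp)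
  have h1 := hs.isLittleO.def (c := ε / 2) (by positivity)
  have hB : Tendsto (fun v : ℝ × ℝ × ℝ => bigWavefront v.1 v.2.1 v.2.2) (𝓝 0) (𝓝 0) := by
    have := continuous_bigWavefront.tendsto 0
    rwa [show bigWavefront (0 : ℝ × ℝ × ℝ).1 (0 : ℝ × ℝ × ℝ).2.1 (0 : ℝ × ℝ × ℝ).2.2 = 0 from
      bigWavefront_zero] at this
  have hl : Tendsto (fun v : ℝ × ℝ × ℝ => (![v.1, 0, 0, 0] : Fin 4 → ℝ)) (𝓝 0) (𝓝 0) := by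
    have hc : Continuous fun v : ℝ × ℝ × ℝ => (![v.1, 0, 0, 0] : Fin 4 → ℝ) := by
      refine continuous_pi fun i => ?_
      fin_cases i <;> dsimp <;> fun_prop
    have := hc.tendsto 0
    rwa [show (![(0 : ℝ × ℝ × ℝ).1, 0, 0, 0] : Fin 4 → ℝ) = 0 by
      funext i; fin_cases i <;> simp] at this
  have h2 := (hB.prodMk_nhds hl).eventually h1
  have h3 := (continuous_fst.tendsto (0 : ℝ × ℝ × ℝ)).eventually
    (H.eventually_time_line (ε := ε) hε)
  set m := |pd 1 τ 0| + |pd 3 τ 0| with hm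
  have hm0 : 0 ≤ m := by positivity
  -- The bound 1/4 keeps the x and z components below s = p² + |q|; the other bound keeps their
  -- contribution to dτ below (ε/2) s.
  have h4 : ∀ᶠ v in 𝓝 (0 : ℝ × ℝ × ℝ), |v.2.1| < min (1 / 4) (ε / (8 * (m + 1))) := by
    have hc : Continuous fun v : ℝ × ℝ × ℝ => |v.2.1| := by fun_prop
    exact hc.continuousAt.eventually_lt_const (by simp; positivity)
  filter_upwards [h2, h3, h4] with v k2 k3 k4
  obtain ⟨r, p, q⟩ := v
  simp only at k2 k3 k4 ⊢
  have p1 : |p| ≤ 1 / 4 := (k4.trans_le (min_le_left _ _)).le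
  have p2 : 4 * |p| * m ≤ ε / 2 := by
    have h5 : |p| ≤ ε / (8 * (m + 1)) := (k4.trans_le (min_le_right _ _)).le
    rw [le_div_iff₀ (by positivity)] at h5
    nlinarith [abs_nonneg p]
  set s := p ^ 2 + |q| with hsd
  have hs0 : 0 ≤ s := by positivity
  have hX : |4 * p ^ 3 - 2 * q * p| ≤ 4 * |p| * s := by
    have e1 : |4 * p ^ 3| = 4 * |p| * p ^ 2 := by
      rw [abs_mul, abs_pow, abs_of_pos (by norm_num : (0 : ℝ) < 4), ← sq_abs p]; ring
    have e2 : |2 * q * p| = 2 * |p| * |q| := by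
      rw [abs_mul, abs_mul, abs_of_pos (by norm_num : (0 : ℝ) < 2)]; ring
    have e3 := abs_sub (4 * p ^ 3) (2 * q * p)
    have e4 : 0 ≤ |p| * |q| := by positivity
    rw [hsd]
    nlinarith
  have hp2 : p ^ 2 ≤ |p| / 4 := by
    rw [← sq_abs]
    nlinarith [abs_nonneg p]
  have hZ : |3 * p ^ 4 - q * p ^ 2| ≤ 4 * |p| * s := by
    have e1 : |3 * p ^ 4| = 3 * p ^ 2 * p ^ 2 := by
      rw [abs_of_nonneg (by positivity)]; ring
    have e2 : |q * p ^ 2| = p ^ 2 * |q| := by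
      rw [abs_mul, abs_of_nonneg (sq_nonneg p)]; ring
    have e3 := abs_sub (3 * p ^ 4) (q * p ^ 2)
    have e4 : p ^ 2 * |q| ≤ |p| / 4 * |q| := by gcongr
    have e5 : p ^ 2 * p ^ 2 ≤ |p| / 4 * p ^ 2 := by gcongr
    have e6 : 0 ≤ |p| * |q| := by positivity
    have e7 : 0 ≤ |p| * p ^ 2 := by positivity
    rw [hsd]
    nlinarith
  have hdiff : bigWavefront r p q - ![r, 0, 0, 0]
      = ![0, 4 * p ^ 3 - 2 * q * p, q, 3 * p ^ 4 - q * p ^ 2] := by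
    funext i; fin_cases i <;> simp [bigWavefront]
  have hnorm : ‖bigWavefront r p q - ![r, 0, 0, 0]‖ ≤ s := by
    have h4s : 4 * |p| * s ≤ s := by nlinarith
    rw [hdiff, pi_norm_le_iff_of_nonneg hs0]
    intro i
    fin_cases i
    · simpa using hs0
    · exact hX.trans h4s
    · simp [hsd]; positivity
    · exact hZ.trans h4s
  have hL : fderiv ℝ τ 0 (bigWavefront r p q - ![r, 0, 0, 0])
      = (4 * p ^ 3 - 2 * q * p) * pd 1 τ 0 + q * pd 2 τ 0 + (3 * p ^ 4 - q * p ^ 2) * pd 3 τ 0 := by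
    rw [hdiff]
    have : (![0, 4 * p ^ 3 - 2 * q * p, q, 3 * p ^ 4 - q * p ^ 2] : Fin 4 → ℝ)
        = (4 * p ^ 3 - 2 * q * p) • Pi.single 1 1 + q • Pi.single 2 1
          + (3 * p ^ 4 - q * p ^ 2) • Pi.single 3 1 := by
      funext i; fin_cases i <;> simp
    rw [this]
    simp [pd]
  rw [hL, Real.norm_eq_abs] at k2
  have k5 := k2.trans (mul_le_mul_of_nonneg_left hnorm (by positivity))
  have k6 : |(4 * p ^ 3 - 2 * q * p) * pd 1 τ 0 + (3 * p ^ 4 - q * p ^ 2) * pd 3 τ 0|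
      ≤ ε / 2 * s := by
    refine (abs_add_le _ _).trans ?_
    rw [abs_mul, abs_mul]
    calc _ ≤ 4 * |p| * s * |pd 1 τ 0| + 4 * |p| * s * |pd 3 τ 0| := by gcongr
      _ = 4 * |p| * m * s := by rw [hm]; ring
      _ ≤ _ := by gcongr
  rw [abs_le] at *
  constructor <;> linarith [k5.1, k5.2, k6.1, k6.2, k3.1, k3.2]

/-- The expansion of the height `q = Q t u` of the cross-sections. -/
theorem eventually_height (H : IsA3Perestroika U g τ) {Q : ℝ → (Fin 2 → ℝ) → ℝ}
    (hQc : ContinuousAt (fun v : ℝ × (Fin 2 → ℝ) => Q v.1 v.2) (0, 0)) (hQ0 : Q 0 0 = 0)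
    (hQ : ∀ᶠ v in 𝓝 ((0, 0) : ℝ × (Fin 2 → ℝ)),
      τ (bigWavefront (v.2 1) (v.2 0) (Q v.1 v.2)) = v.1) {ε : ℝ} (hε : 0 < ε) :
    ∀ᶠ v in 𝓝 ((0, 0) : ℝ × (Fin 2 → ℝ)),
      |Q v.1 v.2 - (v.1 - pd 0 (pd 0 τ) 0 / 2 * v.2 1 ^ 2) / pd 2 τ 0|
        ≤ ε * (|v.1| + v.2 0 ^ 2 + v.2 1 ^ 2) := by
  have hy := H.pd_time_neg
  set y := pd 2 τ 0 with hyd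
  set A := pd 0 (pd 0 τ) 0 / 2 with hA
  have hy' : 0 < |y| := abs_pos.2 hy.ne
  set K := 1 + (1 + |A|) / |y| with hK
  have hK0 : 0 < K := by positivity
  have ht : Tendsto (fun v : ℝ × (Fin 2 → ℝ) => (v.2 1, v.2 0, Q v.1 v.2)) (𝓝 (0, 0))
      (𝓝 (0 : ℝ × ℝ × ℝ)) := by
    have c1 : ContinuousAt (fun v : ℝ × (Fin 2 → ℝ) => v.2 1) (0, 0) := by fun_prop
    have c0 : ContinuousAt (fun v : ℝ × (Fin 2 → ℝ) => v.2 0) (0, 0) := by fun_prop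
    have := (c1.prodMk (c0.prodMk hQc)).tendsto
    simp only [hQ0] at this
    exact this
  -- With E the predicted height, the error contains |q| ≤ |q − E| + |E|. The first bound absorbs |q
  -- − E| into the left side, and the second turns the resulting factor K into ε.
  have h1 := ht.eventually (H.eventually_time_bigWavefront
    (ε := min (|y| / 2) (ε * |y| / (2 * K))) (lt_min (by positivity) (by positivity)))
  filter_upwards [h1, hQ] with v k1 k2
  obtain ⟨t, u⟩ := v
  simp only at k1 k2 ⊢
  rw [k2] at k1
  set q := Q t u
  set ε' := min (|y| / 2) (ε * |y| / (2 * K)) with hε'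
  have e1 : ε' ≤ |y| / 2 := min_le_left _ _
  have e2 : ε' * (2 * K) ≤ ε * |y| := by
    rw [← le_div_iff₀ (by positivity)]; exact min_le_right _ _
  have e0 : 0 < ε' := lt_min (by positivity) (by positivity)
  set E := (t - A * u 1 ^ 2) / y with hE
  have hEy : t - A * u 1 ^ 2 = E * y := by rw [hE]; field_simp [hy.ne]
  have k3 : |q - E| * |y| ≤ ε' * (u 1 ^ 2 + u 0 ^ 2 + |q|) := by
    rw [hEy, show E * y - y * q = -((q - E) * y) by ring, abs_neg, abs_mul] at k1
    exact k1
  have k4 : |q| ≤ |q - E| + |E| := by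
    have := abs_add_le (q - E) E
    rwa [sub_add_cancel] at this
  have k5 : |E| ≤ (1 + |A|) / |y| * (|t| + u 0 ^ 2 + u 1 ^ 2) := by
    rw [hE, abs_div, div_mul_eq_mul_div (1 + |A|)]
    refine (div_le_div_iff_of_pos_right hy').2 ?_
    have h3 := abs_sub t (A * u 1 ^ 2)
    rw [abs_mul, abs_of_nonneg (sq_nonneg (u 1))] at h3
    nlinarith [abs_nonneg A, abs_nonneg t, sq_nonneg (u 0), sq_nonneg (u 1),
      mul_nonneg (abs_nonneg A) (abs_nonneg t), mul_nonneg (abs_nonneg A) (sq_nonneg (u 0))]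
  have k6 : |q - E| * |y| / 2 ≤ ε' * K * (|t| + u 0 ^ 2 + u 1 ^ 2) := by
    have h3 : ε' * |q - E| ≤ |y| / 2 * |q - E| := by gcongr
    have h4 : ε' * |q| ≤ ε' * (|q - E| + (1 + |A|) / |y| * (|t| + u 0 ^ 2 + u 1 ^ 2)) := by
      gcongr; linarith
    rw [hK]
    nlinarith [abs_nonneg t, mul_nonneg e0.le (abs_nonneg t)]
  have k7 : |q - E| * |y| ≤ ε * |y| * (|t| + u 0 ^ 2 + u 1 ^ 2) := by
    have h3 : ε' * (2 * K) * (|t| + u 0 ^ 2 + u 1 ^ 2) ≤ ε * |y| * (|t| + u 0 ^ 2 + u 1 ^ 2) := by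
      gcongr
    linarith
  nlinarith

end IsA3Perestroika

/-! ### Integrands that blow up like `1/Δ` -/

/-- A cone |r| ≤ k p lies in the smooth region, and there f is at least a multiple of 1/p². -/
theorem improperIntegralDiverges_of_div_Delta {Q f : (Fin 2 → ℝ) → ℝ} {a c K : ℝ} (ha : 0 < a)
    (hc : 0 < c) (hK : 0 < K) (hQ : ContinuousOn Q (window a))
    (hf : ContinuousOn f (smoothRegion Q a)) (hle : ∀ u ∈ smoothRegion Q a, c / Delta Q u ≤ f u)
    (hQK : ∀ u ∈ window a, |Q u| ≤ K * u 1 ^ 2 + u 0 ^ 2) :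
    ImproperIntegralDiverges f (smoothRegion Q a) := by
  refine improperIntegralDiverges_of_not_integrableOn hQ hf
    (fun u hu => (div_nonneg hc.le (Delta_pos hu).le).trans (hle u hu)) fun hi => ?_
  -- Then K k² ≤ 1/2, so on the cone |Q| ≤ 3p²/2 < 2p² and Δ ≤ 15p²; k ≤ 1 keeps the cone in the
  -- window.
  set k := min 1 (1 / (2 * K)) with hk
  have hk0 : 0 < k := lt_min one_pos (by positivity)
  have hk1 : k ≤ 1 := min_le_left _ _
  have hkK : K * k ^ 2 ≤ 1 / 2 := by
    have h1 : k ≤ 1 / (2 * K) := min_le_right _ _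
    rw [le_div_iff₀ (by positivity)] at h1
    nlinarith
  have hcone : ∀ u ∈ {u : Fin 2 → ℝ | u 0 ∈ Ioc 0 a ∧ |u 1| ≤ k * u 0},
      u ∈ smoothRegion Q a ∧ Delta Q u ≤ 15 * u 0 ^ 2 := by
    rintro u ⟨⟨h0, h1⟩, h2⟩
    have h3 : |u 1| ≤ u 0 := h2.trans (by nlinarith)
    have hw : u ∈ window a := ⟨by rwa [abs_of_pos h0], h3.trans h1⟩
    have h4 : u 1 ^ 2 ≤ k ^ 2 * u 0 ^ 2 := by
      rw [← sq_abs, ← mul_pow]; gcongr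
    have h5 : K * u 1 ^ 2 ≤ 1 / 2 * u 0 ^ 2 := by
      calc K * u 1 ^ 2 ≤ K * (k ^ 2 * u 0 ^ 2) := by gcongr
        _ = K * k ^ 2 * u 0 ^ 2 := by ring
        _ ≤ _ := by gcongr
    have h6 := abs_le.1 (hQK u hw)
    have h7 : 0 < u 0 ^ 2 := by positivity
    exact ⟨⟨hw.1, hw.2, by linarith [h6.2]⟩, by unfold Delta; linarith [h6.1]⟩
  refine not_integrableOn_cone ha hk0 ?_
  have hm : MeasurableSet {u : Fin 2 → ℝ | u 0 ∈ Ioc 0 a ∧ |u 1| ≤ k * u 0} :=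
    (measurable_pi_apply 0 measurableSet_Ioc).inter
      (measurableSet_le (f := fun u : Fin 2 → ℝ => |u 1|) (g := fun u : Fin 2 → ℝ => k * u 0)
        (by fun_prop) (by fun_prop))
  refine Integrable.mono' ((hi.mono_set fun u hu => (hcone u hu).1).const_mul (15 / c))
    (Measurable.aestronglyMeasurable (by fun_prop)) ?_
  refine (ae_restrict_iff' hm).2 (Eventually.of_forall fun u hu => ?_)
  obtain ⟨h1, h2⟩ := hcone u hu
  have h0 : 0 < u 0 := hu.1.1
  have h3 := hle u h1
  have h4 : c / (15 * u 0 ^ 2) ≤ f u :=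
    (div_le_div_of_nonneg_left hc.le (Delta_pos h1) h2).trans h3
  rw [Real.norm_eq_abs, abs_of_nonneg (by positivity)]
  calc (u 0 ^ 2)⁻¹ = 15 / c * (c / (15 * u 0 ^ 2)) := by field_simp
    _ ≤ _ := by gcongr

theorem le_modelDelta {b α k t : ℝ} (ht : 0 ≤ t) (u : Fin 2 → ℝ) :
    min b (min (α ^ 2) (k ^ 2)) * (|t| + u 0 ^ 2 + u 1 ^ 2) ≤ modelDelta b α k t u := by
  have h1 : min b (min (α ^ 2) (k ^ 2)) ≤ b := min_le_left _ _
  have h2 : min b (min (α ^ 2) (k ^ 2)) ≤ α ^ 2 := (min_le_right _ _).trans (min_le_left _ _)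
  have h3 : min b (min (α ^ 2) (k ^ 2)) ≤ k ^ 2 := (min_le_right _ _).trans (min_le_right _ _)
  rw [abs_of_nonneg ht, modelDelta, mul_add, mul_add]
  gcongr

theorem tendsto_integral_div_Delta {b α k a δ C : ℝ} {Q f : ℝ → (Fin 2 → ℝ) → ℝ}
    {Θ : ℝ × (Fin 2 → ℝ) → ℝ} (hb : 0 < b) (hα : 0 < α) (hk : 0 < k) (ha : 0 < a) (hδ : 0 < δ)
    (hΘ : ContinuousAt Θ (0, 0))
    (hΔ : ∀ ε > 0, ∀ᶠ v in 𝓝 ((0, 0) : ℝ × (Fin 2 → ℝ)), 0 < v.1 →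
      |Delta (Q v.1) v.2 - modelDelta b α k v.1 v.2| ≤ ε * modelDelta b α k v.1 v.2)
    (hi : ∀ t ∈ Ioo 0 δ, IntegrableOn (f t) (window a))
    (hf : ∀ t ∈ Ioo 0 δ, ∀ u ∈ window a, f t u = Θ (t, u) / Delta (Q t) u)
    (hM : ∀ t ∈ Ioo 0 δ, ∀ u ∈ window a, modelDelta b α k t u / 2 ≤ Delta (Q t) u)
    (hC : ∀ t ∈ Ioo 0 δ, ∀ u ∈ window a, |Θ (t, u)| ≤ C) :
    Tendsto (fun t => (∫ u in window a, f t u) / Real.log t) (𝓝[>] 0)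
      (𝓝 (-(Θ (0, 0) * (Real.pi / (k * α))))) := by
  -- The factor 2 comes from Δ being at least half of the model.
  refine tendsto_integral_div_log (B := 2 * C) hb hα hk ha hδ hi (fun t ht u hu => ?_)
    fun ε hε => ?_
  · have hm := modelDelta_pos (α := α) (k := k) hb ht.1 u
    have h1 := hM t ht u hu
    have h2 := hC t ht u hu
    rw [hf t ht u hu, abs_div, abs_of_pos (by linarith : 0 < Delta (Q t) u)]
    rw [div_le_div_iff₀ (by linarith) hm]
    have h0 : 0 ≤ C := (abs_nonneg _).trans h2
    nlinarith [mul_le_mul_of_nonneg_right h2 hm.le]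
  · set g := Θ (0, 0) with hg
    -- The variation of Θ and the error in Δ each contribute at most ε M/4 to the combined
    -- numerator, M being the model; as Δ ≥ M/2, the sum is at most ε Δ.
    have e1 : ∀ᶠ v in 𝓝 ((0, 0) : ℝ × (Fin 2 → ℝ)), |Θ v - g| ≤ ε / 4 :=
      (Metric.continuousAt_iff'.1 hΘ (ε / 4) (by positivity)).mono fun v hv => hv.le
    obtain ⟨s, hs, hball⟩ := Metric.eventually_nhds_iff_ball.1
      (e1.and (hΔ (ε / (4 * (|g| + 1))) (by positivity)))
    set η := min (s / 2) (min a (δ / 2)) with hη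
    have hη0 : 0 < η := lt_min (by positivity) (lt_min ha (by positivity))
    refine ⟨η, hη0, fun t ht u hu => ?_⟩
    have hηa : η ≤ a := (min_le_right _ _).trans (min_le_left _ _)
    have hηδ : η ≤ δ / 2 := (min_le_right _ _).trans (min_le_right _ _)
    have hηs : η ≤ s / 2 := min_le_left _ _
    have ht' : t ∈ Ioo 0 δ := ⟨ht.1, by linarith [ht.2]⟩
    have hu' : u ∈ window a := ⟨hu.1.trans hηa, hu.2.trans hηa⟩
    have hmem : (t, u) ∈ Metric.ball ((0, 0) : ℝ × (Fin 2 → ℝ)) s := by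
      rw [← ball_prod_same]
      refine ⟨?_, ?_⟩
      · rw [mem_ball_zero_iff, Real.norm_eq_abs, abs_of_pos ht.1]; linarith [ht.2]
      · rw [mem_ball_zero_iff, pi_norm_lt_iff hs, Fin.forall_fin_two]
        exact ⟨hu.1.trans_lt (by linarith), hu.2.trans_lt (by linarith)⟩
    obtain ⟨k1, k2⟩ := hball _ hmem
    have k2 := k2 ht.1
    simp only at k2
    have hm := modelDelta_pos (α := α) (k := k) hb ht.1 u
    have h1 := hM t ht' u hu'
    rw [hf t ht' u hu']
    set M := modelDelta b α k t u
    set D := Delta (Q t) u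
    have hD : 0 < D := by linarith
    have h3 : Θ (t, u) / D - g / M = ((Θ (t, u) - g) * M - g * (D - M)) / (D * M) := by
      field_simp; ring
    rw [h3, abs_div, abs_of_pos (mul_pos hD hm), div_le_div_iff₀ (mul_pos hD hm) hm]
    have h4 : |(Θ (t, u) - g) * M - g * (D - M)| ≤ ε / 4 * M + ε / 4 * M := by
      refine (abs_sub _ _).trans (add_le_add ?_ ?_)
      · rw [abs_mul, abs_of_pos hm]; gcongr
      · rw [abs_mul]
        calc |g| * |D - M| ≤ (|g| + 1) * (ε / (4 * (|g| + 1)) * M) := by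
              gcongr
              linarith
          _ = ε / 4 * M := by field_simp
    have h5 : |(Θ (t, u) - g) * M - g * (D - M)| ≤ ε * D := by
      have : ε * (M / 2) ≤ ε * D := by gcongr
      linarith
    nlinarith

namespace IsA3Perestroika

variable {U : Set (Fin 4 → ℝ)} {g : MetricField 4} {τ : (Fin 4 → ℝ) → ℝ}

/-- At the origin e = (0, 1, 0), ∂_1 F = (1, 0, 0) and the normal is (0, 0, −1), while the last
component of e grows like p; so ∂_0 e pairs with the normal to −1. -/
theorem traceSqFactor_pos {Ω : Set (ℝ × (Fin 2 → ℝ))} {V : Set (ℝ × (Fin 3 → ℝ))}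
    {h : ℝ → MetricField 3} {Q : ℝ → (Fin 2 → ℝ) → ℝ}
    (H : FoldedFamily Ω V h (fun t => sliceSurface (Q t)) (fun t => Delta (Q t))
      (fun t => sliceFold τ (Q t))) (h0 : (0, 0) ∈ Ω) (hQ : DifferentiableAt ℝ (Q 0) 0)
    (hQ0 : Q 0 0 = 0) :
    0 < traceSqFactor (h 0) (sliceSurface (Q 0)) (Delta (Q 0)) (sliceFold τ (Q 0)) 0 := by
  have d0 : DifferentiableAt ℝ (fun v : Fin 2 → ℝ => v 0) 0 := by fun_prop
  have hΔ : (fun t => Delta (Q t)) 0 0 = 0 := by simp [Delta, hQ0]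
  have key := FoldedFamily.traceSqFactor_pos (t := 0) (u := 0) H h0 hΔ
  refine key ?_
  have de : DifferentiableAt ℝ (fun v => sliceFold τ (Q 0) v 1) 0 :=
    SmoothFamily.differentiableAt (H.smooth_e 1) H.isOpen_dom h0
  -- The last component of e is p(1 + e₁)/2, so the differentiability of e₁ suffices and φ itself
  -- need not be differentiated.
  have e2 : pd 0 (fun v => sliceFold τ (Q 0) v 2) 0 = 1 := by
    have h1 : (fun v => sliceFold τ (Q 0) v 2)
        = fun v => v 0 * ((1 + sliceFold τ (Q 0) v 1) * 2⁻¹) := by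
      funext v; simp [sliceFold]; ring
    rw [h1]
    have h2 : sliceFold τ (Q 0) 0 1 = 1 := by simp [sliceFold]
    rw [pd_mul 0 d0 (by fun_prop), pd_coord, h2]
    norm_num
  have t0 : tangent (sliceSurface (Q 0)) 1 0 0 = 1 := by
    simp [tangent, sliceSurface, pd_coord]
  have t1 : tangent (sliceSurface (Q 0)) 1 0 1 = 0 := by
    simp only [tangent, sliceSurface]
    dsimp
    simp (disch := fun_prop) [pd_sub, pd_mul, pd_pow, pd_const, pd_coord]
  have t2 : tangent (sliceSurface (Q 0)) 1 0 2 = 0 := by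
    simp only [tangent, sliceSurface]
    dsimp
    simp (disch := fun_prop) [pd_sub, pd_mul, pd_pow, pd_const, pd_coord]
  rw [Fin.sum_univ_three, e2]
  simp [foldNormal, cross_apply, t0, t1, t2, sliceFold]

end IsA3Perestroika

theorem eventually_Delta_of_height {b κ : ℝ} {Q : ℝ → (Fin 2 → ℝ) → ℝ} (hb : 0 < b) (hκ : 0 < κ)
    (hQ : ∀ ε > 0, ∀ᶠ v in 𝓝 ((0, 0) : ℝ × (Fin 2 → ℝ)),
      |Q v.1 v.2 + b * v.1 + κ * v.2 1 ^ 2| ≤ ε * (|v.1| + v.2 0 ^ 2 + v.2 1 ^ 2))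
    {ε : ℝ} (hε : 0 < ε) : ∀ᶠ v in 𝓝 ((0, 0) : ℝ × (Fin 2 → ℝ)), 0 < v.1 →
      |Delta (Q v.1) v.2 - modelDelta (2 * b) √12 √(2 * κ) v.1 v.2|
        ≤ ε * modelDelta (2 * b) √12 √(2 * κ) v.1 v.2 := by
  have hα : √12 ^ 2 = (12 : ℝ) := Real.sq_sqrt (by norm_num)
  have hk : √(2 * κ) ^ 2 = 2 * κ := Real.sq_sqrt (by positivity)
  set m := min (2 * b) (min (√12 ^ 2) (√(2 * κ) ^ 2)) with hm
  have hm0 : 0 < m := by rw [hm, hα, hk]; positivity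
  filter_upwards [hQ (ε * m / 2) (by positivity)] with v hv ht
  have h1 := le_modelDelta (b := 2 * b) (α := √12) (k := √(2 * κ)) ht.le v.2
  rw [← hm] at h1
  have h2 : Delta (Q v.1) v.2 - modelDelta (2 * b) √12 √(2 * κ) v.1 v.2
      = -2 * (Q v.1 v.2 + b * v.1 + κ * v.2 1 ^ 2) := by
    rw [modelDelta, hα, hk, Delta]; ring
  rw [h2, abs_mul, abs_neg, abs_two]
  calc _ ≤ 2 * (ε * m / 2 * (|v.1| + v.2 0 ^ 2 + v.2 1 ^ 2)) := by gcongr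
    _ = ε * (m * (|v.1| + v.2 0 ^ 2 + v.2 1 ^ 2)) := by ring
    _ ≤ _ := by gcongr

/-- For t > 0 the terms −bt and −κr² dominate their errors and leave Q below p²: no crease remains
near the origin. -/
theorem eventually_lt_of_height {b κ : ℝ} {Q : ℝ → (Fin 2 → ℝ) → ℝ} (hb : 0 < b) (hκ : 0 < κ)
    (hQ : ∀ ε > 0, ∀ᶠ v in 𝓝 ((0, 0) : ℝ × (Fin 2 → ℝ)),
      |Q v.1 v.2 + b * v.1 + κ * v.2 1 ^ 2| ≤ ε * (|v.1| + v.2 0 ^ 2 + v.2 1 ^ 2)) :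
    ∀ᶠ v in 𝓝 ((0, 0) : ℝ × (Fin 2 → ℝ)), 0 < v.1 → Q v.1 v.2 < 2 * v.2 0 ^ 2 := by
  filter_upwards [hQ (min (b / 2) (min κ 1)) (by positivity)] with v hv ht
  have e1 : min (b / 2) (min κ 1) ≤ b / 2 := min_le_left _ _
  have e2 : min (b / 2) (min κ 1) ≤ κ := (min_le_right _ _).trans (min_le_left _ _)
  have e3 : min (b / 2) (min κ 1) ≤ 1 := (min_le_right _ _).trans (min_le_right _ _)
  have h1 := (abs_le.1 hv).2
  rw [abs_of_pos ht] at h1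
  have h2 := mul_le_mul_of_nonneg_right e1 ht.le
  have h3 := mul_le_mul_of_nonneg_right e2 (sq_nonneg (v.2 1))
  have h4 := mul_le_mul_of_nonneg_right e3 (sq_nonneg (v.2 0))
  have h5 : 0 < b * v.1 := mul_pos hb ht
  nlinarith [sq_nonneg (v.2 0)]

/-! ### Assembly of the perestroika statement -/

namespace IsA3Perestroika

variable {U : Set (Fin 4 → ℝ)} {g : MetricField 4} {τ : (Fin 4 → ℝ) → ℝ}

theorem exists_entropy (H : IsA3Perestroika U g τ) :
    ∃ a₀ > 0, ∃ ρ > 0, ∃ δ > 0, ∃ (C : ℝ) (Y : ℝ → (Fin 3 → ℝ) → ℝ)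
      (Q : ℝ → (Fin 2 → ℝ) → ℝ),
      IsSliceParam U τ a₀ ρ δ Y Q ∧
      (∀ t ∈ Ioo (-δ) δ, ∀ a ∈ Ioo 0 a₀,
        GaussBonnetRegular (pullback g (slice (Y t))) (sliceSurface (Q t)) (Q t) a C) ∧
      (∀ a ∈ Ioo 0 a₀,
        ImproperIntegralDiverges
          (traceSqDensity (pullback g (slice (Y 0))) (sliceSurface (Q 0)))
          (smoothRegion (Q 0) a) ∧
        ImproperIntegralDiverges
          (normSqDensity (pullback g (slice (Y 0))) (sliceSurface (Q 0)))
          (smoothRegion (Q 0) a)) ∧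
      (CreaseDisappears τ → ∃ c > 0, ∀ a ∈ Ioo 0 a₀, ∃ S₁ S₂ : ℝ → ℝ,
        (∀ t ∈ Ioo 0 δ,
          HasImproperIntegral
            (traceSqDensity (pullback g (slice (Y t))) (sliceSurface (Q t)))
            (smoothRegion (Q t) a) (S₁ t) ∧
          HasImproperIntegral
            (normSqDensity (pullback g (slice (Y t))) (sliceSurface (Q t)))
            (smoothRegion (Q t) a) (S₂ t)) ∧
        Tendsto (fun t => S₁ t / Real.log t) (𝓝[>] 0) (𝓝 (-c)) ∧
        Tendsto (fun t => S₂ t / Real.log t) (𝓝[>] 0) (𝓝 (-c))) := by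
  obtain ⟨r, hr, ρ, hρ, Y, Q, hS, hQ0, hQ⟩ := H.exists_slice
  have hSr := hS r ⟨hr, le_rfl⟩ r ⟨hr, le_rfl⟩
  have F := H.foldedFamily_slice hSr hQ
  set Ω := Ioo (-r) r ×ˢ Metric.ball (0 : Fin 2 → ℝ) r with hΩ
  have h0 : ((0, 0) : ℝ × (Fin 2 → ℝ)) ∈ Ω :=
    ⟨⟨neg_lt_zero.2 hr, hr⟩, Metric.mem_ball_self hr⟩
  have hn := F.isOpen_dom.mem_nhds h0
  have hQs : SmoothFamily Q Ω := hSr.smooth_Q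
  have hQc : ContinuousAt (fun v : ℝ × (Fin 2 → ℝ) => Q v.1 v.2) (0, 0) :=
    hQs.continuousOn.continuousAt hn
  have hΔ0 : (fun t => Delta (Q t)) 0 0 = 0 := by simp [Delta, hQ0]
  set Θ₁ : ℝ × (Fin 2 → ℝ) → ℝ := fun v => traceSqFactor (pullback g (slice (Y v.1)))
    (sliceSurface (Q v.1)) (Delta (Q v.1)) (sliceFold τ (Q v.1)) v.2 with hΘ₁
  set Θ₂ : ℝ × (Fin 2 → ℝ) → ℝ := fun v => normSqFactor (pullback g (slice (Y v.1)))
    (sliceSurface (Q v.1)) (Delta (Q v.1)) (sliceFold τ (Q v.1)) v.2 with hΘ₂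
  have c1 : ContinuousAt Θ₁ (0, 0) := F.continuousOn_traceSqFactor.continuousAt hn
  have c2 : ContinuousAt Θ₂ (0, 0) := F.continuousOn_normSqFactor.continuousAt hn
  have hd0 : DifferentiableAt ℝ (Q 0) 0 := SmoothFamily.differentiableAt hQs F.isOpen_dom h0
  have hpos := traceSqFactor_pos F h0 hd0 hQ0
  replace hpos : 0 < Θ₁ (0, 0) := hpos
  have h21 := FoldedFamily.normSqFactor_eq_traceSqFactor (t := 0) (u := 0)
    (h := fun t => pullback g (slice (Y t))) (F := fun t => sliceSurface (Q t))
    (Δ := fun t => Delta (Q t)) (e := fun t => sliceFold τ (Q t)) hΔ0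
  replace h21 : Θ₂ (0, 0) = Θ₁ (0, 0) := h21
  obtain ⟨C, hC⟩ := F.exists_boundedAt h0
  have hy := H.pd_time_neg
  have hE := fun {ε : ℝ} (hε : 0 < ε) => H.eventually_height hQc hQ0
    (by filter_upwards [hn] with v hv using (hQ v.1 hv.1 v.2 hv.2).2.1) hε
  set y := pd 2 τ 0 with hyd
  -- In these terms Q ≈ −b t − κ r². Always b > 0, since y < 0; κ > 0 exactly when τ has a
  -- nondegenerate maximum along the A₃ line.
  set κ := pd 0 (pd 0 τ) 0 / 2 / y with hκ
  set b := -y⁻¹ with hbd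
  have hb : 0 < b := neg_pos.2 (inv_lt_zero.2 hy)
  have hE' : ∀ ε > 0, ∀ᶠ v in 𝓝 ((0, 0) : ℝ × (Fin 2 → ℝ)),
      |Q v.1 v.2 + b * v.1 + κ * v.2 1 ^ 2| ≤ ε * (|v.1| + v.2 0 ^ 2 + v.2 1 ^ 2) := by
    intro ε hε
    filter_upwards [hE hε] with v hv
    convert hv using 2
    rw [hκ, hbd]; field_simp; ring
  have hcd : CreaseDisappears τ → 0 < κ := fun h =>
    div_pos_of_neg_of_neg (div_neg_of_neg_of_pos h two_pos) hy
  -- The case hypothesis is kept inside the filter, so that one radius serves both kinds of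
  -- perestroika.
  have E5 : ∀ᶠ v in 𝓝 ((0, 0) : ℝ × (Fin 2 → ℝ)), CreaseDisappears τ → 0 < v.1 →
      modelDelta (2 * b) √12 √(2 * κ) v.1 v.2 / 2 ≤ Delta (Q v.1) v.2 ∧
        Q v.1 v.2 < 2 * v.2 0 ^ 2 := by
    by_cases h : CreaseDisappears τ
    · filter_upwards [eventually_Delta_of_height hb (hcd h) hE' (ε := 1 / 2) (by norm_num),
        eventually_lt_of_height hb (hcd h) hE'] with v k1 k2 _ ht
      exact ⟨by linarith [(abs_le.1 (k1 ht)).1], k2 ht⟩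
    · exact Eventually.of_forall fun v hv => absurd hv h
  obtain ⟨s, hs, hball⟩ := Metric.eventually_nhds_iff_ball.1 (hC.and
    ((c1.eventually (lt_mem_nhds (half_lt_self hpos))).and
    ((c2.eventually (lt_mem_nhds (by rw [h21]; exact half_lt_self hpos))).and
    ((hE' 1 one_pos).and E5))))
  set a₀ := min r s with ha₀
  have ha₀0 : 0 < a₀ := lt_min hr hs
  have hgood : ∀ t ∈ Ioo (-a₀) a₀, ∀ a ∈ Ioo 0 a₀, ∀ u ∈ window a,
      (t, u) ∈ Ω ∧ (t, u) ∈ Metric.ball ((0, 0) : ℝ × (Fin 2 → ℝ)) s := by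
    intro t ht a ha u hu
    have h1 : |t| < a₀ := abs_lt.2 ht
    have h2 : ‖u‖ < a₀ := by
      rw [pi_norm_lt_iff ha₀0, Fin.forall_fin_two]
      exact ⟨hu.1.trans_lt ha.2, hu.2.trans_lt ha.2⟩
    refine ⟨⟨abs_lt.1 (h1.trans_le (min_le_left _ _)),
      mem_ball_zero_iff.2 (h2.trans_le (min_le_left _ _))⟩, ?_⟩
    rw [← ball_prod_same]
    exact ⟨mem_ball_zero_iff.2 (h1.trans_le (min_le_right _ _)),
      mem_ball_zero_iff.2 (h2.trans_le (min_le_right _ _))⟩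
  have hsub := fun t a => smoothRegion_subset_window (Q t) a
  have hQw : ∀ t ∈ Ioo (-a₀) a₀, ∀ a ∈ Ioo 0 a₀, ContinuousOn (Q t) (window a) :=
    fun t ht a ha => FoldedFamily.continuousOn_section hQs.continuousOn
      fun u hu => (hgood t ht a ha u hu).1
  have ct : ∀ t ∈ Ioo (-a₀) a₀, ∀ a ∈ Ioo 0 a₀, ContinuousOn
      (traceSqDensity (pullback g (slice (Y t))) (sliceSurface (Q t))) (smoothRegion (Q t) a) :=
    fun t ht a ha => F.continuousOn_traceSqDensity
      fun u hu => (hgood t ht a ha u (hsub t a hu)).1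
  have cn : ∀ t ∈ Ioo (-a₀) a₀, ∀ a ∈ Ioo 0 a₀, ContinuousOn
      (normSqDensity (pullback g (slice (Y t))) (sliceSurface (Q t))) (smoothRegion (Q t) a) :=
    fun t ht a ha => F.continuousOn_normSqDensity
      fun u hu => (hgood t ht a ha u (hsub t a hu)).1
  have et : ∀ t ∈ Ioo (-a₀) a₀, ∀ a ∈ Ioo 0 a₀, ∀ u ∈ smoothRegion (Q t) a,
      traceSqDensity (pullback g (slice (Y t))) (sliceSurface (Q t)) u
        = Θ₁ (t, u) / Delta (Q t) u := fun t ht a ha u hu =>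
    F.traceSqDensity_eq (hgood t ht a ha u (hsub t a hu)).1 (Delta_pos hu)
  have en : ∀ t ∈ Ioo (-a₀) a₀, ∀ a ∈ Ioo 0 a₀, ∀ u ∈ smoothRegion (Q t) a,
      normSqDensity (pullback g (slice (Y t))) (sliceSurface (Q t)) u
        = Θ₂ (t, u) / Delta (Q t) u := fun t ht a ha u hu =>
    F.normSqDensity_eq (hgood t ht a ha u (hsub t a hu)).1 (Delta_pos hu)
  refine ⟨a₀, ha₀0, ρ, hρ, a₀, ha₀0, C, Y, Q, hS a₀ ⟨ha₀0, min_le_left _ _⟩ a₀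
    ⟨ha₀0, min_le_left _ _⟩, fun t ht a ha => ?_, fun a ha => ?_, fun hcr => ?_⟩
  · exact F.gaussBonnetRegular (hQw t ht a ha) fun u hu =>
      (hball _ (hgood t ht a ha u ⟨hu.1, hu.2.1⟩).2).1
  · have z : (0 : ℝ) ∈ Ioo (-a₀) a₀ := ⟨neg_lt_zero.2 ha₀0, ha₀0⟩
    have hK : ∀ u ∈ window a, |Q 0 u| ≤ (|κ| + 1) * u 1 ^ 2 + u 0 ^ 2 := by
      intro u hu
      have h1 := (hball _ (hgood 0 z a ha u hu).2).2.2.2.1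
      simp only [mul_zero, add_zero, abs_zero, zero_add, one_mul] at h1
      have h2 := abs_sub (Q 0 u + κ * u 1 ^ 2) (κ * u 1 ^ 2)
      rw [add_sub_cancel_right, abs_mul, abs_of_nonneg (sq_nonneg (u 1))] at h2
      linarith
    refine ⟨improperIntegralDiverges_of_div_Delta (c := Θ₁ (0, 0) / 2) ha.1 (half_pos hpos)
      (by positivity) (hQw 0 z a ha) (ct 0 z a ha) (fun u hu => ?_) hK,
      improperIntegralDiverges_of_div_Delta (c := Θ₁ (0, 0) / 2) ha.1 (half_pos hpos)
      (by positivity) (hQw 0 z a ha) (cn 0 z a ha) (fun u hu => ?_) hK⟩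
    · rw [et 0 z a ha u hu]
      have := Delta_pos hu
      have h1 := (hball _ (hgood 0 z a ha u (hsub 0 a hu)).2).2.1
      gcongr
    · rw [en 0 z a ha u hu]
      have := Delta_pos hu
      have h1 := (hball _ (hgood 0 z a ha u (hsub 0 a hu)).2).2.2.1
      gcongr
  · have hκ0 := hcd hcr
    have hin : ∀ t ∈ Ioo 0 a₀, t ∈ Ioo (-a₀) a₀ := fun t ht =>
      ⟨by linarith [ht.1], ht.2⟩
    -- The logarithm arises at the origin alone, so the constant does not depend on a.
    refine ⟨Θ₁ (0, 0) * (Real.pi / (√(2 * κ) * √12)), by positivity, fun a ha => ?_⟩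
    have hreg : ∀ t ∈ Ioo 0 a₀, smoothRegion (Q t) a = window a := fun t ht =>
      Subset.antisymm (hsub t a) fun u hu => ⟨hu.1, hu.2,
        ((hball _ (hgood t (hin t ht) a ha u hu).2).2.2.2.2 hcr ht.1).2⟩
    have hM : ∀ t ∈ Ioo 0 a₀, ∀ u ∈ window a,
        modelDelta (2 * b) √12 √(2 * κ) t u / 2 ≤ Delta (Q t) u := fun t ht u hu =>
      ((hball _ (hgood t (hin t ht) a ha u hu).2).2.2.2.2 hcr ht.1).1
    have hΔε := fun ε (hε : ε > 0) => eventually_Delta_of_height hb hκ0 hE' hε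
    have it : ∀ t ∈ Ioo 0 a₀, IntegrableOn
        (traceSqDensity (pullback g (slice (Y t))) (sliceSurface (Q t))) (window a) :=
      fun t ht => (by rw [← hreg t ht]; exact ct t (hin t ht) a ha :
        ContinuousOn _ (window a)).integrableOn_compact (isCompact_window a)
    have jn : ∀ t ∈ Ioo 0 a₀, IntegrableOn
        (normSqDensity (pullback g (slice (Y t))) (sliceSurface (Q t))) (window a) :=
      fun t ht => (by rw [← hreg t ht]; exact cn t (hin t ht) a ha :
        ContinuousOn _ (window a)).integrableOn_compact (isCompact_window a)
    refine ⟨fun t => ∫ u in window a,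
        traceSqDensity (pullback g (slice (Y t))) (sliceSurface (Q t)) u,
      fun t => ∫ u in window a,
        normSqDensity (pullback g (slice (Y t))) (sliceSurface (Q t)) u, fun t ht => ?_, ?_, ?_⟩
    · have h1 := hasImproperIntegral_of_integrableOn (hQw t (hin t ht) a ha) (ct t (hin t ht) a ha)
        (by rw [hreg t ht]; exact it t ht)
      have h2 := hasImproperIntegral_of_integrableOn (hQw t (hin t ht) a ha) (cn t (hin t ht) a ha)
        (by rw [hreg t ht]; exact jn t ht)
      rw [hreg t ht] at h1 h2 ⊢
      exact ⟨h1, h2⟩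
    · exact tendsto_integral_div_Delta (Q := Q) (C := C) (by positivity) (by positivity)
        (by positivity) ha.1 ha₀0 c1 hΔε it
        (fun t ht u hu => et t (hin t ht) a ha u (by rw [hreg t ht]; exact hu)) hM
        fun t ht u hu => (hball _ (hgood t (hin t ht) a ha u hu).2).1.trace
    · rw [← h21]
      exact tendsto_integral_div_Delta (Q := Q) (C := C) (by positivity) (by positivity)
        (by positivity) ha.1 ha₀0 c2 hΔε jn
        (fun t ht u hu => en t (hin t ht) a ha u (by rw [hreg t ht]; exact hu)) hM
        fun t ht u hu => (hball _ (hgood t (hin t ht) a ha u hu).2).1.norm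

end IsA3Perestroika

end A3Caustic

theorem mainTheorem8 :
    -- a generic cross-section, with an isolated `A₃` point
    (∀ (U : Set (Fin 3 → ℝ)) (h : MetricField 3), IsOpen U → (0 : Fin 3 → ℝ) ∈ U →
      SmoothOn h U → (∀ x ∈ U, (h x).PosDef) →
      ∃ a₀ > 0, ∃ C : ℝ, ∀ a ∈ Ioo 0 a₀,
        MapsTo swallowtail (closedRegion (fun u => u 1) a) U ∧
        InjOn swallowtail (smoothRegion (fun u => u 1) a) ∧
        (∀ᶠ P in 𝓝[crossSection] (0 : Fin 3 → ℝ),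
          ∃ u ∈ closedRegion (fun u => u 1) a, P = swallowtail u) ∧
        GaussBonnetRegular h swallowtail (fun u => u 1) a C ∧
        (∃ S₁ : ℝ, HasImproperIntegral (traceSqDensity h swallowtail)
          (smoothRegion (fun u => u 1) a) S₁) ∧
        (∃ S₂ : ℝ, HasImproperIntegral (normSqDensity h swallowtail)
          (smoothRegion (fun u => u 1) a) S₂)) ∧
    -- an `A₃` perestroika
    (∀ (U : Set (Fin 4 → ℝ)) (g : MetricField 4) (τ : (Fin 4 → ℝ) → ℝ),
      IsA3Perestroika U g τ →
      ∃ a₀ > 0, ∃ ρ > 0, ∃ δ > 0, ∃ (C : ℝ) (Y : ℝ → (Fin 3 → ℝ) → ℝ)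
        (Q : ℝ → (Fin 2 → ℝ) → ℝ),
        IsSliceParam U τ a₀ ρ δ Y Q ∧
        (∀ t ∈ Ioo (-δ) δ, ∀ a ∈ Ioo 0 a₀,
          GaussBonnetRegular (pullback g (slice (Y t))) (sliceSurface (Q t)) (Q t) a C) ∧
        (∀ a ∈ Ioo 0 a₀,
          ImproperIntegralDiverges
            (traceSqDensity (pullback g (slice (Y 0))) (sliceSurface (Q 0)))
            (smoothRegion (Q 0) a) ∧
          ImproperIntegralDiverges
            (normSqDensity (pullback g (slice (Y 0))) (sliceSurface (Q 0)))
            (smoothRegion (Q 0) a)) ∧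
        (CreaseDisappears τ → ∃ c > 0, ∀ a ∈ Ioo 0 a₀, ∃ S₁ S₂ : ℝ → ℝ,
          (∀ t ∈ Ioo 0 δ,
            HasImproperIntegral
              (traceSqDensity (pullback g (slice (Y t))) (sliceSurface (Q t)))
              (smoothRegion (Q t) a) (S₁ t) ∧
            HasImproperIntegral
              (normSqDensity (pullback g (slice (Y t))) (sliceSurface (Q t)))
              (smoothRegion (Q t) a) (S₂ t)) ∧
          Tendsto (fun t => S₁ t / Real.log t) (𝓝[>] 0) (𝓝 (-c)) ∧
          Tendsto (fun t => S₂ t / Real.log t) (𝓝[>] 0) (𝓝 (-c)))) :=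
  ⟨genericCrossSection, fun _ _ _ H => H.exists_entropy⟩
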